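/- For $m\ge 1$ let $\Omega\mathbb{RP}^m$ be the space of continuous maps $\mathbb{RP}^1=\mathbb R\cup\{\infty\}\to\mathbb{RP}^m$ that send $\infty$ to $[1:\dots:1]$, with the compact-open topology. For $n\ge 0$ let $\mathrm{Rat}_n(\mathbb{RP}^m)\subseteq\Omega\mathbb{RP}^m$, with the subspace topology, be the closure of the set of all maps of the form $x\mapsto[p_0(x):\dots:p_m(x)]$, where $p_0,\dots,p_m$ are monic real polynomials of degree $n$ without a common root in $\mathbb C$. **Proposition.** For every integer $n>0$ the space $\mathrm{Rat}_n(\mathbb{RP}^2)$ is path-connected and, for every choice of base point, $$\pi_1\,\mathrm{Rat}_n(\mathbb{RP}^2)\cong\mathbb Z .$$ Moreover, if $n$ is odd, then $\mathrm{Rat}_1(\mathbb{RP}^2)\subseteq\mathrm{Rat}_n(\mathbb{RP}^2)$, and if $n$ is even, then $\mathrm{Rat}_2(\mathbb{RP}^2)\subseteq\mathrm{Rat}_n(\mathbb{RP}^2)$; in each case the inclusion induces an isomorphism of fundamental groups at every base point. -/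

import Mathlib

open Polynomial

namespace RationalLoops

/-- The real projective space `ℝP^m`: lines through the origin in `ℝ^(m+1)`. -/
def RP (m : ℕ) : Type := Projectivization ℝ (Fin (m + 1) → ℝ)

/-- `ℝP^m` carries the quotient topology from `ℝ^(m+1) \ {0}`. -/
instance (m : ℕ) : TopologicalSpace (RP m) :=
  inferInstanceAs (TopologicalSpace
    (Quotient (projectivizationSetoid ℝ (Fin (m + 1) → ℝ))))

/-- The point with homogeneous coordinates `[v 0 : ⋯ : v m]`. -/
noncomputable def RP.mk {m : ℕ} (v : Fin (m + 1) → ℝ) (hv : v ≠ 0) : RP m :=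
  Projectivization.mk ℝ v hv

/-- The point `[x : 1]` of the affine piece `ℝ ⊆ ℝP^1`. -/
noncomputable def affinePoint (x : ℝ) : RP 1 :=
  RP.mk ![x, 1] (fun h => one_ne_zero (congrFun h 1))

/-- The point `∞ = [1 : 0]`, the base point of `ℝP^1`. -/
noncomputable def infinity : RP 1 :=
  RP.mk ![1, 0] (fun h => one_ne_zero (congrFun h 0))

/-- The base point `[1 : 1 : ⋯ : 1]` of `ℝP^m`. -/
noncomputable def basePoint (m : ℕ) : RP m :=
  RP.mk (fun _ => 1) (fun h => one_ne_zero (congrFun h 0))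

/-- The loop space `Ω ℝP^m`: continuous maps `ℝP^1 → ℝP^m` sending `∞` to the base point,
with (the restriction of) the compact-open topology. -/
abbrev LoopRP (m : ℕ) : Type :=
  {f : C(RP 1, RP m) // f infinity = basePoint m}

/-- The based real rational maps of degree exactly `n`, restricted to the real axis and viewed
inside `Ω ℝP^m`: loops of the form `x ↦ [p 0 (x) : ⋯ : p m (x)]`, where `p 0, …, p m` are monic
real polynomials of degree `n` without a common root in `ℂ`. -/
def exactRat (n m : ℕ) : Set (LoopRP m) :=
  {f | ∃ p : Fin (m + 1) → ℝ[X],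
    (∀ i, (p i).Monic ∧ (p i).natDegree = n) ∧
    (∀ z : ℂ, ∃ i, aeval z (p i) ≠ 0) ∧
    ∀ x : ℝ, ∃ h : (fun i => (p i).eval x) ≠ 0,
      f.1 (affinePoint x) = RP.mk (fun i => (p i).eval x) h}

/-- The space `Rat_n(ℝP^m)` of real rational loops: the closure in `Ω ℝP^m` of the based real
rational maps of degree `n`.  As a type it has the subspace topology. -/
def rat (n m : ℕ) : Set (LoopRP m) :=
  closure (exactRat n m)

/-- The canonical inclusion `Rat_k(ℝP^m) → Rat_n(ℝP^m)`, when the first space is contained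
in the second. -/
def ratInclusion {k n m : ℕ} (h : rat k m ⊆ rat n m) : C(rat k m, rat n m) :=
  ⟨Set.inclusion h, continuous_inclusion h⟩

end RationalLoops

/-! A triple of monic real polynomials of degree n without common real zero is encoded as a pair (p,
F), where F is complex of degree < n and the triple is (p, p + Re F, p + Im F). Let T be the space
of these pairs (`ratTuple`). The proof replaces rational loops by T and then computes the
fundamental group of T.

From loops to T. A limit of rational loops is again given by polynomials: pass to a limit of
normalised coefficients, cancel common real zeros, read off the leading coefficients at infinity.
This may lower the degree, but only by an even number, so powers of x² + 1 restore it
(`exists_loopMap_eq`). Hence T maps onto the space of rational loops. The triples close in angle to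
a given loop, with a fixed choice of sign, form a convex set; a continuous selection from these sets
gives a homotopy inverse (`exists_homotopyEquiv`).

Generators. For fixed p the fibre of T is, by interpolation, a torus up to homotopy: only the values
of F at the real zeros of p matter. Near any point T contains a product large enough to push paths
into the contractible slice F = 1 followed by a fibre. So loops in fibres generate, and among them
suffice the circles F = 1 + (z - 1)e with e equal to 1 on the zeros right of some b and 0 on the
others. Such a circle survives as long as e ≠ 1/2 on the zeros of p, and moving (p, e) under this
restriction makes each circle either trivial or equal to one fixed circle
(`surjective_map_circleMap`, `joinedIn_base_odd`, `joinedIn_base_even`).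

Infinite order. Along the upper half of the circle of parameters, (p, F) is a path of nonzero
vectors of ℝ × ℂ = ℝ³ with fixed ends on the axis, so T maps to a path space of the 2-sphere, whose
fundamental group is ℤ. The class is detected by transporting a spinor along the path through
finitely many projections: the result is a nonzero complex number, and on the fixed circle it turns
once (`injective_map_of_spin`).

Multiplying by (x² + 1)^j carries the fixed circle for degree k to that for degree k + 2j up to
homotopy, which gives the statement on inclusions (`bijective_map_ratInclusion`). -/

namespace RationalLoops

section

open CategoryTheory unitInterval

/-! ### Fundamental groups by way of the fundamental groupoid -/

section FundamentalGroup

variable {X Y Z : Type*} [TopologicalSpace X] [TopologicalSpace Y] [TopologicalSpace Z]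

/-- The arrow of the fundamental groupoid represented by a path. -/
abbrev cls {x y : X} (γ : Path x y) : FundamentalGroupoid.mk x ⟶ FundamentalGroupoid.mk y :=
  Path.Homotopic.Quotient.mk γ

theorem cls_eq_iff {x y : X} {γ γ' : Path x y} : cls γ = cls γ' ↔ γ.Homotopic γ' :=
  Path.Homotopic.Quotient.eq

theorem cls_surjective {x y : X} (q : FundamentalGroupoid.mk x ⟶ FundamentalGroupoid.mk y) :
    ∃ γ : Path x y, cls γ = q :=
  Path.Homotopic.Quotient.mk_surjective q

theorem cls_trans {x y z : X} (γ : Path x y) (γ' : Path y z) :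
    cls (γ.trans γ') = cls γ ≫ cls γ' := rfl

theorem cls_refl (x : X) : cls (Path.refl x) = 𝟙 (FundamentalGroupoid.mk x) := rfl

theorem cls_symm {x y : X} (γ : Path x y) : cls γ.symm = Groupoid.inv (cls γ) := rfl

theorem groupMap_cls (f : C(X, Y)) {x : X} (γ : Path x x) :
    FundamentalGroup.map f x (cls γ) = cls (γ.map f.continuous) := rfl

theorem groupMap_comp_apply (g : C(Y, Z)) (f : C(X, Y)) (x : X) (q : FundamentalGroup X x) :
    FundamentalGroup.map (g.comp f) x q =
      FundamentalGroup.map g (f x) (FundamentalGroup.map f x q) := by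
  obtain ⟨γ, rfl⟩ := cls_surjective q
  rfl

theorem comp_mem {x : X} (R : Subgroup (FundamentalGroup X x))
    {p q : FundamentalGroupoid.mk x ⟶ FundamentalGroupoid.mk x}
    (hp : (p : FundamentalGroup X x) ∈ R) (hq : (q : FundamentalGroup X x) ∈ R) :
    ((p ≫ q : FundamentalGroupoid.mk x ⟶ FundamentalGroupoid.mk x) : FundamentalGroup X x) ∈ R :=
  R.mul_mem hq hp

/-- A criterion for a subgroup of the fundamental group to be everything. -/
theorem subgroup_eq_top_of_local {x₀ : X} (R : Subgroup (FundamentalGroup X x₀))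
    (A : ∀ x : X, Set (FundamentalGroupoid.mk x₀ ⟶ FundamentalGroupoid.mk x))
    (hne : ∀ x, (A x).Nonempty)
    (hR : ∀ x, ∀ a ∈ A x, ∀ b ∈ A x, ((a ≫ Groupoid.inv b :
      FundamentalGroupoid.mk x₀ ⟶ FundamentalGroupoid.mk x₀) : FundamentalGroup X x₀) ∈ R)
    (h₀ : 𝟙 _ ∈ A x₀)
    (hloc : ∀ x, ∃ U : Set X, IsOpen U ∧ x ∈ U ∧ ∀ (y z : X) (γ : Path y z), (∀ t, γ t ∈ U) →
      ∃ a ∈ A y, a ≫ cls γ ∈ A z) : R = ⊤ := by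
  -- An arrow is closed up to a loop at `x₀` by members of `A`. Since two members of `A x` differ by
  -- an element of `R`, closed-up arrows compose modulo `R`, so goodness passes from short pieces to
  -- the whole loop.
  let Good : ∀ {y z : X}, (FundamentalGroupoid.mk y ⟶ FundamentalGroupoid.mk z) → Prop :=
    fun {y z} q => ∀ a ∈ A y, ∀ b ∈ A z, ((a ≫ q ≫ Groupoid.inv b :
      FundamentalGroupoid.mk x₀ ⟶ FundamentalGroupoid.mk x₀) : FundamentalGroup X x₀) ∈ R
  have hcomp : ∀ {y z w : X} (q : FundamentalGroupoid.mk y ⟶ FundamentalGroupoid.mk z)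
      (q' : FundamentalGroupoid.mk z ⟶ FundamentalGroupoid.mk w), Good q → Good q' →
      Good (q ≫ q') := by
    intro y z w q q' h h' a ha b hb
    obtain ⟨m, hm⟩ := hne z
    have := comp_mem R (h a ha m hm) (h' m hm b hb)
    simpa using this
  have hid : ∀ y : X, Good (𝟙 (FundamentalGroupoid.mk y)) := by
    intro y a ha b hb
    simpa using hR y a ha b hb
  choose U hUo hxU hU using hloc
  have hlocal : ∀ (x y z : X) (γ : Path y z), (∀ t, γ t ∈ U x) → Good (cls γ) := by
    intro x y z γ hγ a ha b hb
    obtain ⟨a', ha', h'⟩ := hU x y z γ hγ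
    have := comp_mem R (hR _ a ha a' ha') (hR _ _ h' b hb)
    simpa using this
  rw [eq_top_iff]
  intro q _
  obtain ⟨γ, rfl⟩ := cls_surjective q
  obtain ⟨t, ht0, hmono, ⟨N, hN⟩, hsub⟩ := exists_monotone_Icc_subset_open_cover_unitInterval
    (c := fun x => γ ⁻¹' U x) (fun x => (hUo x).preimage γ.continuous)
    (fun s _ => Set.mem_iUnion.2 ⟨γ s, hxU (γ s)⟩)
  have key : ∀ k, Good (cls (γ.subpath 0 (t k))) := by
    intro k
    induction k with
    | zero =>
      rw [ht0, Path.subpath_self]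
      exact hid _
    | succ k ih =>
      obtain ⟨x, hx⟩ := hsub k
      have h1 : Good (cls (γ.subpath (t k) (t (k + 1)))) := by
        refine hlocal x _ _ _ fun s => ?_
        have : γ.subpath (t k) (t (k + 1)) s ∈ Set.range (γ.subpath (t k) (t (k + 1))) := ⟨s, rfl⟩
        rw [Path.range_subpath_of_le _ _ _ (hmono (Nat.le_succ k))] at this
        obtain ⟨r, hr, hr'⟩ := this
        rw [← hr']
        exact hx hr
      have h2 : cls (γ.subpath 0 (t (k + 1))) =
          cls (γ.subpath 0 (t k)) ≫ cls (γ.subpath (t k) (t (k + 1))) := by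
        rw [← cls_trans]
        exact (cls_eq_iff.2 ⟨Path.Homotopy.subpathTransSubpath γ _ _ _⟩).symm
      rw [h2]
      exact hcomp _ _ ih h1
  have hfin := key N
  rw [hN N le_rfl] at hfin
  have h1 : Good (cls γ) := by
    -- The subpath from 0 to 1 has the end points `γ 0` and `γ 1`, which equal `x₀` only
    -- propositionally.
    have h2 : ∀ (y z : X) (γ' : Path y z) (hy : y = x₀) (hz : z = x₀), (∀ s, γ' s = γ s) →
        Good (cls γ') → Good (cls γ) := by
      rintro y z γ' rfl rfl hs
      rw [show γ' = γ from Path.ext (funext hs)]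
      exact id
    refine h2 _ _ (γ.subpath 0 1) γ.source γ.target ?_ hfin
    intro s
    simp [Path.subpath]
  have h2 := h1 _ h₀ _ h₀
  have h3 : 𝟙 _ ≫ cls γ ≫ Groupoid.inv (𝟙 (FundamentalGroupoid.mk x₀)) = cls γ := by
    rw [Category.id_comp, show Groupoid.inv (𝟙 (FundamentalGroupoid.mk x₀)) = 𝟙 _ by simp,
      Category.comp_id]
  rwa [h3] at h2

/-- The two induced maps differ by conjugation with the track of the base point under the homotopy.
-/
theorem bijective_map_of_homotopic {f g : C(X, Y)} (h : f.Homotopic g) (x : X)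
    (hf : Function.Bijective (FundamentalGroup.map f x)) :
    Function.Bijective (FundamentalGroup.map g x) := by
  obtain ⟨H⟩ := h
  have key : ∀ q : FundamentalGroup X x, (FundamentalGroup.map g x q).toArrow =
      Groupoid.inv (cls (H.evalAt x)) ≫ (FundamentalGroup.map f x q).toArrow ≫
        cls (H.evalAt x) := by
    intro q
    have := (FundamentalGroupoidFunctor.homotopicMapsNatIso H).naturality q
    have e : (FundamentalGroup.map f x q).toArrow ≫ cls (H.evalAt x) =
        cls (H.evalAt x) ≫ (FundamentalGroup.map g x q).toArrow := this
    rw [e]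
    simp
  constructor
  · intro p q hpq
    apply hf.1
    have : (FundamentalGroup.map g x p).toArrow = (FundamentalGroup.map g x q).toArrow := hpq
    rw [key, key] at this
    have h2 := congrArg (fun w => cls (H.evalAt x) ≫ w ≫ Groupoid.inv (cls (H.evalAt x))) this
    simpa using h2
  · intro q
    obtain ⟨p, hp⟩ := hf.2 (FundamentalGroup.fromArrow
      (cls (H.evalAt x) ≫ q.toArrow ≫ Groupoid.inv (cls (H.evalAt x))))
    refine ⟨p, ?_⟩
    have := key p
    rw [hp] at this
    simpa using this

/-- Conjugation by a path from `x` to `y`, and by its image under `f`, identifies the two induced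
maps. -/
theorem bijective_map_of_joined (f : C(X, Y)) {x y : X} (h : Joined x y)
    (hf : Function.Bijective (FundamentalGroup.map f x)) :
    Function.Bijective (FundamentalGroup.map f y) := by
  obtain ⟨γ⟩ := h
  have key : ∀ q : FundamentalGroup X y, FundamentalGroup.map f x
      (FundamentalGroup.fromArrow (cls γ ≫ q.toArrow ≫ Groupoid.inv (cls γ))) =
      (cls (γ.map f.continuous) ≫ (FundamentalGroup.map f y q).toArrow ≫
        Groupoid.inv (cls (γ.map f.continuous)) :
        FundamentalGroupoid.mk (f x) ⟶ FundamentalGroupoid.mk (f x)) := by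
    intro q
    obtain ⟨δ, rfl⟩ := cls_surjective q
    rw [← cls_symm, ← cls_symm]
    change cls ((γ.trans (δ.trans γ.symm)).map f.continuous) =
      cls ((γ.map f.continuous).trans ((δ.map f.continuous).trans (γ.map f.continuous).symm))
    congr 1
    rw [Path.map_trans, Path.map_trans]
    rfl
  constructor
  · intro p q hpq
    have h1 : FundamentalGroup.map f x
      (FundamentalGroup.fromArrow (cls γ ≫ p.toArrow ≫ Groupoid.inv (cls γ))) =
      FundamentalGroup.map f x
      (FundamentalGroup.fromArrow (cls γ ≫ q.toArrow ≫ Groupoid.inv (cls γ))) := by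
      rw [key, key, hpq]
    have h2 : cls γ ≫ p.toArrow ≫ Groupoid.inv (cls γ) =
      cls γ ≫ q.toArrow ≫ Groupoid.inv (cls γ) := hf.1 h1
    have h3 := congrArg (fun w => Groupoid.inv (cls γ) ≫ w ≫ cls γ) h2
    simpa using h3
  · intro q
    obtain ⟨p, hp⟩ := hf.2 (FundamentalGroup.fromArrow
      (cls (γ.map f.continuous) ≫ q.toArrow ≫ Groupoid.inv (cls (γ.map f.continuous))))
    refine ⟨FundamentalGroup.fromArrow (Groupoid.inv (cls γ) ≫ p.toArrow ≫ cls γ), ?_⟩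
    have := key (FundamentalGroup.fromArrow (Groupoid.inv (cls γ) ≫ p.toArrow ≫ cls γ))
    have e : FundamentalGroup.fromArrow (cls γ ≫ (FundamentalGroup.fromArrow
      (Groupoid.inv (cls γ) ≫ p.toArrow ≫ cls γ)).toArrow ≫ Groupoid.inv (cls γ)) = p := by
      simp
    rw [e, hp] at this
    have h3 := congrArg (fun w : FundamentalGroupoid.mk (f x) ⟶ FundamentalGroupoid.mk (f x) =>
      Groupoid.inv (cls (γ.map f.continuous)) ≫ w ≫ cls (γ.map f.continuous)) this
    simpa using h3.symm

theorem bijective_map_of_homotopic_id (f : C(X, X)) (x : X) (hf : f.Homotopic (.id X)) :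
    Function.Bijective (FundamentalGroup.map f x) := by
  refine bijective_map_of_homotopic hf.symm x ?_
  have : ∀ q, FundamentalGroup.map (.id X) x q = q := by
    intro q
    obtain ⟨γ, rfl⟩ := cls_surjective q
    rfl
  exact ⟨fun p q h => by rwa [this, this] at h, fun q => ⟨q, this q⟩⟩

theorem bijective_map_homotopyEquiv (e : ContinuousMap.HomotopyEquiv X Y) (x : X) :
    Function.Bijective (FundamentalGroup.map e.toFun x) := by
  have h1 := bijective_map_of_homotopic_id _ x e.left_inv
  have h2 := bijective_map_of_homotopic_id _ (e.toFun x) e.right_inv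
  have c1 : ⇑(FundamentalGroup.map (e.invFun.comp e.toFun) x) =
      FundamentalGroup.map e.invFun (e.toFun x) ∘ FundamentalGroup.map e.toFun x :=
    funext (groupMap_comp_apply _ _ x)
  have c2 : ⇑(FundamentalGroup.map (e.toFun.comp e.invFun) (e.toFun x)) =
      FundamentalGroup.map e.toFun (e.invFun (e.toFun x)) ∘
        FundamentalGroup.map e.invFun (e.toFun x) :=
    funext (groupMap_comp_apply _ _ _)
  rw [c1] at h1
  rw [c2] at h2
  -- The two composites involve `e.toFun` at different base points, so the map to control first is
  -- the one they share: it is injective by one composite and surjective by the other.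
  have hinv : Function.Bijective (FundamentalGroup.map e.invFun (e.toFun x)) :=
    ⟨h2.1.of_comp, h1.2.of_comp⟩
  exact (Function.Bijective.of_comp_iff' hinv _).1 h1

end FundamentalGroup

end

section

open CategoryTheory unitInterval

/-! ### The circle and the punctured plane -/

section Circle

theorem nonempty_fundamentalGroup_circle_mulEquiv (z : Circle) :
    Nonempty (FundamentalGroup Circle z ≃* Multiplicative ℤ) := by
  obtain ⟨x, hx⟩ := Circle.isAddQuotientCoveringMap_exp.surjective z
  have hinj : Function.Injective (zmultiplesHom ℝ (2 * Real.pi)) := by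
    intro m n h
    have h' : (m : ℝ) * (2 * Real.pi) = n * (2 * Real.pi) := by simpa using h
    have := mul_right_cancel₀ (by positivity) h'
    exact_mod_cast this
  let e₁ := Circle.isAddQuotientCoveringMap_exp.fundamentalGroupEquiv (x := z) ⟨x, hx⟩
  let e₂ : ℤ ≃+ AddSubgroup.zmultiples (2 * Real.pi) :=
    (AddMonoidHom.ofInjective hinj).trans (AddEquiv.addSubgroupCongr
      (AddSubgroup.range_zmultiplesHom _))
  -- The covering yields the period group with opposite multiplication, which is harmless because
  -- the group is commutative.
  let e₃ : Multiplicative (AddSubgroup.zmultiples (2 * Real.pi)) ≃*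
      (Multiplicative (AddSubgroup.zmultiples (2 * Real.pi)))ᵐᵒᵖ := MulOpposite.opMulEquiv
  exact ⟨e₁.trans (e₃.symm.trans (AddEquiv.toMultiplicative e₂.symm))⟩

theorem continuous_circle_coe : Continuous fun z : Circle => (z : ℂ) := by fun_prop

/-- The inclusion of the circle into the punctured plane. -/
noncomputable def circleUnits : C(Circle, ℂˣ) where
  toFun := Circle.toUnits
  continuous_toFun := by
    refine Units.continuous_iff.2 ⟨continuous_circle_coe, ?_⟩
    have : Continuous fun z : Circle => ((z⁻¹ : Circle) : ℂ) :=
      continuous_circle_coe.comp continuous_inv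
    simpa [Function.comp_def] using this

@[simp] theorem circleUnits_coe (z : Circle) : ((circleUnits z : ℂˣ) : ℂ) = z := rfl

/-- The radial retraction of the punctured plane onto the circle. -/
noncomputable def unitsCircle : C(ℂˣ, Circle) where
  toFun z := ⟨(z : ℂ) / ‖(z : ℂ)‖, by simp [Submonoid.unitSphere]⟩
  continuous_toFun := by
    refine Continuous.subtype_mk ?_ _
    refine Units.continuous_val.div (Complex.continuous_ofReal.comp
      (continuous_norm.comp Units.continuous_val)) fun z => ?_
    simp

@[simp] theorem unitsCircle_coe (z : ℂˣ) : ((unitsCircle z : Circle) : ℂ) = z / ‖(z : ℂ)‖ := rfl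

/-- A continuous family of nonzero complex numbers, as a map to the units. -/
noncomputable def unitsMap {X : Type*} [TopologicalSpace X] (f : X → ℂ) (hf : Continuous f)
    (h0 : ∀ x, f x ≠ 0) : C(X, ℂˣ) where
  toFun x := Units.mk0 (f x) (h0 x)
  continuous_toFun := Units.continuous_iff.2 ⟨hf, (hf.inv₀ h0).congr fun x => by simp⟩

/-- The circle is homotopy equivalent to the punctured plane. -/
noncomputable def circleHomotopyEquiv : ContinuousMap.HomotopyEquiv Circle ℂˣ where
  toFun := circleUnits
  invFun := unitsCircle
  left_inv := by
    have : unitsCircle.comp circleUnits = .id Circle := by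
      ext z
      simp [Circle.norm_coe]
    rw [this]
  right_inv := by
    have h0 : ∀ q : I × ℂˣ, ((q.2 : ℂ)) * (((q.1 : ℝ) + (1 - (q.1 : ℝ)) / ‖(q.2 : ℂ)‖ : ℝ) : ℂ)
        ≠ 0 := by
      rintro ⟨s, z⟩
      have hz : 0 < ‖(z : ℂ)‖ := by simp
      refine mul_ne_zero z.ne_zero (Complex.ofReal_ne_zero.2 ?_)
      rcases eq_or_lt_of_le s.2.1 with h | h
      · simp [← h]
      · have : 0 ≤ (1 - (s : ℝ)) / ‖(z : ℂ)‖ := div_nonneg (by linarith [s.2.2]) hz.le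
        change (s : ℝ) + (1 - (s : ℝ)) / ‖(z : ℂ)‖ ≠ 0
        positivity
    have hc : Continuous fun q : I × ℂˣ =>
        ((q.2 : ℂ)) * (((q.1 : ℝ) + (1 - (q.1 : ℝ)) / ‖(q.2 : ℂ)‖ : ℝ) : ℂ) := by
      have h2 : Continuous fun q : I × ℂˣ => (q.2 : ℂ) := Units.continuous_val.comp continuous_snd
      have h1 : Continuous fun q : I × ℂˣ => (q.1 : ℝ) := continuous_subtype_val.comp continuous_fst
      refine h2.mul (Complex.continuous_ofReal.comp (h1.add ((continuous_const.sub h1).div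
        (continuous_norm.comp h2) fun q => ?_)))
      simp
    refine ⟨⟨unitsMap _ hc h0, fun z => ?_, fun z => ?_⟩⟩
    · ext
      simp [unitsMap, div_eq_mul_inv]
    · ext
      simp [unitsMap]

theorem exists_circle_loop (u : Path (1 : ℂˣ) 1) :
    ∃ ℓ : Path (1 : Circle) 1, ∃ γ : Path (1 : ℂˣ) 1, (∀ t, γ t = circleUnits (ℓ t)) ∧
      u.Homotopic γ := by
  obtain ⟨q, hq⟩ := (bijective_map_homotopyEquiv circleHomotopyEquiv (1 : Circle)).2
    (cls (u.cast (map_one Circle.toUnits) (map_one Circle.toUnits)))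
  obtain ⟨ℓ, rfl⟩ := cls_surjective q
  have h := cls_eq_iff.1 hq
  refine ⟨ℓ, (ℓ.map circleUnits.continuous).cast (map_one Circle.toUnits).symm
    (map_one Circle.toUnits).symm, fun t => rfl, ?_⟩
  exact (h.symm.pathCast (map_one Circle.toUnits).symm (map_one Circle.toUnits).symm)

end Circle

/-! ### Loops in topological groups and in tori -/

section GroupLoops

variable {T : Type*} [TopologicalSpace T] [Group T] [IsTopologicalGroup T]

/-- The Eckmann–Hilton argument: delay `δ` and finish `γ` early by constant loops, and the pointwise
product becomes the concatenation. -/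
theorem cls_mul_loops (γ δ ε : Path (1 : T) 1) (h : ∀ t, ε t = γ t * δ t) :
    cls ε = cls γ ≫ cls δ := by
  rw [← cls_trans, cls_eq_iff]
  have h1 : (γ.trans (Path.refl 1)).Homotopic γ := ⟨Path.Homotopy.transRefl γ⟩
  have h2 : ((Path.refl 1).trans δ).Homotopic δ := ⟨Path.Homotopy.reflTrans δ⟩
  have h3 : ((γ.trans (Path.refl 1)).prod ((Path.refl 1).trans δ)).Homotopic (γ.prod δ) :=
    ⟨Path.Homotopic.prodHomotopy h1.some h2.some⟩
  have h4 := h3.map ⟨fun q : T × T => q.1 * q.2, continuous_mul⟩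
  have h5 := h4.pathCast (show (1 : T) = 1 * 1 by simp) (show (1 : T) = 1 * 1 by simp)
  have e1 : ε = ((γ.prod δ).map (f := fun q : T × T => q.1 * q.2) continuous_mul).cast
      (show (1 : T) = 1 * 1 by simp) (show (1 : T) = 1 * 1 by simp) :=
    Path.ext (_root_.funext fun t => h t)
  have e2 : (((γ.trans (Path.refl 1)).prod ((Path.refl 1).trans δ)).map
      (f := fun q : T × T => q.1 * q.2) continuous_mul).cast
      (show (1 : T) = 1 * 1 by simp) (show (1 : T) = 1 * 1 by simp) = γ.trans δ := by
    refine Path.ext (_root_.funext fun t => ?_)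
    simp only [Path.cast_coe, Path.map_coe, Function.comp_apply, Path.prod_coe,
      Path.trans_apply]
    split_ifs <;> simp
  rw [e1, ← e2]
  exact h5.symm

theorem loop_pi_homotopic {ι : Type*} {X : ι → Type*} [∀ i, TopologicalSpace (X i)]
    {x y : ∀ i, X i} (γ δ : Path x y)
    (h : ∀ i, (γ.map (continuous_apply i)).Homotopic (δ.map (continuous_apply i))) :
    γ.Homotopic δ := by
  have := (⟨Path.Homotopic.piHomotopy (fun i => γ.map (continuous_apply i))
    (fun i => δ.map (continuous_apply i)) fun i => (h i).some⟩ : Path.Homotopic _ _)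
  exact this

/-- The quotient of the threshold loops just below and just above `v a` moves the coordinate `a`
alone, and such loops generate. Thresholds are used because they lead to polynomial circles that can
be brought to a normal form. -/
theorem subgroup_loops_torus_eq_top {ι : Type*} [Finite ι] (v : ι → ℝ)
    (hv : Function.Injective v) (R : Subgroup (FundamentalGroup (ι → ℂˣ) 1))
    (h : ∀ b : ℝ, (∀ a, v a ≠ b) → ∀ (γ : Path (1 : ι → ℂˣ) 1) (ℓ : Path (1 : Circle) 1),
      (∀ t a, γ t a = if b < v a then circleUnits (ℓ t) else 1) →
      (cls γ : FundamentalGroup (ι → ℂˣ) 1) ∈ R) : R = ⊤ := by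
  classical
  rw [eq_top_iff]
  intro q _
  obtain ⟨γ, rfl⟩ := cls_surjective q
  have hu : ∀ a, ∃ ℓ : Path (1 : Circle) 1, ∃ δ : Path (1 : ℂˣ) 1,
      (∀ t, δ t = circleUnits (ℓ t)) ∧ (γ.map (continuous_apply a)).Homotopic δ :=
    fun a => exists_circle_loop (γ.map (continuous_apply a))
  choose ℓ δ hδ hhom using hu
  have c1 : circleUnits 1 = 1 := map_one Circle.toUnits
  have hcont : ∀ P : ι → Prop, [DecidablePred P] → ∀ m : ι → Path (1 : Circle) 1,
      Continuous fun t : I => fun a => if P a then circleUnits (m a t) else 1 := by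
    intro P _ m
    refine continuous_pi fun a => ?_
    split_ifs
    · exact circleUnits.continuous.comp (m a).continuous
    · exact continuous_const
  let G : ∀ (P : ι → Prop) [DecidablePred P] (m : ι → Path (1 : Circle) 1), Path (1 : ι → ℂˣ) 1 :=
    fun P _ m => ⟨⟨_, hcont P m⟩, by ext a; simp [c1], by ext a; simp [c1]⟩
  have hGapp : ∀ (P : ι → Prop) [DecidablePred P] (m : ι → Path (1 : Circle) 1) t a,
      G P m t a = if P a then circleUnits (m a t) else 1 := fun P _ m t a => rfl
  have hsingle : ∀ a (m : ι → Path (1 : Circle) 1),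
      (cls (G (fun i => i = a) m) : FundamentalGroup (ι → ℂˣ) 1) ∈ R := by
    intro a m
    -- Between the thresholds `v a - ε` and `v a + ε` lies no other value of `v`.
    obtain ⟨ε, hε, hiso⟩ : ∃ ε > 0, ∀ i, i ≠ a → ε < |v i - v a| := by
      by_cases hne : ∃ i, i ≠ a
      · have : Nonempty {i // i ≠ a} := hne.elim fun i hi => ⟨⟨i, hi⟩⟩
        obtain ⟨i₀, hi₀⟩ := Finite.exists_min fun i : {i // i ≠ a} => |v i - v a|
        have hp : 0 < |v i₀ - v a| := abs_pos.2 (sub_ne_zero.2 (hv.ne i₀.2))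
        exact ⟨|v i₀ - v a| / 2, by linarith, fun i hi => by linarith [hi₀ ⟨i, hi⟩]⟩
      · exact ⟨1, one_pos, fun i hi => (hne ⟨i, hi⟩).elim⟩
    have hb1 : ∀ i, v i ≠ v a - ε := by
      intro i hi
      by_cases h' : i = a
      · subst h'; linarith
      · have := hiso i h'
        rw [hi, show v a - ε - v a = -ε by ring, abs_neg, abs_of_pos hε] at this
        exact lt_irrefl _ this
    have hb2 : ∀ i, v i ≠ v a + ε := by
      intro i hi
      by_cases h' : i = a
      · subst h'; linarith
      · have := hiso i h'
        rw [hi, show v a + ε - v a = ε by ring, abs_of_pos hε] at this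
        exact lt_irrefl _ this
    have m1 := h _ hb1 (G (fun i => v a - ε < v i) fun _ => m a) (m a) fun t i => rfl
    have m2 := h _ hb2 (G (fun i => v a + ε < v i) fun _ => m a) (m a) fun t i => rfl
    have e : cls (G (fun i => v a - ε < v i) fun _ => m a) =
        cls (G (fun i => i = a) m) ≫ cls (G (fun i => v a + ε < v i) fun _ => m a) := by
      refine cls_mul_loops _ _ _ fun t => _root_.funext fun i => ?_
      rw [Pi.mul_apply, hGapp, hGapp, hGapp]
      by_cases h' : i = a
      · subst h'
        simp [hε, hε.le]
      · have := hiso i h'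
        rcases lt_abs.1 this with h2 | h2
        · rw [if_pos (by linarith), if_neg h', if_pos (by linarith), one_mul]
        · rw [if_neg (by linarith), if_neg h', if_neg (by linarith), one_mul]
    have e2 : cls (G (fun i => i = a) m) = cls (G (fun i => v a - ε < v i) fun _ => m a) ≫
        Groupoid.inv (cls (G (fun i => v a + ε < v i) fun _ => m a)) := by
      rw [e]; simp
    rw [e2]
    exact comp_mem R m1 (R.inv_mem m2)
  have hS : ∀ S : Finset ι, (cls (G (fun i => i ∈ S) ℓ) : FundamentalGroup (ι → ℂˣ) 1) ∈ R := by
    intro S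
    induction S using Finset.induction_on with
    | empty =>
      have : G (fun i => i ∈ (∅ : Finset ι)) ℓ = Path.refl 1 := by
        ext t a; simp [hGapp]
      rw [this]
      exact R.one_mem
    | insert a S ha ih =>
      have e : cls (G (fun i => i ∈ insert a S) ℓ) =
          cls (G (fun i => i = a) ℓ) ≫ cls (G (fun i => i ∈ S) ℓ) := by
        refine cls_mul_loops _ _ _ fun t => _root_.funext fun i => ?_
        rw [Pi.mul_apply, hGapp, hGapp, hGapp]
        by_cases h' : i = a
        · subst h'; simp [ha]
        · simp [h']
      rw [e]
      exact comp_mem R (hsingle a ℓ) ih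
  have := Fintype.ofFinite ι
  have e : cls γ = cls (G (fun i => i ∈ (Finset.univ : Finset ι)) ℓ) := by
    rw [cls_eq_iff]
    refine loop_pi_homotopic _ _ fun a => (hhom a).trans ?_
    have : (G (fun i => i ∈ (Finset.univ : Finset ι)) ℓ).map (continuous_apply a) = δ a := by
      refine Path.ext (_root_.funext fun t => ?_)
      rw [hδ]
      simp [hGapp]
    rw [← this]
  rw [e]
  exact hS _

end GroupLoops

end

section

open unitInterval

/-! ### Binary forms with prescribed coefficients -/

section Evaluation

variable {n : ℕ} {M : Type*} [AddCommGroup M] [Module ℝ M]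

/-- The value at `(u, v)` of the degree `n` form with coefficients `c 0, …, c (n - 1)`, and
vanishing coefficient of `u ^ n`. -/
def hev (c : Fin n → M) (u v : ℝ) : M := ∑ i : Fin n, (u ^ (i : ℕ) * v ^ (n - (i : ℕ))) • c i

/-- The value at `(u, v)` of the degree `n` form with coefficients `a 0, …, a (n - 1), 1`. -/
def pev (a : Fin n → ℝ) (u v : ℝ) : ℝ := u ^ n + hev a u v

theorem hev_add (c d : Fin n → M) (u v : ℝ) : hev (c + d) u v = hev c u v + hev d u v := by
  simp [hev, Finset.sum_add_distrib]

theorem hev_zero (u v : ℝ) : hev (0 : Fin n → M) u v = 0 := by simp [hev]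

theorem hev_smul {S : Type*} [Monoid S] [DistribMulAction S M] [SMulCommClass ℝ S M] (s : S)
    (c : Fin n → M) (u v : ℝ) : hev (s • c) u v = s • hev c u v := by
  rw [hev, hev, Finset.smul_sum]
  exact Finset.sum_congr rfl fun i _ => smul_comm _ s _

theorem hev_sum {ι : Type*} (S : Finset ι) (c : ι → Fin n → M) (u v : ℝ) :
    hev (∑ i ∈ S, c i) u v = ∑ i ∈ S, hev (c i) u v := by
  classical
  induction S using Finset.induction_on with
  | empty => simp [hev_zero]
  | insert a S ha ih => rw [Finset.sum_insert ha, Finset.sum_insert ha, hev_add, ih]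

theorem hev_ofReal (e : Fin n → ℝ) (u v : ℝ) :
    hev (fun i => (e i : ℂ)) u v = ((hev e u v : ℝ) : ℂ) := by
  simp [hev]

theorem pev_combo (a b : Fin n → ℝ) {s t : ℝ} (h : s + t = 1) (u v : ℝ) :
    pev (s • a + t • b) u v = s * pev a u v + t * pev b u v := by
  rw [pev, hev_add, hev_smul, hev_smul, pev, pev, smul_eq_mul, smul_eq_mul]
  linear_combination (-u ^ n) * h

theorem hev_homog (c : Fin n → M) (l u v : ℝ) : hev c (l * u) (l * v) = l ^ n • hev c u v := by
  rw [hev, hev, Finset.smul_sum]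
  refine Finset.sum_congr rfl fun i _ => ?_
  rw [smul_smul]
  congr 1
  rw [mul_pow, mul_pow]
  have : l ^ n = l ^ (i : ℕ) * l ^ (n - (i : ℕ)) := by
    rw [← pow_add]; congr 1; have := i.2; omega
  rw [this]; ring

theorem pev_homog (a : Fin n → ℝ) (l u v : ℝ) : pev a (l * u) (l * v) = l ^ n * pev a u v := by
  rw [pev, hev_homog, pev, mul_pow, smul_eq_mul]; ring

theorem hev_infinity (c : Fin n → M) (u : ℝ) : hev c u 0 = 0 := by
  refine Finset.sum_eq_zero fun i _ => ?_
  rw [zero_pow (by have := i.2; omega), mul_zero, zero_smul]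

theorem pev_infinity (a : Fin n → ℝ) (u : ℝ) : pev a u 0 = u ^ n := by
  rw [pev, hev_infinity, add_zero]

theorem hev_eq_pow_smul (c : Fin n → M) (u : ℝ) {v : ℝ} (hv : v ≠ 0) :
    hev c u v = v ^ n • hev c (u / v) 1 := by
  rw [← hev_homog, mul_div_cancel₀ _ hv, mul_one]

theorem pev_eq_pow_mul (a : Fin n → ℝ) (u : ℝ) {v : ℝ} (hv : v ≠ 0) :
    pev a u v = v ^ n * pev a (u / v) 1 := by
  rw [← pev_homog, mul_div_cancel₀ _ hv, mul_one]

theorem continuous_hev [TopologicalSpace M] [ContinuousAdd M] [ContinuousSMul ℝ M] {X : Type*}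
    [TopologicalSpace X] {c : X → Fin n → M} {u v : X → ℝ} (hc : Continuous c)
    (hu : Continuous u) (hv : Continuous v) : Continuous fun x => hev (c x) (u x) (v x) := by
  unfold hev
  exact continuous_finsetSum _ fun i _ =>
    ((hu.pow _).mul (hv.pow _)).smul ((continuous_apply i).comp hc)

theorem continuous_pev {X : Type*} [TopologicalSpace X] {a : X → Fin n → ℝ} {u v : X → ℝ}
    (ha : Continuous a) (hu : Continuous u) (hv : Continuous v) :
    Continuous fun x => pev (a x) (u x) (v x) :=
  (hu.pow n).add (continuous_hev ha hu hv)

end Evaluation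

/-! ### Coefficient vectors, real zeros and interpolation -/

section Polynomials

variable {n : ℕ}

/-- The vector of the first `n` coefficients. -/
def coef {R : Type*} [Semiring R] (n : ℕ) (P : R[X]) : Fin n → R := fun i => P.coeff i

theorem hev_coef_real (P : ℝ[X]) (hP : P.degree < n) (x : ℝ) :
    hev (coef n P) x 1 = P.eval x := by
  have : P ∈ degreeLT ℝ n := mem_degreeLT.2 hP
  rcases eq_or_ne P 0 with rfl | h0
  · simp [hev, coef]
  rw [eval_eq_sum_range' ((natDegree_lt_iff_degree_lt h0).2 hP), Finset.sum_range, hev]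
  refine Finset.sum_congr rfl fun i _ => ?_
  simp [coef, mul_comm]

theorem hev_coef_complex (P : ℂ[X]) (hP : P.degree < n) (x : ℝ) :
    hev (coef n P) x 1 = P.eval (x : ℂ) := by
  rcases eq_or_ne P 0 with rfl | h0
  · simp [hev, coef]
  rw [eval_eq_sum_range' ((natDegree_lt_iff_degree_lt h0).2 hP), Finset.sum_range, hev]
  refine Finset.sum_congr rfl fun i _ => ?_
  simp [coef, mul_comm]

theorem pev_coef (P : ℝ[X]) (hP : P.Monic) (hn : P.natDegree = n) (x : ℝ) :
    pev (coef n P) x 1 = P.eval x := by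
  rw [eval_eq_sum_range, hn, Finset.sum_range_succ, Finset.sum_range, pev, hev,
    ← hn, hP.coeff_natDegree, hn, add_comm]
  simp [coef, mul_comm]

/-- The polynomial of degree `< n` with given coefficients. -/
noncomputable def lowPoly {R : Type*} [Semiring R] (c : Fin n → R) : R[X] :=
  ∑ i : Fin n, C (c i) * X ^ (i : ℕ)

theorem degree_lowPoly {R : Type*} [Semiring R] (c : Fin n → R) : (lowPoly c).degree < n := by
  refine (degree_sum_le _ _).trans_lt ((Finset.sup_lt_iff (WithBot.bot_lt_coe n)).2 fun i _ => ?_)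
  exact (degree_C_mul_X_pow_le _ _).trans_lt (Nat.cast_lt.2 i.2)

theorem coef_lowPoly {R : Type*} [Semiring R] (c : Fin n → R) : coef n (lowPoly c) = c := by
  ext i
  simp [coef, lowPoly, coeff_X_pow, Fin.val_inj]

theorem hev_eq_eval_real (c : Fin n → ℝ) (x : ℝ) : hev c x 1 = (lowPoly c).eval x := by
  rw [← hev_coef_real _ (degree_lowPoly c), coef_lowPoly]

theorem hev_eq_eval_complex (c : Fin n → ℂ) (x : ℝ) : hev c x 1 = (lowPoly c).eval (x : ℂ) := by
  rw [← hev_coef_complex _ (degree_lowPoly c), coef_lowPoly]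

/-- The monic polynomial of degree `n` with given lower coefficients. -/
noncomputable def monicPoly (a : Fin n → ℝ) : ℝ[X] := X ^ n + lowPoly a

theorem monic_monicPoly (a : Fin n → ℝ) : (monicPoly a).Monic :=
  monic_X_pow_add (degree_lowPoly a)

theorem natDegree_monicPoly (a : Fin n → ℝ) : (monicPoly a).natDegree = n := by
  rw [monicPoly, natDegree_eq_of_degree_eq_some]
  rw [degree_add_eq_left_of_degree_lt] <;> simp [degree_lowPoly a]

theorem pev_eq_eval (a : Fin n → ℝ) (x : ℝ) : pev a x 1 = (monicPoly a).eval x := by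
  rw [pev, hev_eq_eval_real, monicPoly]; simp

theorem exists_pev_eq (P : ℝ[X]) (hP : P.Monic) (hn : P.natDegree = n) :
    ∃ a : Fin n → ℝ, ∀ x, pev a x 1 = P.eval x := ⟨_, pev_coef P hP hn⟩

theorem exists_hev_eq_real (P : ℝ[X]) (hP : P.degree < n) :
    ∃ c : Fin n → ℝ, ∀ x, hev c x 1 = P.eval x := ⟨_, hev_coef_real P hP⟩

/-- The real zeros of a monic polynomial. -/
def realZeros (a : Fin n → ℝ) : Set ℝ := {x | pev a x 1 = 0}

theorem finite_realZeros (a : Fin n → ℝ) : (realZeros a).Finite := by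
  have : realZeros a = {x | (monicPoly a).IsRoot x} := by
    ext x; simp [realZeros, pev_eq_eval]
  rw [this]
  exact finite_setOfPred_isRoot (monic_monicPoly a).ne_zero

instance (a : Fin n → ℝ) : Finite (realZeros a) := (finite_realZeros a).to_subtype

theorem card_realZeros_le (a : Fin n → ℝ) (S : Finset ℝ) (hS : ∀ x ∈ S, x ∈ realZeros a) :
    S.card ≤ n := by
  have : S.val ≤ (monicPoly a).roots := by
    refine (Multiset.le_iff_subset S.nodup).2 fun x hx => ?_
    rw [mem_roots (monic_monicPoly a).ne_zero, IsRoot.def, ← pev_eq_eval]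
    exact hS x hx
  calc S.card ≤ (monicPoly a).roots.card := Multiset.card_le_card this
    _ ≤ (monicPoly a).natDegree := card_roots' _
    _ = n := natDegree_monicPoly a

/-- Lagrange interpolation at the real zeros of a monic polynomial. -/
theorem exists_lagrange (a : Fin n → ℝ) : ∃ l : realZeros a → Fin n → ℝ,
    ∀ i j : realZeros a, hev (l i) j 1 = if i = j then 1 else 0 := by
  classical
  have := Fintype.ofFinite (realZeros a)
  have hinj : Set.InjOn (fun i : realZeros a => (i : ℝ)) (Finset.univ : Finset (realZeros a)) :=
    fun i _ j _ h => Subtype.ext h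
  have hcard : (Finset.univ : Finset (realZeros a)).card ≤ n := by
    rw [← Finset.card_map (Function.Embedding.subtype _)]
    refine card_realZeros_le a _ fun x hx => ?_
    obtain ⟨y, -, rfl⟩ := Finset.mem_map.1 hx
    exact y.2
  have hdeg : ∀ i : realZeros a, (Lagrange.basis Finset.univ
      (fun i : realZeros a => (i : ℝ)) i).degree < n := by
    intro i
    have : Nonempty (realZeros a) := ⟨i⟩
    have hpos : 0 < (Finset.univ : Finset (realZeros a)).card := Finset.univ_nonempty.card_pos
    rw [Lagrange.degree_basis hinj (Finset.mem_univ i)]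
    exact_mod_cast (by omega : (Finset.univ : Finset (realZeros a)).card - 1 < n)
  refine ⟨fun i => coef n (Lagrange.basis Finset.univ (fun i : realZeros a => (i : ℝ)) i),
    fun i j => ?_⟩
  rw [hev_coef_real _ (hdeg i)]
  split_ifs with h
  · subst h
    exact Lagrange.eval_basis_self hinj (Finset.mem_univ i)
  · exact Lagrange.eval_basis_of_ne (v := fun i : realZeros a => (i : ℝ)) h (Finset.mem_univ j)

/-- The constant polynomial `1`. -/
def oneCoef (n : ℕ) (M : Type*) [Zero M] [One M] : Fin n → M := fun i => if (i : ℕ) = 0 then 1 else 0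

theorem hev_one_real (hn : 0 < n) (x : ℝ) : hev (oneCoef n ℝ) x 1 = 1 := by
  have : oneCoef n ℝ = coef n (1 : ℝ[X]) := by
    ext i; simp [oneCoef, coef, coeff_one]
  rw [this, hev_coef_real _ (by rw [degree_one]; exact_mod_cast hn), eval_one]

theorem ofReal_oneCoef : (fun i => ((oneCoef n ℝ i : ℝ) : ℂ)) = oneCoef n ℂ := by
  ext i
  by_cases h : (i : ℕ) = 0 <;> simp [oneCoef, h]

theorem hev_one (hn : 0 < n) (x : ℝ) : hev (oneCoef n ℂ) x 1 = 1 := by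
  rw [← ofReal_oneCoef, hev_ofReal, hev_one_real hn, Complex.ofReal_one]

end Polynomials

/-! ### Connectedness of spaces of nonvanishing polynomials -/

section Nonvanishing

variable {n : ℕ}

/-- Complex polynomials of degree `< n` without zeros in a set of real numbers. -/
def nonvanishing (n : ℕ) (K : Set ℝ) : Set (Fin n → ℂ) := {c | ∀ x ∈ K, hev c x 1 ≠ 0}

theorem nonvanishing_anti {K L : Set ℝ} (h : K ⊆ L) : nonvanishing n L ⊆ nonvanishing n K :=
  fun _ hc x hx => hc x (h hx)

theorem joinedIn_nonvanishing_univ_const (hn : 0 < n) {K : Set ℝ} {z : ℂ} (hz : z ≠ 0) :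
    JoinedIn (nonvanishing n K) (z • oneCoef n ℂ) (oneCoef n ℂ) := by
  have h := (isPathConnected_compl_singleton_of_one_lt_rank (E := ℂ)
    (by simp [Complex.rank_real_complex]) 0).joinedIn z hz 1 one_ne_zero
  have h2 := JoinedIn.map h (f := fun w : ℂ => w • oneCoef n ℂ) (by fun_prop)
  rw [one_smul] at h2
  refine h2.mono ?_
  rintro _ ⟨w, hw, rfl⟩ x -
  rw [hev_smul, hev_one hn, smul_eq_mul, mul_one]
  exact hw

/-- Replacing x by sx and letting s tend to 0 contracts the polynomial to its nonzero constant term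
without creating real zeros. -/
theorem joinedIn_nonvanishing_univ (hn : 0 < n) {c : Fin n → ℂ}
    (hc : c ∈ nonvanishing n Set.univ) :
    JoinedIn (nonvanishing n Set.univ) c (oneCoef n ℂ) := by
  have h0 : c ⟨0, hn⟩ ≠ 0 := by
    have := hc 0 trivial
    rw [hev, Finset.sum_eq_single ⟨0, hn⟩ (fun i _ hi => by
      have : (i : ℕ) ≠ 0 := fun h => hi (Fin.ext h)
      simp [this]) (by simp)] at this
    simpa using this
  refine JoinedIn.trans ?_ (joinedIn_nonvanishing_univ_const hn h0)
  have hcont : Continuous fun s : I => fun i : Fin n => ((σ s : ℝ) ^ (i : ℕ)) • c i := by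
    fun_prop
  have hev' : ∀ (s x : ℝ), hev (fun i : Fin n => (s ^ (i : ℕ)) • c i) x 1 = hev c (s * x) 1 := by
    intro s x
    refine Finset.sum_congr rfl fun i _ => ?_
    rw [smul_smul, one_pow, mul_one, mul_one, mul_pow, mul_comm]
  refine ⟨⟨⟨_, hcont⟩, ?_, ?_⟩, fun s x _ => ?_⟩
  · ext i; simp
  · ext i
    by_cases hi : (i : ℕ) = 0
    · have : i = ⟨0, hn⟩ := Fin.ext hi
      subst this
      simp [oneCoef]
    · simp [oneCoef, hi]
  · change hev (fun i : Fin n => ((σ s : ℝ) ^ (i : ℕ)) • c i) x 1 ≠ 0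
    rw [hev']
    exact hc _ trivial

/-- Push the real line a little into the lower half plane. If no zero has imaginary part in [-η, 0),
then x ↦ c(x - isη) has no real zeros at all for 0 < s ≤ 1, while at s = 0 it has none in `K`. This
reduces to polynomials without real zeros. -/
theorem joinedIn_nonvanishing (hn : 0 < n) {K : Set ℝ} {c : Fin n → ℂ}
    (hc : c ∈ nonvanishing n K) : JoinedIn (nonvanishing n K) c (oneCoef n ℂ) := by
  rcases eq_or_ne (lowPoly c) 0 with h0 | h0
  · have hK : K = ∅ := by
      rw [Set.eq_empty_iff_forall_notMem]
      intro x hx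
      apply hc x hx
      rw [hev_eq_eval_complex, h0, eval_zero]
    have : nonvanishing n K = Set.univ := by
      ext d; simp [nonvanishing, hK]
    rw [this]
    exact joinedIn_univ.2 (PathConnectedSpace.joined _ _)
  obtain ⟨η, hη, hroot⟩ : ∃ η > 0, ∀ z : ℂ, (lowPoly c).eval z = 0 → ¬ (-η ≤ z.im ∧ z.im < 0) := by
    have hfin : {z : ℂ | (lowPoly c).IsRoot z}.Finite := finite_setOfPred_isRoot h0
    have hfin2 : (Complex.im '' {z | (lowPoly c).IsRoot z} ∩ Set.Iio 0).Finite :=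
      (hfin.image Complex.im).subset Set.inter_subset_left
    have hmem : (Complex.im '' {z | (lowPoly c).IsRoot z} ∩ Set.Iio 0)ᶜ ∈ nhds (0 : ℝ) :=
      hfin2.isClosed.isOpen_compl.mem_nhds (by simp)
    obtain ⟨ε, hε, hball⟩ := Metric.mem_nhds_iff.1 hmem
    refine ⟨ε / 2, by positivity, fun z hz ⟨h1, h2⟩ => ?_⟩
    refine hball (a := z.im) ?_ ⟨⟨z, hz, rfl⟩, h2⟩
    rw [Metric.mem_ball, Real.dist_eq, sub_zero, abs_of_neg h2]
    linarith
  let g : ℝ → Fin n → ℂ := fun s => coef n (taylor (-(Complex.I * (s * η))) (lowPoly c))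
  have hg : ∀ s x : ℝ, hev (g s) x 1 = (lowPoly c).eval (x + -(Complex.I * (s * η))) := by
    intro s x
    rw [hev_coef_complex, taylor_eval]
    rw [degree_taylor]
    exact degree_lowPoly c
  have hgc : Continuous g := by
    refine continuous_pi fun i => ?_
    simp only [g, coef, taylor_coeff]
    exact (Polynomial.continuous _).comp (by fun_prop)
  have hpos : ∀ s x : ℝ, 0 < s → s ≤ 1 → hev (g s) x 1 ≠ 0 := by
    intro s x h1 h2 h3
    rw [hg] at h3
    refine hroot _ h3 ⟨?_, ?_⟩ <;> simp <;> nlinarith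
  have j1 : JoinedIn (nonvanishing n K) c (g 1) := by
    refine ⟨⟨⟨fun s : I => g s, hgc.comp continuous_subtype_val⟩, ?_, ?_⟩, fun s x hx => ?_⟩
    · simp [g, coef_lowPoly]
    · simp
    · rcases eq_or_lt_of_le s.2.1 with h | h
      · change hev (g s) x 1 ≠ 0
        rw [hg, ← h]
        have := hc x hx
        rw [hev_eq_eval_complex] at this
        simpa using this
      · exact hpos _ _ h s.2.2
  have j2 := joinedIn_nonvanishing_univ hn (c := g 1) fun x _ => hpos 1 x one_pos le_rfl
  exact j1.trans (j2.mono (nonvanishing_anti (Set.subset_univ K)))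

end Nonvanishing

end

section

open CategoryTheory unitInterval

/-! ### Free homotopies and conjugation -/

section GroupoidTools

variable {X Y : Type*} [TopologicalSpace X] [TopologicalSpace Y]

/-- Naturality of a homotopy on the loop `ℓ`: its two ends are conjugate by the track of `y₀`. All
identifications are pointwise, so that end points need to agree only propositionally. -/
theorem cls_square (K : C(I × Y, X)) {y₀ : Y} (ℓ : Path y₀ y₀) {x y : X} (δ : Path x y)
    (hδ : ∀ s, K (s, y₀) = δ s) (γ : Path x x) (hγ : ∀ t, γ t = K (0, ℓ t)) (γ' : Path y y)
    (hγ' : ∀ t, γ' t = K (1, ℓ t)) : cls γ ≫ cls δ = cls δ ≫ cls γ' := by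
  obtain rfl : K (0, y₀) = x := by rw [hδ, δ.source]
  obtain rfl : K (1, y₀) = y := by rw [hδ, δ.target]
  let f : C(Y, X) := ⟨fun z => K (0, z), by fun_prop⟩
  let g : C(Y, X) := ⟨fun z => K (1, z), by fun_prop⟩
  let F : f.Homotopy g := ⟨K, fun _ => rfl, fun _ => rfl⟩
  have := Path.Homotopic.map_trans_evalAt F ℓ
  rw [← cls_eq_iff, cls_trans, cls_trans] at this
  have e1 : γ = ℓ.map (map_continuous f) := Path.ext (_root_.funext fun t => hγ t)
  have e2 : γ' = ℓ.map (map_continuous g) := Path.ext (_root_.funext fun t => hγ' t)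
  have e3 : δ = F.evalAt y₀ := Path.ext (_root_.funext fun t => (hδ t).symm)
  rw [e1, e2, e3]
  exact this

/-- Conjugation by an arrow of the fundamental groupoid. -/
noncomputable def conjHom {x₀ x : X} (β : FundamentalGroupoid.mk x₀ ⟶ FundamentalGroupoid.mk x) :
    FundamentalGroup X x →* FundamentalGroup X x₀ where
  toFun q := (β ≫ q.toArrow ≫ Groupoid.inv β :
    FundamentalGroupoid.mk x₀ ⟶ FundamentalGroupoid.mk x₀)
  map_one' := by
    change β ≫ 𝟙 _ ≫ Groupoid.inv β = 𝟙 _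
    simp
  map_mul' p q := by
    change β ≫ (q.toArrow ≫ p.toArrow) ≫ Groupoid.inv β =
      (β ≫ q.toArrow ≫ Groupoid.inv β) ≫ (β ≫ p.toArrow ≫ Groupoid.inv β)
    simp

theorem conjHom_apply {x₀ x : X} (β : FundamentalGroupoid.mk x₀ ⟶ FundamentalGroupoid.mk x)
    (q : FundamentalGroupoid.mk x ⟶ FundamentalGroupoid.mk x) :
    conjHom β q = β ≫ q ≫ Groupoid.inv β := rfl

theorem mapOfEq_cls (f : C(Y, X)) {y : Y} {x : X} (h : f y = x) (ℓ : Path y y) (γ : Path x x)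
    (hγ : ∀ t, γ t = f (ℓ t)) : FundamentalGroup.mapOfEq f h (cls ℓ) = cls γ := by
  subst h
  rw [FundamentalGroup.mapOfEq_apply]
  change cls (ℓ.map f.continuous) = cls γ
  congr 1
  exact Path.ext (_root_.funext fun t => (hγ t).symm)

theorem map_surjective_of_mapOfEq (f : C(Y, X)) {y : Y} {x : X} (h : f y = x)
    (hs : Function.Surjective (FundamentalGroup.mapOfEq f h)) :
    Function.Surjective (FundamentalGroup.map f y) := by
  subst h
  intro q
  obtain ⟨p, hp⟩ := hs q
  obtain ⟨ℓ, rfl⟩ := cls_surjective p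
  refine ⟨cls ℓ, ?_⟩
  rw [← hp, mapOfEq_cls f rfl ℓ (ℓ.map f.continuous) fun t => rfl]
  rfl

end GroupoidTools

/-! ### The space of polynomial tuples, its slice F = 1, its fibres and its circles -/

section RatTuple

variable {n : ℕ}

/-- Pairs `(p, F)` of a monic real polynomial `p` of degree `n` and a complex polynomial `F` of
degree `< n` without common real zeros. They encode the triples `(p, p + Re F, p + Im F)` of
monic real polynomials without common real zeros. -/
def ratTuple (n : ℕ) : Set ((Fin n → ℝ) × (Fin n → ℂ)) :=
  {x | x.2 ∈ nonvanishing n (realZeros x.1)}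

theorem mem_ratTuple {p : Fin n → ℝ} {F : Fin n → ℂ} :
    (p, F) ∈ ratTuple n ↔ ∀ x, pev p x 1 = 0 → hev F x 1 ≠ 0 := Iff.rfl

theorem one_mem_ratTuple (hn : 0 < n) (p : Fin n → ℝ) : (p, oneCoef n ℂ) ∈ ratTuple n :=
  mem_ratTuple.2 fun x _ => by rw [hev_one hn]; exact one_ne_zero

/-- The contractible slice `F = 1`. -/
def baseSlice (hn : 0 < n) : C(Fin n → ℝ, ratTuple n) :=
  ⟨fun p => ⟨(p, oneCoef n ℂ), one_mem_ratTuple hn p⟩, by fun_prop⟩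

/-- Allowing `K` larger than the set of real zeros makes the same path of second components usable
for every polynomial with zeros in `K`. -/
theorem exists_vertical_path (hn : 0 < n) (x : ratTuple n) {K : Set ℝ}
    (hK : realZeros x.1.1 ⊆ K) (hx : x.1.2 ∈ nonvanishing n K) :
    ∃ G : Path (baseSlice hn x.1.1) x, ∀ t, (G t).1.1 = x.1.1 ∧ (G t).1.2 ∈ nonvanishing n K := by
  obtain ⟨γ, hγ⟩ := (joinedIn_nonvanishing hn hx).symm
  refine ⟨⟨⟨fun t => ⟨(x.1.1, γ t), fun r hr => hγ t r (hK hr)⟩, by fun_prop⟩, ?_, ?_⟩,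
    fun t => ⟨rfl, hγ t⟩⟩
  · simp [baseSlice]
  · simp

theorem pathConnectedSpace_ratTuple (hn : 0 < n) : PathConnectedSpace (ratTuple n) := by
  refine ⟨⟨baseSlice hn 0⟩, fun x y => ?_⟩
  obtain ⟨G, -⟩ := exists_vertical_path hn x subset_rfl x.2
  obtain ⟨H, -⟩ := exists_vertical_path hn y subset_rfl y.2
  exact ⟨G.symm.trans ((((PathConnectedSpace.somePath x.1.1 y.1.1).map
    (baseSlice hn).continuous)).trans H)⟩

/-- Pairs `(p, e)` of real polynomials for which `z ↦ (p, 1 + (z - 1) e)` is a circle of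
elements of `ratTuple n`. -/
def circleData (n : ℕ) : Set ((Fin n → ℝ) × (Fin n → ℝ)) :=
  {d | ∀ x, pev d.1 x 1 = 0 → hev d.2 x 1 ≠ 1 / 2}

/-- The number is (1 - t) + zt, and |1 - t| = |t| only for t = 1/2. -/
theorem one_add_mul_ne_zero {z : Circle} {t : ℝ} (ht : t ≠ 1 / 2) :
    (1 : ℂ) + ((z : ℂ) - 1) * (t : ℂ) ≠ 0 := by
  intro h
  have h1 : ((1 - t : ℝ) : ℂ) = -(z : ℂ) * (t : ℂ) := by push_cast; linear_combination h
  have h2 := congrArg norm h1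
  rw [norm_mul, norm_neg, Circle.norm_coe, one_mul, Complex.norm_real, Complex.norm_real,
    Real.norm_eq_abs, Real.norm_eq_abs] at h2
  rcases abs_eq_abs.1 h2 with h3 | h3 <;> apply ht <;> linarith

/-- The coefficients of `1 + (z - 1) e`. -/
def circleCoef (e : Fin n → ℝ) (z : Circle) : Fin n → ℂ :=
  oneCoef n ℂ + ((z : ℂ) - 1) • fun i => ((e i : ℝ) : ℂ)

theorem hev_circleCoef (hn : 0 < n) (e : Fin n → ℝ) (z : Circle) (x : ℝ) :
    hev (circleCoef e z) x 1 = 1 + ((z : ℂ) - 1) * (hev e x 1 : ℝ) := by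
  rw [circleCoef, hev_add, hev_one hn, hev_smul, hev_ofReal, smul_eq_mul]

theorem circleCoef_mem (hn : 0 < n) {d : (Fin n → ℝ) × (Fin n → ℝ)} (hd : d ∈ circleData n)
    (z : Circle) : (d.1, circleCoef d.2 z) ∈ ratTuple n := by
  refine mem_ratTuple.2 fun x hx => ?_
  rw [hev_circleCoef hn]
  exact one_add_mul_ne_zero (hd x hx)

theorem continuous_circleCoef {X : Type*} [TopologicalSpace X] {e : X → Fin n → ℝ}
    {z : X → Circle} (he : Continuous e) (hz : Continuous z) :
    Continuous fun x => circleCoef (e x) (z x) := by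
  have hz' : Continuous fun x => (z x : ℂ) := continuous_circle_coe.comp hz
  unfold circleCoef
  refine continuous_const.add ((hz'.sub continuous_const).smul ?_)
  exact continuous_pi fun i => Complex.continuous_ofReal.comp ((continuous_apply i).comp he)

/-- The circle in `ratTuple n` determined by an element of `circleData n`. -/
def circleMap (hn : 0 < n) {d : (Fin n → ℝ) × (Fin n → ℝ)} (hd : d ∈ circleData n) :
    C(Circle, ratTuple n) :=
  ⟨fun z => ⟨(d.1, circleCoef d.2 z), circleCoef_mem hn hd z⟩,
    (continuous_const.prodMk (continuous_circleCoef continuous_const continuous_id)).subtype_mk _⟩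

theorem circleCoef_one (e : Fin n → ℝ) : circleCoef e 1 = oneCoef n ℂ := by
  simp [circleCoef]

theorem circleCoef_zero (z : Circle) : circleCoef (0 : Fin n → ℝ) z = oneCoef n ℂ := by
  ext i
  simp [circleCoef]

theorem circleMap_one (hn : 0 < n) {d : (Fin n → ℝ) × (Fin n → ℝ)} (hd : d ∈ circleData n) :
    circleMap hn hd 1 = baseSlice hn d.1 :=
  Subtype.ext (Prod.ext rfl (circleCoef_one _))

/-- The class of the paths from `p` to `q` in the slice `F = 1`. -/
noncomputable def sliceArrow (hn : 0 < n) (p q : Fin n → ℝ) :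
    FundamentalGroupoid.mk (baseSlice hn p) ⟶ FundamentalGroupoid.mk (baseSlice hn q) :=
  cls ((PathConnectedSpace.somePath p q).map (baseSlice hn).continuous)

/-- The slice is parametrised by a vector space, so transport along it does not depend on the path.
-/
theorem cls_slice_eq (hn : 0 < n) {p q : Fin n → ℝ} (δ : Path p q) :
    cls (δ.map (baseSlice hn).continuous) = sliceArrow hn p q :=
  cls_eq_iff.2 ((SimplyConnectedSpace.paths_homotopic _ _).map (baseSlice hn))

theorem sliceArrow_self (hn : 0 < n) (p : Fin n → ℝ) : sliceArrow hn p p = 𝟙 _ := by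
  rw [← cls_slice_eq hn (Path.refl p)]
  rfl

theorem sliceArrow_comp (hn : 0 < n) (p q r : Fin n → ℝ) :
    sliceArrow hn p q ≫ sliceArrow hn q r = sliceArrow hn p r := by
  rw [← cls_slice_eq hn (PathConnectedSpace.somePath p q),
    ← cls_slice_eq hn (PathConnectedSpace.somePath q r), ← cls_trans, ← Path.map_trans,
    cls_slice_eq]

/-- The loops of the circle of `d` are, up to transport along the slice, in `R`. -/
def CircleIn (hn : 0 < n) {p₀ : Fin n → ℝ}
    (R : Subgroup (FundamentalGroup (ratTuple n) (baseSlice hn p₀)))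
    (d : (Fin n → ℝ) × (Fin n → ℝ)) : Prop :=
  ∀ (ℓ : Path (1 : Circle) 1) (γ : Path (baseSlice hn d.1) (baseSlice hn d.1)),
    (∀ t, (γ t).1 = (d.1, circleCoef d.2 (ℓ t))) → conjHom (sliceArrow hn p₀ d.1) (cls γ) ∈ R

variable (hn : 0 < n) {p₀ : Fin n → ℝ}
  {R : Subgroup (FundamentalGroup (ratTuple n) (baseSlice hn p₀))}

/-- A path of circle data sweeps out a cylinder whose base points (z = 1) stay in the slice, so the
two circles are conjugate by transport along the slice. -/
theorem CircleIn.of_joinedIn {d d' : (Fin n → ℝ) × (Fin n → ℝ)}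
    (hd : CircleIn hn R d) (h : JoinedIn (circleData n) d d') : CircleIn hn R d' := by
  obtain ⟨δ, hδ⟩ := h
  intro ℓ γ' hγ'
  let K : C(I × Circle, ratTuple n) :=
    ⟨fun q => ⟨((δ q.1).1, circleCoef (δ q.1).2 q.2), circleCoef_mem hn (hδ q.1) q.2⟩, by
      refine Continuous.subtype_mk ?_ _
      refine Continuous.prodMk (by fun_prop) (continuous_circleCoef ?_ continuous_snd)
      fun_prop⟩
  let γ : Path (baseSlice hn d.1) (baseSlice hn d.1) :=
    ⟨⟨fun t => K (0, ℓ t), by fun_prop⟩, by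
      refine Subtype.ext (Prod.ext ?_ ?_) <;> simp [K, baseSlice, circleCoef_one], by
      refine Subtype.ext (Prod.ext ?_ ?_) <;> simp [K, baseSlice, circleCoef_one]⟩
  let ε : Path d.1 d'.1 := δ.map continuous_fst
  have hsq := cls_square K ℓ (ε.map (baseSlice hn).continuous)
    (fun s => Subtype.ext (Prod.ext rfl (circleCoef_one _))) γ (fun t => rfl) γ' fun t => by
      refine Subtype.ext ?_
      rw [hγ']
      simp [K]
  rw [cls_slice_eq] at hsq
  have h1 := hd ℓ γ fun t => by
    change (K (0, ℓ t)).1 = _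
    simp [K]
  rw [conjHom_apply, ← sliceArrow_comp hn p₀ d.1 d'.1]
  rw [conjHom_apply] at h1
  have h2 : (sliceArrow hn p₀ d.1 ≫ sliceArrow hn d.1 d'.1) ≫ cls γ' ≫
      Groupoid.inv (sliceArrow hn p₀ d.1 ≫ sliceArrow hn d.1 d'.1) =
      sliceArrow hn p₀ d.1 ≫ cls γ ≫ Groupoid.inv (sliceArrow hn p₀ d.1) := by
    have h3 : cls γ = sliceArrow hn d.1 d'.1 ≫ cls γ' ≫ Groupoid.inv (sliceArrow hn d.1 d'.1) := by
      rw [← Category.assoc, ← hsq]; simp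
    rw [h3]; simp
  rw [h2]
  exact h1

theorem circleIn_zero (q : Fin n → ℝ) : CircleIn hn R (q, 0) := by
  intro ℓ γ hγ
  have : γ = Path.refl _ := by
    refine Path.ext (_root_.funext fun t => Subtype.ext ?_)
    rw [hγ, circleCoef_zero]
    rfl
  rw [this, cls_refl]
  change conjHom (sliceArrow hn p₀ q) 1 ∈ R
  rw [map_one]
  exact R.one_mem

theorem circleIn_range {d : (Fin n → ℝ) × (Fin n → ℝ)} (hd : d ∈ circleData n) :
    CircleIn hn (FundamentalGroup.mapOfEq (circleMap hn hd) (circleMap_one hn hd)).range d := by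
  intro ℓ γ hγ
  refine ⟨cls ℓ, ?_⟩
  rw [mapOfEq_cls _ _ ℓ γ fun t => Subtype.ext (hγ t), sliceArrow_self, conjHom_apply]
  simp

/-- Vertical loops come from circles. -/
theorem vertical_loop_mem (p : Fin n → ℝ)
    (hR : ∀ (b : ℝ) (e : Fin n → ℝ), b ∉ realZeros p →
      (∀ x ∈ realZeros p, hev e x 1 = if b < x then 1 else 0) → CircleIn hn R (p, e))
    (L : Path (baseSlice hn p) (baseSlice hn p)) (hL : ∀ t, (L t).1.1 = p) :
    conjHom (sliceArrow hn p₀ p) (cls L) ∈ R := by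
  classical
  have := Fintype.ofFinite (realZeros p)
  obtain ⟨l, hl⟩ := exists_lagrange p
  let lc : realZeros p → Fin n → ℂ := fun a i => ((l a i : ℝ) : ℂ)
  -- `Λ v` is a polynomial with value `v a` at each real zero `a` of `p`; it embeds the torus in the
  -- fibre over `p`.
  let Λ : (realZeros p → ℂˣ) → Fin n → ℂ := fun v => oneCoef n ℂ + ∑ a, ((v a : ℂ) - 1) • lc a
  have hlc : ∀ a b : realZeros p, hev (lc a) b 1 = if a = b then 1 else 0 := by
    intro a b
    rw [hev_ofReal, hl]
    split_ifs <;> simp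
  have hΛ : ∀ v (a : realZeros p), hev (Λ v) a 1 = v a := by
    intro v a
    rw [hev_add, hev_one hn, hev_sum]
    simp_rw [hev_smul, hlc]
    simp
  have hΛc : Continuous Λ := by
    refine continuous_const.add (continuous_finsetSum _ fun a _ =>
      Continuous.smul (f := fun v : realZeros p → ℂˣ => (v a : ℂ) - 1) ?_ continuous_const)
    exact (Units.continuous_val.comp (continuous_apply a)).sub continuous_const
  have hΛ1 : Λ 1 = oneCoef n ℂ := by simp [Λ]
  have hmem : ∀ v, (p, Λ v) ∈ ratTuple n := fun v =>
    mem_ratTuple.2 fun x hx => by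
      rw [hΛ v ⟨x, hx⟩]
      exact (v ⟨x, hx⟩).ne_zero
  let f : C(realZeros p → ℂˣ, ratTuple n) :=
    ⟨fun v => ⟨(p, Λ v), hmem v⟩, (continuous_const.prodMk hΛc).subtype_mk _⟩
  have hf1 : f 1 = baseSlice hn p := Subtype.ext (Prod.ext rfl hΛ1)
  have htop : ((R.comap (conjHom (sliceArrow hn p₀ p))).comap (FundamentalGroup.mapOfEq f hf1)) =
      ⊤ := by
    refine subgroup_loops_torus_eq_top (fun a : realZeros p => (a : ℝ)) Subtype.val_injective _
      fun b hb γ ℓ hγ => ?_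
    have hc : ∀ t, (f (γ t)).1 = (p, circleCoef (∑ a : realZeros p, if b < (a : ℝ) then l a else 0) (ℓ t)) := by
      intro t
      refine Prod.ext rfl ?_
      change Λ (γ t) = _
      simp only [Λ, circleCoef]
      congr 1
      ext i
      simp only [Finset.sum_apply, Pi.smul_apply, smul_eq_mul]
      rw [Complex.ofReal_sum, Finset.mul_sum]
      refine Finset.sum_congr rfl fun a _ => ?_
      rw [hγ]
      split_ifs <;> simp [lc]
    change conjHom (sliceArrow hn p₀ p) (FundamentalGroup.mapOfEq f hf1 (cls γ)) ∈ R
    rw [mapOfEq_cls f hf1 γ ((γ.map f.continuous).cast hf1.symm hf1.symm) fun t => rfl]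
    refine hR b (∑ a : realZeros p, if b < (a : ℝ) then l a else 0) (fun hb' => hb ⟨b, hb'⟩ rfl) (fun x hx => ?_)
      ℓ _ hc
    rw [hev_sum, Finset.sum_eq_single (⟨x, hx⟩ : realZeros p)]
    · split_ifs
      · exact (hl ⟨x, hx⟩ ⟨x, hx⟩).trans (if_pos rfl)
      · rw [hev_zero]
    · intro a _ ha
      split_ifs
      · exact (hl a ⟨x, hx⟩).trans (if_neg ha)
      · rw [hev_zero]
    · simp
  have hne : ∀ (t : I) (a : realZeros p), hev (L t).1.2 a 1 ≠ 0 := by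
    intro t a
    exact (L t).2 a (by rw [hL]; exact a.2)
  have hLc : Continuous fun t => (L t).1.2 := by fun_prop
  let v : Path (1 : realZeros p → ℂˣ) 1 :=
    ⟨⟨fun t a => unitsMap (fun t => hev (L t).1.2 a 1)
      (continuous_hev hLc continuous_const continuous_const) (fun t => hne t a) t,
      continuous_pi fun a => ContinuousMap.continuous _⟩, by
      ext a
      change hev (L 0).1.2 a 1 = 1
      rw [L.source]
      exact hev_one hn _, by
      ext a
      change hev (L 1).1.2 a 1 = 1
      rw [L.target]
      exact hev_one hn _⟩
  have hv : ∀ t (a : realZeros p), ((v t a : ℂˣ) : ℂ) = hev (L t).1.2 a 1 := fun t a => rfl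
  let γ : Path (baseSlice hn p) (baseSlice hn p) :=
    (v.map f.continuous).cast hf1.symm hf1.symm
  have hγ : ∀ t, γ t = f (v t) := fun t => rfl
  have hhom : L.Homotopic γ := by
    -- `L t` and its interpolation have equal values at the zeros of `p`, so the segment between
    -- them stays in the fibre.
    have hcomb : ∀ (s t : I) (a : realZeros p),
        hev ((1 - (s : ℝ)) • (L t).1.2 + (s : ℝ) • Λ (v t)) a 1 = hev (L t).1.2 a 1 := by
      intro s t a
      rw [hev_add, hev_smul, hev_smul, hΛ, hv, ← add_smul]
      simp
    refine ⟨⟨⟨⟨fun q => ⟨(p, (1 - (q.1 : ℝ)) • (L q.2).1.2 + (q.1 : ℝ) • Λ (v q.2)),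
      mem_ratTuple.2 fun x hx => ?_⟩, ?_⟩, fun t => ?_, fun t => ?_⟩, fun s t ht => ?_⟩⟩
    · rw [hcomb q.1 q.2 ⟨x, hx⟩]
      exact hne q.2 ⟨x, hx⟩
    · refine Continuous.subtype_mk (continuous_const.prodMk (Continuous.add ?_ ?_)) _
      · exact (continuous_const.sub (continuous_subtype_val.comp continuous_fst)).smul
          (hLc.comp continuous_snd)
      · exact (continuous_subtype_val.comp continuous_fst).smul
          (hΛc.comp (v.continuous.comp continuous_snd))
    · refine Subtype.ext (Prod.ext (hL t).symm ?_)
      simp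
    · refine Subtype.ext (Prod.ext rfl ?_)
      simp [hγ, f]
    · have hend : L t = baseSlice hn p ∧ v t = 1 := by
        rcases ht with rfl | ht
        · simp
        · rw [Set.mem_singleton_iff.1 ht]; simp
      refine Subtype.ext (Prod.ext (hL t).symm ?_)
      change (1 - (s : ℝ)) • (L t).1.2 + (s : ℝ) • Λ (v t) = (L t).1.2
      rw [hend.1, hend.2, hΛ1]
      change (1 - (s : ℝ)) • oneCoef n ℂ + (s : ℝ) • oneCoef n ℂ = oneCoef n ℂ
      rw [← add_smul]
      simp
  rw [cls_eq_iff.2 hhom]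
  have h1 : conjHom (sliceArrow hn p₀ p) (FundamentalGroup.mapOfEq f hf1 (cls v)) ∈ R :=
    (Subgroup.eq_top_iff' _).1 htop (cls v)
  rwa [mapOfEq_cls f hf1 v γ hγ] at h1

end RatTuple

end

/-! ### Circles generate the fundamental group -/

section

open CategoryTheory unitInterval

theorem isOpen_setOf_forall_mem_compact {X Y : Type*} [TopologicalSpace X] [TopologicalSpace Y]
    {K : Set Y} (hK : IsCompact K) {W : Set (X × Y)} (hW : IsOpen W) :
    IsOpen {x | ∀ y ∈ K, (x, y) ∈ W} :=
  isOpen_iff_eventually.2 fun _ hx =>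
    hK.eventually_forall_of_forall_eventually fun y hy => hW.mem_nhds (hx y hy)

section Surjectivity

variable {n : ℕ}

theorem isOpen_nonvanishing {K : Set ℝ} (hK : IsCompact K) : IsOpen (nonvanishing n K) :=
  isOpen_setOf_forall_mem_compact (X := Fin n → ℂ) (W := {q | hev q.1 q.2 1 ≠ 0}) hK
    (isOpen_ne_fun (continuous_hev continuous_fst continuous_snd continuous_const) continuous_const)

theorem pev_ne_zero_of_circle (p : Fin n → ℝ) {u v : ℝ} (h : u ^ 2 + v ^ 2 = 1)
    (hv : v = 0 ∨ u / v ∉ realZeros p) : pev p u v ≠ 0 := by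
  by_cases h0 : v = 0
  · subst h0
    rw [pev_infinity]
    refine pow_ne_zero _ fun hu => ?_
    subst hu
    norm_num at h
  · rw [pev_eq_pow_mul p u h0]
    exact mul_ne_zero (pow_ne_zero _ h0) (hv.resolve_left h0)

/-- Real zeros of a nearby polynomial stay near the old ones, where `x.1.2` is still nonzero.
Homogeneous coordinates make this uniform and exclude zeros arriving from infinity. -/
theorem exists_isolating_set (x : ratTuple n) : ∃ (K : Set ℝ) (O : Set (Fin n → ℝ)),
    IsCompact K ∧ IsOpen O ∧ x.1.1 ∈ O ∧ x.1.2 ∈ nonvanishing n K ∧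
      ∀ p ∈ O, realZeros p ⊆ K := by
  have hZ := finite_realZeros x.1.1
  have hopen : IsOpen {t : ℝ | hev x.1.2 t 1 ≠ 0} :=
    isOpen_ne_fun (continuous_hev continuous_const continuous_id continuous_const) continuous_const
  obtain ⟨δ, hδ, hsub⟩ := hZ.isCompact.exists_cthickening_subset_open hopen fun t ht => x.2 t ht
  -- The unit circle without neighbourhoods of the zeros. It is compact and contains the points at
  -- infinity (±1, 0), where a monic form has value ±1.
  let C : Set (ℝ × ℝ) := {w | w.1 ^ 2 + w.2 ^ 2 = 1 ∧ ∀ a ∈ realZeros x.1.1,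
    δ * |w.2| ≤ |w.1 - a * w.2|}
  have hC : IsCompact C := by
    refine IsCompact.of_isClosed_subset (isCompact_Icc (a := ((-1, -1) : ℝ × ℝ)) (b := (1, 1)))
      ?_ ?_
    · refine IsClosed.inter (isClosed_eq (by fun_prop) continuous_const) (?_ : IsClosed
        {w : ℝ × ℝ | ∀ a ∈ realZeros x.1.1, δ * |w.2| ≤ |w.1 - a * w.2|})
      simp only [Set.ofPred_forall]
      exact isClosed_biInter fun a _ => isClosed_le (by fun_prop) (by fun_prop)
    · rintro ⟨u, v⟩ ⟨h, -⟩
      have h' : u ^ 2 + v ^ 2 = 1 := h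
      refine ⟨⟨?_, ?_⟩, ⟨?_, ?_⟩⟩ <;> simp only <;> nlinarith [sq_nonneg u, sq_nonneg v]
  refine ⟨Metric.cthickening δ (realZeros x.1.1), {p | ∀ w ∈ C, pev p w.1 w.2 ≠ 0},
    hZ.isCompact.cthickening, ?_, ?_, fun t ht => hsub ht, ?_⟩
  · exact isOpen_setOf_forall_mem_compact (X := Fin n → ℝ)
      (W := {q | pev q.1 q.2.1 q.2.2 ≠ 0}) hC
      (isOpen_ne_fun (continuous_pev continuous_fst (by fun_prop) (by fun_prop)) continuous_const)
  · rintro ⟨u, v⟩ ⟨h, hw⟩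
    refine pev_ne_zero_of_circle _ h ?_
    by_cases h0 : v = 0
    · exact Or.inl h0
    · refine Or.inr fun hroot => ?_
      have := hw _ hroot
      simp only [div_mul_cancel₀ u h0, sub_self, abs_zero] at this
      have := mul_pos hδ (abs_pos.2 h0)
      linarith
  · intro p hp t ht
    by_contra hcon
    have hs : 0 < Real.sqrt (t ^ 2 + 1) := Real.sqrt_pos.2 (by positivity)
    have hs2 := Real.sq_sqrt (show 0 ≤ t ^ 2 + 1 by positivity)
    set s := Real.sqrt (t ^ 2 + 1)
    have hmem : ((s⁻¹ * t, s⁻¹ * 1) : ℝ × ℝ) ∈ C := by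
      refine ⟨?_, fun a ha => ?_⟩
      · simp only
        field_simp
        linarith
      · simp only
        have hd : δ ≤ |t - a| := by
          by_contra h
          refine hcon (Metric.thickening_subset_cthickening _ _ (Metric.mem_thickening_iff.2
            ⟨a, ha, ?_⟩))
          rw [Real.dist_eq]
          exact not_le.1 h
        rw [show s⁻¹ * t - a * (s⁻¹ * 1) = s⁻¹ * (t - a) by ring, mul_one, abs_mul,
          abs_of_pos (inv_pos.2 hs), mul_comm]
        exact mul_le_mul_of_nonneg_left hd (inv_pos.2 hs).le
    refine hp _ hmem ?_
    simp only
    rw [pev_homog]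
    have : pev p t 1 = 0 := ht
    rw [this, mul_zero]

variable (hn : 0 < n)

/-- The criterion is applied to the arrows that run along the slice and then inside a fibre. Two of
them with the same end differ by a fibre loop, hence by threshold circles, which `hD` reduces to the
circle of `d` or to a constant one. -/
theorem surjective_map_circleMap {d : (Fin n → ℝ) × (Fin n → ℝ)} (hd : d ∈ circleData n)
    (hD : ∀ (p : Fin n → ℝ) (b : ℝ) (e : Fin n → ℝ), b ∉ realZeros p →
      (∀ x ∈ realZeros p, hev e x 1 = if b < x then 1 else 0) →
      JoinedIn (circleData n) d (p, e) ∨ ∃ q, JoinedIn (circleData n) (q, 0) (p, e)) :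
    Function.Surjective (FundamentalGroup.map (circleMap hn hd) 1) := by
  refine map_surjective_of_mapOfEq _ (circleMap_one hn hd) ?_
  rw [← MonoidHom.range_eq_top]
  set R := (FundamentalGroup.mapOfEq (circleMap hn hd) (circleMap_one hn hd)).range
  have hvert : ∀ (p : Fin n → ℝ) (L : Path (baseSlice hn p) (baseSlice hn p)),
      (∀ t, (L t).1.1 = p) → conjHom (sliceArrow hn d.1 p) (cls L) ∈ R := by
    intro p L hL
    refine vertical_loop_mem hn p (fun b e hb he => ?_) L hL
    rcases hD p b e hb he with h | ⟨q, h⟩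
    · exact (circleIn_range hn hd).of_joinedIn hn h
    · exact (circleIn_zero hn q).of_joinedIn hn h
  refine subgroup_eq_top_of_local R (fun x => {q | ∃ G : Path (baseSlice hn x.1.1) x,
    (∀ t, (G t).1.1 = x.1.1) ∧ q = sliceArrow hn d.1 x.1.1 ≫ cls G}) ?_ ?_ ?_ ?_
  · intro x
    obtain ⟨G, hG⟩ := exists_vertical_path hn x subset_rfl x.2
    exact ⟨_, G, fun t => (hG t).1, rfl⟩
  · rintro x _ ⟨G, hG, rfl⟩ _ ⟨H, hH, rfl⟩
    have := hvert x.1.1 (G.trans H.symm) fun t => by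
      rw [Path.trans_apply]
      split_ifs
      · exact hG _
      · exact hH _
    rw [conjHom_apply, cls_trans, cls_symm] at this
    simpa using this
  · refine ⟨Path.refl _, fun t => rfl, ?_⟩
    change 𝟙 _ = sliceArrow hn d.1 d.1 ≫ 𝟙 _
    rw [sliceArrow_self, Category.comp_id]
  · intro x
    obtain ⟨K, O, hK, hO, hxO, hxK, hOK⟩ := exists_isolating_set x
    refine ⟨{y | y.1.1 ∈ O ∧ y.1.2 ∈ nonvanishing n K},
      (hO.preimage (by fun_prop)).inter ((isOpen_nonvanishing hK).preimage (by fun_prop)),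
      ⟨hxO, hxK⟩, ?_⟩
    intro y z γ hγ
    have hy : y.1.1 ∈ O ∧ y.1.2 ∈ nonvanishing n K := by simpa using hγ 0
    have hz : z.1.1 ∈ O ∧ z.1.2 ∈ nonvanishing n K := by simpa using hγ 1
    obtain ⟨G, hG⟩ := exists_vertical_path hn y (hOK _ hy.1) hy.2
    refine ⟨_, ⟨G, fun t => (hG t).1, rfl⟩, ?_⟩
    -- Over `O` all zeros lie in `K`, so the two components can be moved independently.
    let μ : C(O × nonvanishing n K, ratTuple n) :=
      ⟨fun q => ⟨(q.1, q.2), fun t ht => q.2.2 t (hOK _ q.1.2 ht)⟩, by fun_prop⟩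
    have hone : oneCoef n ℂ ∈ nonvanishing n K := fun t _ => by
      rw [hev_one hn]; exact one_ne_zero
    let γp : Path (⟨y.1.1, hy.1⟩ : O) ⟨z.1.1, hz.1⟩ :=
      ⟨⟨fun t => ⟨(γ t).1.1, (hγ t).1⟩, by fun_prop⟩, by simp, by simp⟩
    let γF : Path (⟨y.1.2, hy.2⟩ : nonvanishing n K) ⟨z.1.2, hz.2⟩ :=
      ⟨⟨fun t => ⟨(γ t).1.2, (hγ t).2⟩, by fun_prop⟩, by simp, by simp⟩
    let GF : Path (⟨oneCoef n ℂ, hone⟩ : nonvanishing n K) ⟨y.1.2, hy.2⟩ :=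
      ⟨⟨fun t => ⟨(G t).1.2, (hG t).2⟩, by fun_prop⟩,
        Subtype.ext (congrArg (fun q : ratTuple n => q.1.2) G.source), by simp⟩
    let H : Path (baseSlice hn z.1.1) z :=
      (((Path.refl (⟨z.1.1, hz.1⟩ : O)).prod (GF.trans γF)).map μ.continuous).cast rfl rfl
    refine ⟨H, fun t => rfl, ?_⟩
    rw [Category.assoc]
    rw [← sliceArrow_comp hn d.1 y.1.1 z.1.1, Category.assoc]
    congr 1
    let S : Path (baseSlice hn y.1.1) (baseSlice hn z.1.1) :=
      ((γp.map continuous_subtype_val).map (baseSlice hn).continuous)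
    have hS : sliceArrow hn y.1.1 z.1.1 = cls S := (cls_slice_eq hn _).symm
    rw [hS, ← cls_trans, ← cls_trans, cls_eq_iff]
    -- In the product, the first component may move before rather than during the second half. This
    -- turns "fibre path `G`, then `γ`" into "slice path `S`, then fibre path `H`".
    have h1 : ((Path.refl _).trans γp).Homotopic (γp.trans (Path.refl _)) :=
      Path.Homotopic.trans ⟨Path.Homotopy.reflTrans γp⟩ (Path.Homotopic.symm
        ⟨Path.Homotopy.transRefl γp⟩)
    have h2 : (GF.trans γF).Homotopic ((Path.refl _).trans (GF.trans γF)) :=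
      Path.Homotopic.symm ⟨Path.Homotopy.reflTrans _⟩
    have h3 : (((Path.refl _).trans γp).prod (GF.trans γF)).Homotopic
        ((γp.trans (Path.refl _)).prod ((Path.refl _).trans (GF.trans γF))) :=
      ⟨Path.Homotopic.prodHomotopy h1.some h2.some⟩
    have h4 := h3.map μ
    have e1 : ∀ t, μ ((((Path.refl _).trans γp).prod (GF.trans γF)) t) = (G.trans γ) t := by
      intro t
      rw [Path.trans_apply G γ, Path.prod_coe]
      simp only [Path.trans_apply]
      split_ifs with h
      · exact Subtype.ext (Prod.ext (hG ⟨2 * t, _⟩).1.symm rfl)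
      · rfl
    have e2 : ∀ t, μ (((γp.trans (Path.refl _)).prod ((Path.refl _).trans (GF.trans γF))) t) =
        (S.trans H) t := by
      intro t
      rw [Path.trans_apply S H, Path.prod_coe]
      simp only [Path.trans_apply γp (Path.refl _), Path.trans_apply (Path.refl _) (GF.trans γF)]
      split_ifs with h <;> rfl
    have e1' : (((Path.refl _).trans γp).prod (GF.trans γF)).map (map_continuous μ) =
      G.trans γ := Path.ext (_root_.funext e1)
    have e2' : ((γp.trans (Path.refl _)).prod ((Path.refl _).trans (GF.trans γF))).map
      (map_continuous μ) = S.trans H := Path.ext (_root_.funext e2)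
    exact e1' ▸ e2' ▸ h4

end Surjectivity

end

section

open unitInterval

/-! ### Normal forms of circle data -/

section CircleData

variable {n : ℕ}

theorem joinedIn_circleData {p p' e e' : Fin n → ℝ}
    (h : ∀ s : ℝ, 0 ≤ s → s ≤ 1 → ∀ x, (1 - s) * pev p x 1 + s * pev p' x 1 = 0 →
      (1 - s) * hev e x 1 + s * hev e' x 1 ≠ 1 / 2) :
    JoinedIn (circleData n) (p, e) (p', e') := by
  refine JoinedIn.ofLine (f := fun s : ℝ => (((1 - s) • p + s • p', (1 - s) • e + s • e') :
    (Fin n → ℝ) × (Fin n → ℝ))) (by fun_prop) (by simp) (by simp) ?_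
  rintro _ ⟨s, hs, rfl⟩ x hx
  simp only at hx
  rw [pev_combo _ _ (by ring)] at hx
  simp only
  rw [hev_add, hev_smul, hev_smul]
  exact h s hs.1 hs.2 x hx

theorem combo_self {s a : ℝ} : (1 - s) * a + s * a = a := by ring

/-- Moving only the second polynomial. -/
theorem joinedIn_circleData_right {p e e' : Fin n → ℝ}
    (h : ∀ s : ℝ, 0 ≤ s → s ≤ 1 → ∀ x, pev p x 1 = 0 →
      (1 - s) * hev e x 1 + s * hev e' x 1 ≠ 1 / 2) :
    JoinedIn (circleData n) (p, e) (p, e') :=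
  joinedIn_circleData fun s h0 h1 x hx => h s h0 h1 x (by rwa [combo_self] at hx)

/-- Moving only the first polynomial, keeping its sign where the second one is `1 / 2`. -/
theorem joinedIn_circleData_left {p p' e : Fin n → ℝ}
    (h : ∀ x, hev e x 1 = 1 / 2 → 0 < pev p x 1 * pev p' x 1) :
    JoinedIn (circleData n) (p, e) (p', e) := by
  refine joinedIn_circleData fun s h0 h1 x hx he => ?_
  rw [combo_self] at he
  have h2 := h x he
  rcases eq_or_lt_of_le h0 with rfl | h0
  · simp at hx
    simp [hx] at h2
  · rcases pos_and_pos_or_neg_and_neg_of_mul_pos h2 with ⟨h3, h4⟩ | ⟨h3, h4⟩ <;>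
      nlinarith

theorem exists_shifted_pow (hn : 0 < n) (b c : ℝ) :
    ∃ q : Fin n → ℝ, ∀ x, pev q x 1 = (x - b) ^ n + c := by
  have hm : ((X - C b) ^ n : ℝ[X]).Monic := (monic_X_sub_C b).pow n
  have hd : ((X - C b) ^ n : ℝ[X]).natDegree = n := by
    rw [natDegree_pow, natDegree_X_sub_C, mul_one]
  have hlt : (C c : ℝ[X]).degree < ((X - C b) ^ n : ℝ[X]).degree := by
    refine degree_C_le.trans_lt ?_
    rw [degree_eq_natDegree hm.ne_zero, hd]
    exact_mod_cast hn
  obtain ⟨q, hq⟩ := exists_pev_eq ((X - C b) ^ n + C c) (hm.add_of_left hlt) (n := n) (by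
    rw [natDegree_add_C, hd])
  exact ⟨q, fun x => by rw [hq]; simp⟩

theorem exists_half_line (hn : 2 ≤ n) (b : ℝ) :
    ∃ m : Fin n → ℝ, ∀ x, hev m x 1 = (x - b + 1) / 2 := by
  obtain ⟨m, hm⟩ := exists_hev_eq_real (n := n) (C (1 / 2) * X + C ((1 - b) / 2))
    (degree_linear_le.trans_lt (by exact_mod_cast hn))
  exact ⟨m, fun x => by rw [hm]; simp; ring⟩

/-- If there are zeros on both sides of `b`, then the line through 1/2 at `b` lies on the same side
of 1/2 as the step function at every zero, so the segment between them avoids 1/2. A line needs 2 ≤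
n, and two distinct zeros guarantee this. Otherwise a constant does the same. -/
theorem joinedIn_circleData_step {p e : Fin n → ℝ} {b : ℝ} (hn : 0 < n)
    (hb : b ∉ realZeros p) (he : ∀ x ∈ realZeros p, hev e x 1 = if b < x then 1 else 0) :
    JoinedIn (circleData n) (p, e) (p, oneCoef n ℝ) ∨ JoinedIn (circleData n) (p, e) (p, 0) ∨
      2 ≤ n ∧ ∃ m : Fin n → ℝ, (∀ x, hev m x 1 = (x - b + 1) / 2) ∧
        JoinedIn (circleData n) (p, e) (p, m) := by
  by_cases h1 : ∀ x ∈ realZeros p, b < x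
  · left
    refine joinedIn_circleData_right fun s _ _ x hx => ?_
    rw [hev_one_real hn, he x hx, if_pos (h1 x hx)]
    norm_num
  by_cases h2 : ∀ x ∈ realZeros p, x ≤ b
  · right; left
    refine joinedIn_circleData_right fun s _ _ x hx => ?_
    rw [hev_zero, he x hx, if_neg (not_lt.2 (h2 x hx))]
    norm_num
  right; right
  push Not at h1 h2
  obtain ⟨x, hx, hxb⟩ := h1
  obtain ⟨y, hy, hyb⟩ := h2
  have hn2 : 2 ≤ n := by
    have := card_realZeros_le p {x, y} (by simp [hx, hy])
    rwa [Finset.card_pair (by linarith : x < y).ne] at this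
  obtain ⟨m, hm⟩ := exists_half_line hn2 b
  refine ⟨hn2, m, hm, joinedIn_circleData_right fun s h0 h1 t ht => ?_⟩
  have htb : t ≠ b := fun h => hb (h ▸ ht)
  rw [he t ht, hm]
  split_ifs with h
  · apply ne_of_gt
    rcases eq_or_lt_of_le h0 with rfl | h0
    · norm_num
    · nlinarith
  · have h3 : t < b := lt_of_le_of_ne (not_lt.1 h) htb
    apply ne_of_lt
    rcases eq_or_lt_of_le h0 with rfl | h0
    · norm_num
    · nlinarith

/-- The line equals 1/2 at `b` only, so just the sign of p(b) matters. The polynomial (x - b)^n + 1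
is positive for x ≥ b, hence on its zeros the line is below 1/2 and can be lowered to 0. -/
theorem joinedIn_half_line_pos {p m : Fin n → ℝ} {b : ℝ} (hn : 0 < n)
    (hm : ∀ x, hev m x 1 = (x - b + 1) / 2) (hp : 0 < pev p b 1) :
    ∃ q : Fin n → ℝ, JoinedIn (circleData n) (p, m) (q, 0) := by
  obtain ⟨q, hq⟩ := exists_shifted_pow hn b 1
  refine ⟨q, JoinedIn.trans (y := (q, m)) (joinedIn_circleData_left fun x hx => ?_)
    (joinedIn_circleData_right fun s h0 h1 x hx h => ?_)⟩
  · rw [hm] at hx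
    obtain rfl : x = b := by linarith
    rw [hq, sub_self, zero_pow hn.ne', zero_add, mul_one]
    exact hp
  · rw [hq] at hx
    rw [hm, hev_zero] at h
    have : 0 ≤ x - b := by
      by_contra! hneg
      have h2 := mul_nonpos_of_nonneg_of_nonpos (sub_nonneg.2 h1) hneg.le
      obtain rfl : s = 0 := by linarith
      linarith
    have := pow_nonneg this n
    linarith

/-- For p(b) < 0 replace `p` by (x - b)^n - 1. As n is odd, its real zeros lie to the right of `b`,
so the line can be raised to the constant 1; with that constant the first polynomial is free. -/
theorem joinedIn_base_odd (hodd : Odd n) (p₀ p : Fin n → ℝ) (b : ℝ) (e : Fin n → ℝ)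
    (hb : b ∉ realZeros p) (he : ∀ x ∈ realZeros p, hev e x 1 = if b < x then 1 else 0) :
    JoinedIn (circleData n) (p₀, oneCoef n ℝ) (p, e) ∨
      ∃ q, JoinedIn (circleData n) (q, 0) (p, e) := by
  have hn : 0 < n := hodd.pos
  have hone : ∀ q q' : Fin n → ℝ, JoinedIn (circleData n) (q, oneCoef n ℝ) (q', oneCoef n ℝ) :=
    fun q q' => joinedIn_circleData_left fun x hx => by
      rw [hev_one_real hn] at hx; norm_num at hx
  rcases joinedIn_circleData_step hn hb he with h | h | ⟨-, m, hm, h⟩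
  · exact Or.inl ((hone _ _).trans h.symm)
  · exact Or.inr ⟨p, h.symm⟩
  rcases lt_or_gt_of_ne hb with hp | hp
  · left
    obtain ⟨q, hq⟩ := exists_shifted_pow hn b (-1)
    have h1 : JoinedIn (circleData n) (p, m) (q, m) := joinedIn_circleData_left fun x hx => by
      rw [hm] at hx
      obtain rfl : x = b := by linarith
      rw [hq, sub_self, zero_pow hn.ne']
      linarith
    have h2 : JoinedIn (circleData n) (q, m) (q, oneCoef n ℝ) :=
      joinedIn_circleData_right fun s h0 h1 x hx h => by
        rw [hq] at hx
        rw [hm, hev_one_real hn] at h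
        have : x - b ≤ 0 := by
          by_contra! hneg
          have h2 := mul_nonneg (sub_nonneg.2 h1) hneg.le
          obtain rfl : s = 0 := by linarith
          linarith
        have := hodd.pow_nonpos this
        linarith
    exact (h.trans (h1.trans (h2.trans (hone q p₀)))).symm
  · obtain ⟨q, hq⟩ := joinedIn_half_line_pos hn hm hp
    exact Or.inr ⟨q, (h.trans hq).symm⟩

/-- For even n the constant 1 gives a trivial circle as well, because x^n + 1 has no real zeros.
There remain the lines with p(b) < 0, and all of these are connected. -/
theorem joinedIn_base_even (hn : 0 < n) (heven : Even n) {p₀ m₀ : Fin n → ℝ} (hp₀ : pev p₀ 0 1 < 0)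
    (hm₀ : ∀ x, hev m₀ x 1 = (x + 1) / 2) (p : Fin n → ℝ) (b : ℝ) (e : Fin n → ℝ)
    (hb : b ∉ realZeros p) (he : ∀ x ∈ realZeros p, hev e x 1 = if b < x then 1 else 0) :
    JoinedIn (circleData n) (p₀, m₀) (p, e) ∨
      ∃ q, JoinedIn (circleData n) (q, 0) (p, e) := by
  rcases joinedIn_circleData_step hn hb he with h | h | ⟨-, m, hm, h⟩
  · right
    obtain ⟨q, hq⟩ := exists_shifted_pow hn 0 1
    have h1 : JoinedIn (circleData n) (p, oneCoef n ℝ) (q, oneCoef n ℝ) :=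
      joinedIn_circleData_left fun x hx => by rw [hev_one_real hn] at hx; norm_num at hx
    have h2 : JoinedIn (circleData n) (q, oneCoef n ℝ) (q, 0) :=
      joinedIn_circleData_right fun s _ _ x hx => by
        rw [hq] at hx
        have := heven.pow_nonneg (x - 0)
        linarith
    exact ⟨q, (h.trans (h1.trans h2)).symm⟩
  · exact Or.inr ⟨p, h.symm⟩
  rcases lt_or_gt_of_ne hb with hp | hp
  · left
    -- This constant makes `q` negative between 0 and `b`, so the point where the line equals 1/2
    -- can slide from `b` to 0.
    obtain ⟨q, hq⟩ := exists_shifted_pow hn 0 (-(b ^ n + 1))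
    have hbn := heven.pow_nonneg b
    have h1 : JoinedIn (circleData n) (p, m) (q, m) := joinedIn_circleData_left fun x hx => by
      rw [hm] at hx
      obtain rfl : x = b := by linarith
      refine mul_pos_of_neg_of_neg hp ?_
      rw [hq, sub_zero]
      linarith
    have h2 : JoinedIn (circleData n) (q, m) (q, m₀) :=
      joinedIn_circleData_right fun s h0 h1 x hx h => by
        rw [hq, sub_zero] at hx
        rw [hm, hm₀] at h
        have hx' : x = (1 - s) * b := by linarith
        have : x ^ n ≤ b ^ n := by
          rw [hx', mul_pow]
          exact mul_le_of_le_one_left hbn (pow_le_one₀ (by linarith) (by linarith))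
        linarith
    have h3 : JoinedIn (circleData n) (q, m₀) (p₀, m₀) := joinedIn_circleData_left fun x hx => by
      rw [hm₀] at hx
      obtain rfl : x = 0 := by linarith
      refine mul_pos_of_neg_of_neg ?_ hp₀
      rw [hq, sub_zero, zero_pow hn.ne']
      linarith
    exact (h.trans (h1.trans (h2.trans h3))).symm
  · obtain ⟨q, hq⟩ := joinedIn_half_line_pos hn hm hp
    exact Or.inr ⟨q, (h.trans hq).symm⟩

end CircleData

end

section

open unitInterval

/-! ### Discrete transport of spinors -/

section Spin

/-- The length of a vector of `ℝ × ℂ = ℝ³`. -/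
noncomputable def len (v : ℝ × ℂ) : ℝ := √(v.1 ^ 2 + ‖v.2‖ ^ 2)

theorem len_sq (v : ℝ × ℂ) : len v ^ 2 = v.1 ^ 2 + ‖v.2‖ ^ 2 := Real.sq_sqrt (by positivity)

theorem len_pos {v : ℝ × ℂ} (hv : v ≠ 0) : 0 < len v := by
  refine Real.sqrt_pos.2 ?_
  by_cases h : v.1 = 0
  · have : v.2 ≠ 0 := fun h2 => hv (Prod.ext h h2)
    positivity
  · positivity

theorem continuous_len : Continuous len := by unfold len; fun_prop

/-- The traceless Hermitian matrix of a vector of `ℝ³`, acting on `ℂ²`. -/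
noncomputable def pauli (v : ℝ × ℂ) (u : ℂ × ℂ) : ℂ × ℂ :=
  (v.1 * u.1 + starRingEnd ℂ v.2 * u.2, v.2 * u.1 - v.1 * u.2)

/-- Hence the eigenvalues are ± `len v` for nonzero `v`, and `spin v` is 2 `len v` times the
projection to the positive eigenline. -/
theorem pauli_pauli (v : ℝ × ℂ) (u : ℂ × ℂ) : pauli v (pauli v u) = ((len v : ℂ) ^ 2) • u := by
  have h : ((len v : ℂ)) ^ 2 = (v.1 : ℂ) ^ 2 + starRingEnd ℂ v.2 * v.2 := by
    rw [Complex.conj_mul']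
    exact_mod_cast len_sq v
  rw [h]
  ext <;> simp [pauli] <;> ring

theorem pauli_add (v w : ℝ × ℂ) (u : ℂ × ℂ) : pauli (v + w) u = pauli v u + pauli w u := by
  ext <;> simp [pauli] <;> ring

theorem pauli_smul (t : ℝ) (v : ℝ × ℂ) (u : ℂ × ℂ) : pauli (t • v) u = (t : ℂ) • pauli v u := by
  ext <;> simp [pauli] <;> ring

theorem pauli_smul_right (c : ℂ) (v : ℝ × ℂ) (u : ℂ × ℂ) : pauli v (c • u) = c • pauli v u := by
  ext <;> simp [pauli] <;> ring

theorem pauli_add_right (v : ℝ × ℂ) (u w : ℂ × ℂ) : pauli v (u + w) = pauli v u + pauli v w := by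
  ext <;> simp [pauli] <;> ring

theorem pauli_injective {v : ℝ × ℂ} (hv : v ≠ 0) {u : ℂ × ℂ} (h : pauli v u = 0) : u = 0 := by
  have h1 := pauli_pauli v u
  rw [h] at h1
  have h2 : pauli v (0 : ℂ × ℂ) = 0 := by ext <;> simp [pauli]
  rw [h2] at h1
  have h3 : ((len v : ℂ)) ^ 2 ≠ 0 := pow_ne_zero _ (by exact_mod_cast (len_pos hv).ne')
  exact (smul_eq_zero.1 h1.symm).resolve_left h3

/-- `u` is a spinor for the direction `v`. -/
def IsSpinor (v : ℝ × ℂ) (u : ℂ × ℂ) : Prop := pauli v u = (len v : ℂ) • u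

/-- Multiple of the projection to the spinors for the direction `v`. -/
noncomputable def spin (v : ℝ × ℂ) (u : ℂ × ℂ) : ℂ × ℂ := (len v : ℂ) • u + pauli v u

theorem isSpinor_spin (v : ℝ × ℂ) (u : ℂ × ℂ) : IsSpinor v (spin v u) := by
  rw [IsSpinor, spin, pauli_add_right, pauli_smul_right, pauli_pauli, smul_add, smul_smul, sq,
    add_comm]

/-- Two vectors that do not point in opposite directions. -/
def NotOpposite (v w : ℝ × ℂ) : Prop := len w • v + len v • w ≠ 0

/-- For a spinor `u` of `v`, the matrix of `len w • v + len v • w` sends `u` to `len v • spin w u`,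
and the matrix of a nonzero vector is injective. -/
theorem spin_ne_zero {v w : ℝ × ℂ} (h : NotOpposite v w) {u : ℂ × ℂ} (hu : IsSpinor v u)
    (h0 : u ≠ 0) : spin w u ≠ 0 := by
  refine fun h1 => h0 (pauli_injective h ?_)
  rw [pauli_add, pauli_smul, pauli_smul, hu, smul_comm, ← smul_add]
  exact (congrArg _ h1).trans (smul_zero _)

theorem spin_smul (c : ℂ) (v : ℝ × ℂ) (u : ℂ × ℂ) : spin v (c • u) = c • spin v u := by
  rw [spin, spin, pauli_smul_right, smul_comm, ← smul_add]

/-- Rotation of ℝ³ about the axis lifts to diag(1, z) on spinors. -/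
theorem spin_rotate (z : Circle) (v : ℝ × ℂ) (u : ℂ × ℂ) :
    spin (v.1, z * v.2) (u.1, z * u.2) = ((spin v u).1, z * (spin v u).2) := by
  have hl : len (v.1, (z : ℂ) * v.2) = len v := by simp [len, Circle.norm_coe]
  have hz : starRingEnd ℂ (z : ℂ) * z = 1 := by
    rw [Complex.conj_mul', Circle.norm_coe]; simp
  simp only [spin, pauli, hl, Prod.mk_add_mk, Prod.smul_mk, smul_eq_mul, Prod.fst_add,
    Prod.snd_add, Prod.smul_fst, Prod.smul_snd, map_mul]
  refine Prod.ext ?_ ?_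
  · simp only
    linear_combination (starRingEnd ℂ v.2 * u.2) * hz
  · simp only
    ring

/-- Successive projections of the spinor `u` along a sequence of directions. -/
noncomputable def spinChain (v : ℕ → ℝ × ℂ) (u : ℂ × ℂ) : ℕ → ℂ × ℂ
  | 0 => u
  | i + 1 => spin (v (i + 1)) (spinChain v u i)

theorem spinChain_spec {v : ℕ → ℝ × ℂ} {u : ℂ × ℂ} (hu : IsSpinor (v 0) u) (h0 : u ≠ 0) (N : ℕ)
    (hN : ∀ i < N, NotOpposite (v i) (v (i + 1))) :
    IsSpinor (v N) (spinChain v u N) ∧ spinChain v u N ≠ 0 := by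
  induction N with
  | zero => exact ⟨hu, h0⟩
  | succ N ih =>
    obtain ⟨h1, h2⟩ := ih fun i hi => hN i (hi.trans N.lt_succ_self)
    exact ⟨isSpinor_spin _ _, spin_ne_zero (hN N N.lt_succ_self) h1 h2⟩

theorem spinChain_congr {v w : ℕ → ℝ × ℂ} (u : ℂ × ℂ) {N : ℕ} (h : ∀ i ≤ N, v i = w i) :
    spinChain v u N = spinChain w u N := by
  induction N with
  | zero => rfl
  | succ N ih => rw [spinChain, spinChain, ih fun i hi => h i (hi.trans N.le_succ), h _ le_rfl]

theorem spinChain_add (v : ℕ → ℝ × ℂ) (u : ℂ × ℂ) (m N : ℕ) :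
    spinChain v u (m + N) = spinChain (fun i => v (m + i)) (spinChain v u m) N := by
  induction N with
  | zero => rfl
  | succ N ih => rw [← add_assoc, spinChain, spinChain, ih, add_assoc]

theorem spinChain_smul (c : ℂ) (v : ℕ → ℝ × ℂ) (u : ℂ × ℂ) (N : ℕ) :
    spinChain v (c • u) N = c • spinChain v u N := by
  induction N with
  | zero => rfl
  | succ N ih => rw [spinChain, spinChain, ih, spin_smul]

theorem spinChain_rotate (z : Circle) (v : ℕ → ℝ × ℂ) (u : ℂ × ℂ) (N : ℕ) :
    spinChain (fun i => ((v i).1, z * (v i).2)) (u.1, z * u.2) N =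
      ((spinChain v u N).1, z * (spinChain v u N).2) := by
  induction N with
  | zero => rfl
  | succ N ih => rw [spinChain, spinChain, ih, spin_rotate]

theorem continuous_spinChain {Y : Type*} [TopologicalSpace Y] {v : Y → ℕ → ℝ × ℂ}
    (hv : ∀ i, Continuous fun y => v y i) (u : ℂ × ℂ) (N : ℕ) :
    Continuous fun y => spinChain (v y) u N := by
  induction N with
  | zero => exact continuous_const
  | succ N ih =>
    simp only [spinChain, spin, pauli]
    have h1 := continuous_len.comp (hv (N + 1))
    have h2 := hv (N + 1)
    simp only [Function.comp_def] at h1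
    fun_prop

/-- Over the positive half axis the spinor line is the first coordinate line, over the negative half
axis the second. The first case turns the final spinor into a number; the second lets a rotation act
on the spinor by a scalar. -/
theorem IsSpinor.snd_eq_zero {v : ℝ × ℂ} {u : ℂ × ℂ} (h : IsSpinor v u) (h1 : 0 < v.1)
    (h2 : v.2 = 0) : u.2 = 0 := by
  have hl : len v = v.1 := by rw [len, h2]; simp [h1.le]
  have := congrArg Prod.snd h
  simp only [pauli, h2, hl, Prod.smul_snd, smul_eq_mul] at this
  have h3 : (v.1 : ℂ) * u.2 = 0 := by linear_combination (-1 / 2) * this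
  exact (mul_eq_zero.1 h3).resolve_left (by exact_mod_cast h1.ne')

theorem IsSpinor.fst_eq_zero {v : ℝ × ℂ} {u : ℂ × ℂ} (h : IsSpinor v u) (h1 : v.1 < 0)
    (h2 : v.2 = 0) : u.1 = 0 := by
  have hl : len v = -v.1 := by
    rw [len, h2]; simp [Real.sqrt_sq_eq_abs, abs_of_neg h1]
  have := congrArg Prod.fst h
  simp only [pauli, h2, hl, Prod.smul_fst, smul_eq_mul, map_zero, zero_mul, add_zero,
    Complex.ofReal_neg] at this
  have h3 : (v.1 : ℂ) * u.1 = 0 := by linear_combination (1 / 2) * this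
  exact (mul_eq_zero.1 h3).resolve_left (by exact_mod_cast h1.ne)

/-- The equidistant points of the unit interval. -/
noncomputable def gridPoint (N i : ℕ) : I := Set.projIcc 0 1 zero_le_one ((i : ℝ) / N)

theorem gridPoint_zero (N : ℕ) : gridPoint N 0 = 0 := by
  simp [gridPoint]

theorem gridPoint_self {N : ℕ} (hN : 0 < N) : gridPoint N N = 1 := by
  have : (N : ℝ) ≠ 0 := by positivity
  simp [gridPoint, div_self this]

theorem gridPoint_mono (N : ℕ) {i j : ℕ} (h : i ≤ j) : gridPoint N i ≤ gridPoint N j :=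
  Set.monotone_projIcc _ (by gcongr)

/-- Not being opposite is an open condition that holds on the diagonal of `I × I`, uniformly over
the compact space `Y`; a Lebesgue number gives the mesh. -/
theorem exists_grid {Y : Type*} [TopologicalSpace Y] [CompactSpace Y] (V : C(Y × I, ℝ × ℂ))
    (hV : ∀ q, V q ≠ 0) : ∃ N₀ : ℕ, ∀ N, N₀ < N → ∀ y i,
      NotOpposite (V (y, gridPoint N i)) (V (y, gridPoint N (i + 1))) := by
  have hopen : IsOpen {q : I × I | ∀ y ∈ (Set.univ : Set Y),
      (q, y) ∈ {r : (I × I) × Y | NotOpposite (V (r.2, r.1.1)) (V (r.2, r.1.2))}} := by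
    refine isOpen_setOf_forall_mem_compact isCompact_univ ?_
    have h1 : Continuous fun r : (I × I) × Y => len (V (r.2, r.1.1)) :=
      continuous_len.comp (by fun_prop)
    have h2 : Continuous fun r : (I × I) × Y => len (V (r.2, r.1.2)) :=
      continuous_len.comp (by fun_prop)
    exact isOpen_ne_fun ((h2.smul (by fun_prop)).add (h1.smul (by fun_prop))) continuous_const
  have hmem := hopen.mem_nhdsSet.2 (show Set.diagonal I ⊆ _ by
    rintro ⟨s, t⟩ (rfl : s = t) y -
    have := len_pos (hV (y, s))
    simp only [Set.mem_ofPred_eq, NotOpposite]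
    rw [← two_smul ℝ, smul_smul]
    exact smul_ne_zero (by positivity) (hV _))
  rw [nhdsSet_diagonal_eq_uniformity, Metric.mem_uniformity_dist] at hmem
  obtain ⟨ε, hε, h⟩ := hmem
  obtain ⟨N₀, hN₀⟩ := exists_nat_one_div_lt hε
  refine ⟨N₀, fun N hN y i => h ?_ y trivial⟩
  have hNpos : (0 : ℝ) < N := by exact_mod_cast (Nat.zero_le _).trans_lt hN
  have h1 : dist (gridPoint N i) (gridPoint N (i + 1)) ≤ 1 / N := by
    have h2 := (LipschitzWith.projIcc (zero_le_one' ℝ)).dist_le_mul ((i : ℝ) / N)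
      (((i + 1 : ℕ) : ℝ) / N)
    refine h2.trans (le_of_eq ?_)
    rw [Real.dist_eq, ← sub_div, abs_div, abs_of_pos hNpos]
    simp
  refine h1.trans_lt (lt_of_le_of_lt ?_ hN₀)
  gcongr
  exact_mod_cast hN

end Spin

end

/-! ### Injectivity from the spinor invariant -/

section

open unitInterval

theorem spinChain_fst_ne_zero {f : I → ℝ × ℂ} {u : ℂ × ℂ} (hu : u ≠ 0) (hs : IsSpinor (f 0) u)
    (h1 : 0 < (f 1).1) (h2 : (f 1).2 = 0) {N : ℕ} (hN : 0 < N)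
    (h : ∀ i, NotOpposite (f (gridPoint N i)) (f (gridPoint N (i + 1)))) :
    (spinChain (fun i => f (gridPoint N i)) u N).1 ≠ 0 := by
  obtain ⟨h3, h4⟩ := spinChain_spec (v := fun i => f (gridPoint N i))
    (by simpa only [gridPoint_zero] using hs) hu N fun i _ => h i
  rw [gridPoint_self hN] at h3
  exact fun h0 => h4 (Prod.ext h0 (h3.snd_eq_zero h1 h2))

/-- Turning the second part of a chain of directions around the axis turns the result. -/
theorem spinChain_half_turn {f g : ℕ → ℝ × ℂ} {u : ℂ × ℂ} {z : Circle} {m k : ℕ}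
    (hl : ∀ i ≤ m, g i = f i) (hr : ∀ i, m ≤ i → g i = ((f i).1, z * (f i).2))
    (hm : (spinChain f u m).1 = 0) :
    z * (spinChain g u (m + k)).1 = (spinChain f u (m + k)).1 := by
  have hc : spinChain g u m = spinChain f u m := spinChain_congr u hl
  have hz : (z : ℂ) ≠ 0 := Circle.coe_ne_zero z
  rw [spinChain_add, spinChain_add f, hc]
  set w := spinChain f u m with hw
  have e1 : w = (z : ℂ)⁻¹ • ((w.1, z * w.2) : ℂ × ℂ) := by
    refine Prod.ext ?_ ?_
    · simp [hm]
    · simp [hz]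
  have e2 : (fun i => g (m + i)) = fun i => ((f (m + i)).1, z * (f (m + i)).2) :=
    _root_.funext fun i => hr _ (Nat.le_add_right _ _)
  rw [e2, e1, spinChain_smul, spinChain_rotate (v := fun i => f (m + i)), ← e1]
  simp [hz]

/-- The first coordinate of the transported spinor is a continuous function to ℂ \ {0} once the grid
is fine enough. Applied to a null homotopy of the image of a loop `ℓ` of the circle, it yields a
null homotopy in ℂ \ {0}. Through the deformation `W` this is a null homotopy of `ℓ` itself: at the
end of `W` only the part of each path after the time `b / 2` is turned by `z`, and that part starts
on the negative half axis. -/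
theorem injective_map_of_spin {X : Type*} [TopologicalSpace X] (c : C(Circle, X))
    (V : C(X × I, ℝ × ℂ)) (hV : ∀ q, V q ≠ 0) {u : ℂ × ℂ} (hu : u ≠ 0)
    (hs : ∀ x, IsSpinor (V (x, 0)) u) (he : ∀ x, 0 < (V (x, 1)).1 ∧ (V (x, 1)).2 = 0)
    (W : C((Circle × I) × I, ℝ × ℂ)) (hW : ∀ q, W q ≠ 0) (hWs : ∀ q, IsSpinor (W (q, 0)) u)
    (hWe : ∀ q, 0 < (W (q, 1)).1 ∧ (W (q, 1)).2 = 0)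
    (hWV : ∀ z τ, W ((z, 0), τ) = V (c z, τ)) (b : ℕ) (hb : b ≤ 1)
    (hl : ∀ z (τ : I), (τ : ℝ) ≤ b / 2 → W ((z, 1), τ) = W ((1, 1), τ))
    (hr : ∀ z (τ : I), (b : ℝ) / 2 ≤ τ →
      W ((z, 1), τ) = ((W ((1, 1), τ)).1, z * (W ((1, 1), τ)).2))
    (hm : ∀ τ : I, (τ : ℝ) = b / 2 → (W ((1, 1), τ)).1 < 0 ∧ (W ((1, 1), τ)).2 = 0) :
    Function.Injective (FundamentalGroup.map c 1) := by
  refine (injective_iff_map_eq_one _).2 fun q hq => ?_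
  obtain ⟨ℓ, rfl⟩ := cls_surjective q
  obtain ⟨K⟩ : (ℓ.map c.continuous).Homotopic (Path.refl (c 1)) := cls_eq_iff.1 hq
  obtain ⟨N₁, hN₁⟩ := exists_grid (Y := I × I) ⟨fun q => V (K q.1, q.2), by fun_prop⟩
    fun q => hV _
  obtain ⟨N₂, hN₂⟩ := exists_grid W hW
  set M := N₁ + N₂ + 1 with hM
  -- This is 2M, so the grid point with index `b * M` is exactly `b / 2`; the sum displays the chain
  -- as cut at this index.
  set N := b * M + (2 * M - b * M) with hN
  have hbM : b * M ≤ M := by simpa using Nat.mul_le_mul_right M hb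
  have hNM : N = 2 * M := by omega
  have hN1 : N₁ < N := by omega
  have hN2 : N₂ < N := by omega
  have hN0 : 0 < N := by omega
  let φ : (I → ℝ × ℂ) → ℂ := fun f => (spinChain (fun i => f (gridPoint N i)) u N).1
  have hφ1 : ∀ q : I × I, φ (fun τ => V (K q, τ)) ≠ 0 := fun q =>
    spinChain_fst_ne_zero (f := fun τ => V (K q, τ)) hu (hs _) (he _).1 (he _).2 hN0 (hN₁ N hN1 q)
  have hφ2 : ∀ q, φ (fun τ => W (q, τ)) ≠ 0 := fun q =>
    spinChain_fst_ne_zero (f := fun τ => W (q, τ)) hu (hWs _) (hWe _).1 (hWe _).2 hN0 (hN₂ N hN2 q)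
  have hc1 : Continuous fun q : I × I => φ fun τ => V (K q, τ) :=
    (continuous_spinChain (fun i => by fun_prop) u N).fst
  have hc2 : Continuous fun q : Circle × I => φ fun τ => W (q, τ) :=
    (continuous_spinChain (fun i => by fun_prop) u N).fst
  -- The half turn gives z · φ = a at the end of the deformation, so the quotient a / φ is there
  -- exactly z.
  set a : ℂ := φ fun τ => W ((1, 1), τ) with ha
  let G₁ : C(I × I, ℂˣ) := unitsMap (fun q => a / φ fun τ => V (K q, τ))
    (continuous_const.div hc1 hφ1) fun q => div_ne_zero (hφ2 _) (hφ1 q)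
  let G₂ : C(Circle × I, ℂˣ) := unitsMap (fun q => a / φ fun τ => W (q, τ))
    (continuous_const.div hc2 hφ2) fun q => div_ne_zero (hφ2 _) (hφ2 q)
  let f : C(Circle, ℂˣ) := ⟨fun z => G₂ (z, 0), by fun_prop⟩
  have hgrid : ((gridPoint N (b * M) : I) : ℝ) = b / 2 := by
    have hMpos : (M : ℝ) ≠ 0 := by positivity
    have h1 : ((b * M : ℕ) : ℝ) / (N : ℝ) = b / 2 := by
      rw [hNM]; push_cast; field_simp
    have hb' : (b : ℝ) ≤ 1 := by exact_mod_cast hb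
    rw [gridPoint, h1, Set.projIcc_of_mem _ (show (b : ℝ) / 2 ∈ Set.Icc 0 1 from
      ⟨by positivity, by linarith⟩)]
  have hturn : ∀ z : Circle, (z : ℂ) * φ (fun τ => W ((z, 1), τ)) = a := fun z => by
    refine spinChain_half_turn (f := fun i => W ((1, 1), gridPoint N i))
      (g := fun i => W ((z, 1), gridPoint N i)) (m := b * M) (fun i hi => hl z _ ?_)
      (fun i hi => hr z _ ?_) ?_
    · rw [← hgrid]; exact gridPoint_mono N hi
    · rw [← hgrid]; exact gridPoint_mono N hi
    · have := (spinChain_spec (v := fun i => W ((1, 1), gridPoint N i))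
        (by simpa only [gridPoint_zero] using hWs _) hu (b * M) fun i _ => hN₂ N hN2 _ i).1
      exact this.fst_eq_zero (hm _ hgrid).1 (hm _ hgrid).2
  have hf : circleUnits.Homotopic f := by
    refine ⟨⟨⟨fun q => G₂ (q.2, σ q.1), by fun_prop⟩, fun z => ?_, fun z => ?_⟩⟩
    · ext
      simp only [unitInterval.symm_zero]
      change a / φ (fun τ => W ((z, 1), τ)) = z
      rw [div_eq_iff (hφ2 _), hturn]
    · simp only [unitInterval.symm_one]
      rfl
  have hinj := (bijective_map_of_homotopic hf 1 (bijective_map_homotopyEquiv circleHomotopyEquiv 1)).1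
  refine (injective_iff_map_eq_one _).1 hinj _ ?_
  rw [groupMap_cls]
  change cls _ = cls (Path.refl (f 1))
  have hGf : ∀ z s t, K (s, t) = c z → G₁ (s, t) = f z := fun z s t h => by
    ext
    change a / φ (fun τ => V (K (s, t), τ)) = a / φ (fun τ => W ((z, 0), τ))
    simp only [h, hWV]
  refine cls_eq_iff.2 ⟨⟨⟨G₁, fun t => ?_, fun t => ?_⟩, fun s t ht => ?_⟩⟩
  · exact hGf _ _ _ (K.apply_zero t)
  · exact hGf _ _ _ (K.apply_one t)
  · rcases ht with rfl | rfl
    · refine (hGf 1 s 0 (K.source s)).trans ?_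
      simp
    · refine (hGf 1 s 1 (K.target s)).trans ?_
      simp

end

section

open unitInterval

/-! ### The invariant on the two fixed circles -/

section Injectivity

variable {n : ℕ}

theorem direction_ne_zero {p : Fin n → ℝ} {F : Fin n → ℂ} (h : (p, F) ∈ ratTuple n) {u v : ℝ}
    (huv : u ≠ 0 ∨ v ≠ 0) : ((pev p u v, hev F u v) : ℝ × ℂ) ≠ 0 := by
  intro h0
  have h1 : pev p u v = 0 := congrArg Prod.fst h0
  have h2 : hev F u v = 0 := congrArg Prod.snd h0
  by_cases hv : v = 0
  · rw [hv, pev_infinity] at h1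
    exact huv.elim (fun hu => pow_ne_zero n hu h1) fun h => h hv
  · rw [pev_eq_pow_mul _ _ hv] at h1
    rw [hev_eq_pow_smul _ _ hv] at h2
    have hvn : v ^ n ≠ 0 := pow_ne_zero _ hv
    exact mem_ratTuple.1 h _ ((mul_eq_zero.1 h1).resolve_left hvn)
      ((smul_eq_zero.1 h2).resolve_left hvn)

/-- The upper half circle, from `(-1, 0)` to `(1, 0)`. -/
noncomputable def halfCircle (τ : I) : ℝ × ℝ := (-Real.cos (Real.pi * τ), Real.sin (Real.pi * τ))

theorem continuous_halfCircle : Continuous halfCircle := by unfold halfCircle; fun_prop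

theorem halfCircle_zero : halfCircle 0 = (-1, 0) := by simp [halfCircle]

theorem halfCircle_one : halfCircle 1 = (1, 0) := by simp [halfCircle]

theorem halfCircle_ne_zero (τ : I) : (halfCircle τ).1 ≠ 0 ∨ (halfCircle τ).2 ≠ 0 := by
  by_contra! h
  have := Real.sin_sq_add_cos_sq (Real.pi * τ)
  simp only [halfCircle, neg_eq_zero] at h
  rw [h.1, h.2] at this
  norm_num at this

theorem halfCircle_snd_nonneg (τ : I) : 0 ≤ (halfCircle τ).2 :=
  Real.sin_nonneg_of_nonneg_of_le_pi (mul_nonneg Real.pi_pos.le τ.2.1)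
    (mul_le_of_le_one_right Real.pi_pos.le τ.2.2)

theorem halfCircle_fst_nonpos {τ : I} (h : (τ : ℝ) ≤ 1 / 2) : (halfCircle τ).1 ≤ 0 := by
  have h0 := mul_nonneg Real.pi_pos.le τ.2.1
  have h1 := mul_le_mul_of_nonneg_left h Real.pi_pos.le
  exact neg_nonpos.2 (Real.cos_nonneg_of_neg_pi_div_two_le_of_le (by linarith [Real.pi_pos])
    (by linarith))

theorem halfCircle_fst_nonneg {τ : I} (h : 1 / 2 ≤ (τ : ℝ)) : 0 ≤ (halfCircle τ).1 := by
  have h0 := mul_le_of_le_one_right Real.pi_pos.le τ.2.2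
  have h1 := mul_le_mul_of_nonneg_left h Real.pi_pos.le
  exact neg_nonneg.2 (Real.cos_nonpos_of_pi_div_two_le_of_le (by linarith)
    (by linarith [Real.pi_pos]))

/-- The directions met along the half circle. -/
noncomputable def directions (n : ℕ) : C(ratTuple n × I, ℝ × ℂ) where
  toFun q := (pev q.1.1.1 (halfCircle q.2).1 (halfCircle q.2).2,
    hev q.1.1.2 (halfCircle q.2).1 (halfCircle q.2).2)
  continuous_toFun := by
    have h := continuous_halfCircle.comp (continuous_snd (X := ratTuple n) (Y := I))
    exact (continuous_pev (by fun_prop) h.fst h.snd).prodMk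
      (continuous_hev (by fun_prop) h.fst h.snd)

theorem directions_ne_zero (q : ratTuple n × I) : directions n q ≠ 0 :=
  direction_ne_zero q.1.2 (halfCircle_ne_zero q.2)

theorem directions_zero (x : ratTuple n) : directions n (x, 0) = ((-1) ^ n, 0) := by
  simp [directions, halfCircle_zero, pev_infinity, hev_infinity]

theorem directions_one (x : ratTuple n) : directions n (x, 1) = (1, 0) := by
  simp [directions, halfCircle_one, pev_infinity, hev_infinity]

theorem hev_circleCoef_oneCoef (z : Circle) (u v : ℝ) :
    hev (circleCoef (oneCoef n ℝ) z) u v = z * hev (oneCoef n ℂ) u v := by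
  rw [circleCoef, ofReal_oneCoef, hev_add, hev_smul, smul_eq_mul]
  ring

/-- The paths start on the negative half axis, and the circle F = z turns each whole path about the
axis. So the cut is at time 0 and no deformation is needed. -/
theorem injective_map_circleMap_odd (hodd : Odd n) (p : Fin n → ℝ)
    (hd : (p, oneCoef n ℝ) ∈ circleData n) :
    Function.Injective (FundamentalGroup.map (circleMap hodd.pos hd) 1) := by
  have hu : ((0, 1) : ℂ × ℂ) ≠ 0 := by simp
  have hs : ∀ x : ratTuple n, IsSpinor (directions n (x, 0)) (0, 1) := fun x => by
    rw [directions_zero, hodd.neg_one_pow]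
    simp [IsSpinor, pauli, len]
  have he : ∀ x : ratTuple n, 0 < (directions n (x, 1)).1 ∧ (directions n (x, 1)).2 = 0 :=
    fun x => by rw [directions_one]; simp
  refine injective_map_of_spin _ (directions n) directions_ne_zero hu hs he
    ⟨fun q => directions n (circleMap hodd.pos hd q.1.1, q.2), by fun_prop⟩
    (fun q => directions_ne_zero _) (fun q => hs _) (fun q => he _) (fun z τ => rfl) 0 zero_le_one
    (fun z τ h => ?_) (fun z τ h => ?_) fun τ h => ?_
  · obtain rfl : τ = 0 := Subtype.ext (le_antisymm (by simpa using h) τ.2.1)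
    exact (directions_zero _).trans (directions_zero _).symm
  · refine Prod.ext rfl ?_
    refine (hev_circleCoef_oneCoef z _ _).trans ?_
    change _ = (z : ℂ) * hev (circleCoef (oneCoef n ℝ) 1) _ _
    rw [circleCoef_one]
  · obtain rfl : τ = 0 := Subtype.ext (by simpa using h)
    have := directions_zero (circleMap hodd.pos hd 1)
    rw [hodd.neg_one_pow] at this
    change (directions n (circleMap hodd.pos hd 1, 0)).1 < 0 ∧
      (directions n (circleMap hodd.pos hd 1, 0)).2 = 0
    rw [this]
    simp

theorem hev_circleCoef_half_line (hn : 2 ≤ n) {e : Fin n → ℝ} (he : ∀ x, hev e x 1 = (x + 1) / 2)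
    (z : Circle) (u v : ℝ) :
    hev (circleCoef e z) u v = (v : ℂ) ^ (n - 1) * ((v - u) / 2 + z * ((u + v) / 2)) := by
  by_cases hv : v = 0
  · rw [hv, hev_infinity, Complex.ofReal_zero, zero_pow (by omega), zero_mul]
  · rw [hev_eq_pow_smul _ _ hv, hev_circleCoef (by omega), he]
    obtain ⟨k, rfl⟩ : ∃ k, n = k + 1 := ⟨n - 1, by omega⟩
    have hv' : (v : ℂ) ≠ 0 := by exact_mod_cast hv
    rw [Complex.real_smul]
    push_cast
    rw [pow_succ, mul_assoc]
    congr 1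
    field_simp
    ring

theorem add_mul_circle_ne_zero {a b : ℝ} (h1 : a + b ≠ 0) (h2 : a ≠ b) (z : Circle) :
    (a : ℂ) + z * b ≠ 0 := by
  intro h
  have h3 := congrArg norm (show (a : ℂ) = -(z : ℂ) * b by linear_combination h)
  rw [norm_mul, norm_neg, Circle.norm_coe, one_mul, Complex.norm_real, Complex.norm_real,
    Real.norm_eq_abs, Real.norm_eq_abs] at h3
  rcases abs_eq_abs.1 h3 with h4 | h4
  · exact h2 h4
  · exact h1 (by linarith)

/-- Here the paths start and end on the positive half axis. The second component is v^(n-1)((v -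
u)/2 + z(u + v)/2); its two coefficients are deformed to the negative and positive parts of u. Then
only the half u ≥ 0 is turned, and at u = 0 the path is on the negative half axis because p(0) < 0.
-/
theorem injective_map_circleMap_even (hn : 0 < n) (heven : Even n) {p e : Fin n → ℝ}
    (hp : pev p 0 1 < 0) (he : ∀ x, hev e x 1 = (x + 1) / 2) (hd : (p, e) ∈ circleData n) :
    Function.Injective (FundamentalGroup.map (circleMap hn hd) 1) := by
  have hn2 : 2 ≤ n := by obtain ⟨k, rfl⟩ := heven; omega
  have hpow : ((0 : ℂ)) ^ (n - 1) = 0 := zero_pow (by omega)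
  have hu : ((1, 0) : ℂ × ℂ) ≠ 0 := by simp
  have hs' : IsSpinor ((1, 0) : ℝ × ℂ) (1, 0) := by simp [IsSpinor, pauli, len]
  have hs : ∀ x : ratTuple n, IsSpinor (directions n (x, 0)) (1, 0) := fun x => by
    rwa [directions_zero, heven.neg_one_pow]
  have hend : ∀ x : ratTuple n, 0 < (directions n (x, 1)).1 ∧ (directions n (x, 1)).2 = 0 :=
    fun x => by rw [directions_one]; simp
  let W : C((Circle × I) × I, ℝ × ℂ) := ⟨fun q => (pev p (halfCircle q.2).1 (halfCircle q.2).2,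
    ((halfCircle q.2).2 : ℂ) ^ (n - 1) *
      (((1 - (q.1.2 : ℝ)) * (((halfCircle q.2).2 - (halfCircle q.2).1) / 2) +
        q.1.2 * max (-(halfCircle q.2).1) 0 : ℝ) +
      q.1.1 * ((1 - (q.1.2 : ℝ)) * (((halfCircle q.2).1 + (halfCircle q.2).2) / 2) +
        q.1.2 * max (halfCircle q.2).1 0 : ℝ))), by
    have h := continuous_halfCircle.comp (continuous_snd (X := Circle × I) (Y := I))
    have h1 := h.fst
    have h2 := h.snd
    simp only [Function.comp_def] at h1 h2
    have h3 : Continuous fun q : (Circle × I) × I => (q.1.1 : ℂ) :=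
      continuous_circle_coe.comp (by fun_prop)
    exact (continuous_pev (by fun_prop) h1 h2).prodMk (by fun_prop)⟩
  have hWdef : ∀ z s τ, W ((z, s), τ) = (pev p (halfCircle τ).1 (halfCircle τ).2,
    ((halfCircle τ).2 : ℂ) ^ (n - 1) *
      (((1 - (s : ℝ)) * (((halfCircle τ).2 - (halfCircle τ).1) / 2) +
        s * max (-(halfCircle τ).1) 0 : ℝ) +
      z * ((1 - (s : ℝ)) * (((halfCircle τ).1 + (halfCircle τ).2) / 2) +
        s * max (halfCircle τ).1 0 : ℝ))) := fun z s τ => rfl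
  have hhalf : ((1 : ℕ) : ℝ) / 2 = 1 / 2 := by norm_num
  refine injective_map_of_spin _ (directions n) directions_ne_zero hu hs hend W ?_ ?_ ?_
    (fun z τ => ?_) 1 le_rfl
    (fun z τ h => ?_) (fun z τ h => ?_) fun τ h => ?_
  · rintro ⟨⟨z, s⟩, τ⟩ h0
    rw [hWdef] at h0
    have h1 := congrArg Prod.fst h0
    have h2 := congrArg Prod.snd h0
    simp only [Prod.fst_zero, Prod.snd_zero] at h1 h2
    have hv := halfCircle_snd_nonneg τ
    have hne := halfCircle_ne_zero τ
    set u := (halfCircle τ).1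
    set v := (halfCircle τ).2
    rcases eq_or_lt_of_le hv with hv0 | hv0
    · rw [← hv0, pev_infinity] at h1
      rw [← hv0] at hne
      exact hne.elim (fun h => pow_ne_zero n h h1) fun h => h rfl
    -- At u = 0 the first component is nonzero. Elsewhere the two real coefficients have the
    -- positive sum (1 - s)v + s|u| and differ by u, so the second component is nonzero.
    rcases eq_or_ne u 0 with hu0 | hu0
    · rw [pev_eq_pow_mul _ _ hv0.ne', hu0, zero_div] at h1
      exact mul_ne_zero (pow_ne_zero _ hv0.ne') hp.ne h1
    have hs0 := s.2.1
    have hs1 := s.2.2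
    have hmax : max (-u) 0 + max u 0 = |u| := by
      rcases le_total 0 u with h | h
      · simp [h, abs_of_nonneg h]
      · simp [h, abs_of_nonpos h]
    have hmax2 : max u 0 - max (-u) 0 = u := by
      rcases le_total 0 u with h | h <;> simp [h]
    have habs := abs_pos.2 hu0
    have hv' : (v : ℂ) ^ (n - 1) ≠ 0 := pow_ne_zero _ (by exact_mod_cast hv0.ne')
    refine add_mul_circle_ne_zero ?_ ?_ z ((mul_eq_zero.1 h2).resolve_left hv')
    · have : 0 < (1 - (s : ℝ)) * v + s * |u| := by
        rcases eq_or_lt_of_le hs0 with h | h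
        · rw [← h]; simpa using hv0
        · have := mul_pos h habs
          have := mul_nonneg (sub_nonneg.2 hs1) hv
          linarith
      rw [← hmax] at this
      intro h
      linarith
    · intro h
      apply hu0
      linear_combination (-1 : ℝ) * h - (s : ℝ) * hmax2
  · rintro ⟨z, s⟩
    rw [hWdef, halfCircle_zero]
    simp only [Complex.ofReal_zero, hpow, zero_mul, pev_infinity, heven.neg_one_pow]
    exact hs'
  · rintro ⟨z, s⟩
    rw [hWdef, halfCircle_one]
    simp [hpow, pev_infinity]
  · rw [hWdef]
    refine Prod.ext rfl ?_
    refine Eq.trans ?_ (hev_circleCoef_half_line hn2 he z _ _).symm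
    simp
  · rw [hhalf] at h
    rw [hWdef, hWdef]
    simp [max_eq_right (halfCircle_fst_nonpos h)]
  · rw [hhalf] at h
    rw [hWdef, hWdef]
    have : max (-(halfCircle τ).1) 0 = 0 := max_eq_right (by linarith [halfCircle_fst_nonneg h])
    simp [this]
    ring
  · rw [hhalf] at h
    have h0 : (halfCircle τ).1 = 0 :=
      le_antisymm (halfCircle_fst_nonpos h.le) (halfCircle_fst_nonneg h.ge)
    have h1 : 0 < (halfCircle τ).2 := lt_of_le_of_ne (halfCircle_snd_nonneg τ)
      ((halfCircle_ne_zero τ).resolve_left (fun h => h h0)).symm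
    rw [hWdef]
    simp only [h0]
    refine ⟨?_, by simp⟩
    rw [pev_eq_pow_mul _ _ h1.ne', zero_div]
    exact mul_neg_of_pos_of_neg (pow_pos h1 n) hp

end Injectivity

end

/-! ### The fixed circles carry the fundamental group -/

section Bijectivity

variable {n : ℕ}

theorem bijective_map_circleMap_odd (hodd : Odd n) (p : Fin n → ℝ)
    (hd : (p, oneCoef n ℝ) ∈ circleData n) :
    Function.Bijective (FundamentalGroup.map (circleMap hodd.pos hd) 1) :=
  ⟨injective_map_circleMap_odd hodd p hd,
    surjective_map_circleMap _ hd fun q b e hb he => joinedIn_base_odd hodd p q b e hb he⟩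

theorem bijective_map_circleMap_even (hn : 0 < n) (heven : Even n) {p e : Fin n → ℝ}
    (hp : pev p 0 1 < 0) (he : ∀ x, hev e x 1 = (x + 1) / 2) (hd : (p, e) ∈ circleData n) :
    Function.Bijective (FundamentalGroup.map (circleMap hn hd) 1) :=
  ⟨injective_map_circleMap_even hn heven hp he hd,
    surjective_map_circleMap _ hd fun q b e' hb he' =>
      joinedIn_base_even hn heven hp he q b e' hb he'⟩

end Bijectivity

/-! ### Projective space as a space of projection matrices -/

section ProjectiveSpace

variable {m : ℕ}

theorem RP.exists_mk (ℓ : RP m) : ∃ v : Fin (m + 1) → ℝ, ∃ hv : v ≠ 0, RP.mk v hv = ℓ :=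
  ⟨_, Projectivization.rep_nonzero ℓ, Projectivization.mk_rep ℓ⟩

theorem RP.mk_eq_mk_iff {v w : Fin (m + 1) → ℝ} {hv : v ≠ 0} {hw : w ≠ 0} :
    RP.mk v hv = RP.mk w hw ↔ ∃ c : ℝ, c • w = v :=
  Projectivization.mk_eq_mk_iff' ℝ v w hv hw

/-- The quotient map onto projective space. -/
noncomputable def RP.quotientMk (m : ℕ) : {v : Fin (m + 1) → ℝ // v ≠ 0} → RP m :=
  fun v => RP.mk v.1 v.2

theorem RP.continuous_quotientMk : Continuous (RP.quotientMk m) :=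
  continuous_quotient_mk'

/-- The saturation of an open set is the union of its preimages under nonzero scalings. Openness is
what keeps the map a quotient map after taking a product with a space of parameters. -/
theorem RP.isOpenQuotientMap_quotientMk : IsOpenQuotientMap (RP.quotientMk m) := by
  refine ⟨fun ℓ => ?_, RP.continuous_quotientMk, fun U hU => ?_⟩
  · obtain ⟨v, hv, h⟩ := RP.exists_mk ℓ
    exact ⟨⟨v, hv⟩, h⟩
  · have hq : Topology.IsQuotientMap (RP.quotientMk m) := isQuotientMap_quotient_mk'
    rw [← hq.isOpen_preimage]
    have : RP.quotientMk m ⁻¹' (RP.quotientMk m '' U) =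
        ⋃ c : ℝˣ, (fun v : {v : Fin (m + 1) → ℝ // v ≠ 0} =>
          (⟨c • v.1, (smul_ne_zero_iff_ne c).2 v.2⟩ : {v : Fin (m + 1) → ℝ // v ≠ 0})) ⁻¹' U := by
      ext v
      simp only [Set.mem_preimage, Set.mem_image, Set.mem_iUnion]
      constructor
      · rintro ⟨w, hw, h⟩
        obtain ⟨c, hc⟩ := RP.mk_eq_mk_iff.1 h
        have hc0 : c ≠ 0 := by rintro rfl; exact w.2 (by rw [← hc, zero_smul])
        refine ⟨Units.mk0 c hc0, ?_⟩
        convert hw using 1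
        exact Subtype.ext hc
      · rintro ⟨c, hc⟩
        exact ⟨_, hc, RP.mk_eq_mk_iff.2 ⟨c, rfl⟩⟩
    rw [this]
    exact isOpen_iUnion fun c => hU.preimage (by
      refine Continuous.subtype_mk ?_ _
      exact continuous_subtype_val.const_smul c)

theorem RP.continuous_mk {Y : Type*} [TopologicalSpace Y] {v : Y → Fin (m + 1) → ℝ}
    (hv : Continuous v) (h0 : ∀ y, v y ≠ 0) : Continuous fun y => RP.mk (v y) (h0 y) :=
  RP.continuous_quotientMk.comp (hv.subtype_mk h0)

/-- The matrix of the orthogonal projection to the line spanned by a vector. -/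
noncomputable def lineProj (v : Fin (m + 1) → ℝ) (i j : Fin (m + 1)) : ℝ :=
  v i * v j / ∑ k, v k ^ 2

theorem sum_sq_pos {v : Fin (m + 1) → ℝ} (hv : v ≠ 0) : 0 < ∑ k, v k ^ 2 := by
  obtain ⟨i, hi⟩ := Function.ne_iff.1 hv
  exact Finset.sum_pos' (fun k _ => sq_nonneg _)
    ⟨i, Finset.mem_univ i, by have : v i ≠ 0 := hi; positivity⟩

theorem lineProj_smul {c : ℝ} (hc : c ≠ 0) (v : Fin (m + 1) → ℝ) :
    lineProj (c • v) = lineProj v := by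
  ext i j
  simp only [lineProj, Pi.smul_apply, smul_eq_mul, mul_pow, ← Finset.mul_sum]
  rw [show c * v i * (c * v j) = c ^ 2 * (v i * v j) by ring,
    mul_div_mul_left _ _ (pow_ne_zero 2 hc)]

/-- The embedding of projective space into the space of matrices. -/
noncomputable def RP.proj (ℓ : RP m) : Fin (m + 1) → Fin (m + 1) → ℝ :=
  Projectivization.lift (fun v : {v : Fin (m + 1) → ℝ // v ≠ 0} => lineProj v.1) (by
    rintro ⟨v, hv⟩ ⟨w, hw⟩ t h
    have ht : t ≠ 0 := by rintro rfl; exact hv (by simpa using h)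
    simp only at h ⊢
    rw [h, lineProj_smul ht]) ℓ

theorem RP.proj_mk (v : Fin (m + 1) → ℝ) (hv : v ≠ 0) : (RP.mk v hv).proj = lineProj v := rfl

theorem RP.continuous_proj : Continuous (RP.proj (m := m)) := by
  rw [RP.isOpenQuotientMap_quotientMk.isQuotientMap.continuous_iff]
  change Continuous fun v : {v : Fin (m + 1) → ℝ // v ≠ 0} => lineProj v.1
  unfold lineProj
  refine continuous_pi fun i => continuous_pi fun j => Continuous.div ?_ ?_ fun v =>
    (sum_sq_pos v.2).ne'
  · exact ((continuous_apply i).comp continuous_subtype_val).mul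
      ((continuous_apply j).comp continuous_subtype_val)
  · exact continuous_finsetSum _ fun k _ => ((continuous_apply k).comp continuous_subtype_val).pow 2

/-- Applying the projection to a vector. -/
def applyProj (A : Fin (m + 1) → Fin (m + 1) → ℝ) (a : Fin (m + 1) → ℝ) : Fin (m + 1) → ℝ :=
  fun i => ∑ j, A i j * a j

theorem applyProj_lineProj (v a : Fin (m + 1) → ℝ) :
    applyProj (lineProj v) a = ((∑ j, v j * a j) / ∑ k, v k ^ 2) • v := by
  ext i
  simp only [applyProj, lineProj, Pi.smul_apply, smul_eq_mul, Finset.sum_div, Finset.sum_mul]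
  exact Finset.sum_congr rfl fun j _ => by ring

theorem applyProj_lineProj_self {v : Fin (m + 1) → ℝ} (hv : v ≠ 0) (c : ℝ) :
    applyProj (lineProj v) (c • v) = c • v := by
  rw [applyProj_lineProj]
  congr 1
  rw [div_eq_iff (sum_sq_pos hv).ne', Finset.mul_sum]
  exact Finset.sum_congr rfl fun j _ => by simp; ring

theorem RP.eq_mk_of_applyProj {ℓ : RP m} {a : Fin (m + 1) → ℝ} (ha : a ≠ 0)
    (h : applyProj ℓ.proj a = a) : ℓ = RP.mk a ha := by
  obtain ⟨v, hv, rfl⟩ := RP.exists_mk ℓ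
  rw [RP.proj_mk, applyProj_lineProj] at h
  exact (RP.mk_eq_mk_iff.2 ⟨_, h⟩).symm

theorem RP.proj_injective : Function.Injective (RP.proj (m := m)) := by
  intro ℓ ℓ' h
  obtain ⟨v, hv, rfl⟩ := RP.exists_mk ℓ'
  refine RP.eq_mk_of_applyProj hv ?_
  rw [h, RP.proj_mk]
  simpa using applyProj_lineProj_self hv 1

instance : CompactSpace (RP m) := by
  have hK : IsCompact (Metric.sphere (0 : Fin (m + 1) → ℝ) 1) := isCompact_sphere _ _
  have := isCompact_iff_compactSpace.1 hK
  have h0 : ∀ v : Metric.sphere (0 : Fin (m + 1) → ℝ) 1, v.1 ≠ 0 := fun v =>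
    ne_zero_of_mem_unit_sphere v
  have hc : Continuous fun v : Metric.sphere (0 : Fin (m + 1) → ℝ) 1 => RP.mk v.1 (h0 v) :=
    RP.continuous_mk continuous_subtype_val h0
  refine Function.Surjective.compactSpace hc fun ℓ => ?_
  obtain ⟨v, hv, rfl⟩ := RP.exists_mk ℓ
  exact ⟨⟨‖v‖⁻¹ • v, by simp [norm_smul, hv]⟩, RP.mk_eq_mk_iff.2 ⟨‖v‖⁻¹, rfl⟩⟩

theorem RP.isClosedEmbedding_proj : Topology.IsClosedEmbedding (RP.proj (m := m)) :=
  RP.continuous_proj.isClosedEmbedding RP.proj_injective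

instance : T2Space (RP m) := RP.isClosedEmbedding_proj.isEmbedding.t2Space

instance {X : Type*} [TopologicalSpace X] [CompactSpace X] :
    TopologicalSpace.MetrizableSpace C(X, RP m) :=
  (ContinuousMap.isEmbedding_postcomp (X := X) ⟨RP.proj, RP.continuous_proj⟩
    RP.isClosedEmbedding_proj.isEmbedding).metrizableSpace

/-- For nonzero vectors this is the squared cosine of the angle between the lines; it does not
depend on the choice of the spanning vectors. -/
theorem sum_lineProj_mul (a b : Fin (m + 1) → ℝ) :
    ∑ k, ∑ l, lineProj a k l * lineProj b k l =
      (∑ k, a k * b k) ^ 2 / ((∑ k, a k ^ 2) * ∑ k, b k ^ 2) := by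
  rw [sq (∑ k, a k * b k), Finset.sum_mul_sum, Finset.sum_div]
  refine Finset.sum_congr rfl fun k _ => ?_
  rw [Finset.sum_div]
  refine Finset.sum_congr rfl fun l _ => ?_
  rw [lineProj, lineProj, div_mul_div_comm]
  ring

/-- Distance of lines in terms of the angle between them. -/
theorem abs_lineProj_sub_le {v w : Fin (m + 1) → ℝ} (hv : v ≠ 0) (hw : w ≠ 0) (i j : Fin (m + 1)) :
    (lineProj v i j - lineProj w i j) ^ 2 ≤
      2 - 2 * ((∑ k, v k * w k) ^ 2 / ((∑ k, v k ^ 2) * ∑ k, w k ^ 2)) := by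
  have hv' := (sum_sq_pos hv).ne'
  have hw' := (sum_sq_pos hw).ne'
  have h1 : ∑ k, ∑ l, (lineProj v k l - lineProj w k l) ^ 2 =
      2 - 2 * ((∑ k, v k * w k) ^ 2 / ((∑ k, v k ^ 2) * ∑ k, w k ^ 2)) := by
    have e : ∀ k l, (lineProj v k l - lineProj w k l) ^ 2 = lineProj v k l * lineProj v k l +
        lineProj w k l * lineProj w k l - 2 * (lineProj v k l * lineProj w k l) := fun k l => by ring
    simp only [e, Finset.sum_sub_distrib, Finset.sum_add_distrib, ← Finset.mul_sum, sum_lineProj_mul]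
    simp only [← sq]
    rw [div_self (pow_ne_zero 2 hv'), div_self (pow_ne_zero 2 hw')]
    ring
  rw [← h1]
  refine (Finset.single_le_sum (f := fun l => (lineProj v i l - lineProj w i l) ^ 2)
    (fun l _ => sq_nonneg _) (Finset.mem_univ j)).trans ?_
  exact Finset.single_le_sum (f := fun k => ∑ l, (lineProj v k l - lineProj w k l) ^ 2)
    (fun k _ => Finset.sum_nonneg fun l _ => sq_nonneg _) (Finset.mem_univ i)

end ProjectiveSpace

section

open unitInterval

/-! ### From polynomial tuples to loops -/

section LoopMap

variable {n : ℕ}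

/-- The coefficients of the three polynomials `p`, `p + Re F`, `p + Im F`. -/
def triple (x : (Fin n → ℝ) × (Fin n → ℂ)) : Fin 3 → Fin n → ℝ :=
  ![x.1, x.1 + fun i => (x.2 i).re, x.1 + fun i => (x.2 i).im]

theorem hev_re (c : Fin n → ℂ) (u v : ℝ) : hev (fun i => (c i).re) u v = (hev c u v).re := by
  simp only [hev, Complex.re_sum, Complex.smul_re, smul_eq_mul]

theorem hev_im (c : Fin n → ℂ) (u v : ℝ) : hev (fun i => (c i).im) u v = (hev c u v).im := by
  simp only [hev, Complex.im_sum, Complex.smul_im, smul_eq_mul]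

theorem pev_add (a b : Fin n → ℝ) (u v : ℝ) : pev (a + b) u v = pev a u v + hev b u v := by
  rw [pev, pev, hev_add, add_assoc]

theorem triple_surjective : Function.Surjective (triple (n := n)) := by
  intro P
  refine ⟨(P 0, fun i => ⟨P 1 i - P 0 i, P 2 i - P 0 i⟩), ?_⟩
  ext i j
  fin_cases i <;> simp [triple]

/-- The values of the three homogenized polynomials. -/
noncomputable def vec (x : (Fin n → ℝ) × (Fin n → ℂ)) (w : Fin 2 → ℝ) : Fin 3 → ℝ :=
  fun i => pev (triple x i) (w 0) (w 1)

theorem vec_zero (x : (Fin n → ℝ) × (Fin n → ℂ)) (w : Fin 2 → ℝ) :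
    vec x w 0 = pev x.1 (w 0) (w 1) := rfl

theorem vec_one (x : (Fin n → ℝ) × (Fin n → ℂ)) (w : Fin 2 → ℝ) :
    vec x w 1 = pev x.1 (w 0) (w 1) + (hev x.2 (w 0) (w 1)).re := by
  rw [← hev_re, ← pev_add]; rfl

theorem vec_two (x : (Fin n → ℝ) × (Fin n → ℂ)) (w : Fin 2 → ℝ) :
    vec x w 2 = pev x.1 (w 0) (w 1) + (hev x.2 (w 0) (w 1)).im := by
  rw [← hev_im, ← pev_add]; rfl

theorem vec_smul (x : (Fin n → ℝ) × (Fin n → ℂ)) (c : ℝ) (w : Fin 2 → ℝ) :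
    vec x (c • w) = c ^ n • vec x w :=
  _root_.funext fun _ => pev_homog _ _ _ _

theorem vec_infinity (x : (Fin n → ℝ) × (Fin n → ℂ)) : vec x ![1, 0] = fun _ => 1 := by
  ext i
  simp [vec, pev_infinity]

theorem continuous_vec :
    Continuous fun q : ((Fin n → ℝ) × (Fin n → ℂ)) × (Fin 2 → ℝ) => vec q.1 q.2 := by
  have h0 : Continuous fun q : ((Fin n → ℝ) × (Fin n → ℂ)) × (Fin 2 → ℝ) =>
    pev q.1.1 (q.2 0) (q.2 1) := continuous_pev (by fun_prop) (by fun_prop) (by fun_prop)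
  have h1 : Continuous fun q : ((Fin n → ℝ) × (Fin n → ℂ)) × (Fin 2 → ℝ) =>
    hev q.1.2 (q.2 0) (q.2 1) := continuous_hev (by fun_prop) (by fun_prop) (by fun_prop)
  refine continuous_pi fun i => ?_
  fin_cases i
  · exact h0
  · refine (h0.add (Complex.continuous_re.comp h1)).congr fun q => (vec_one _ _).symm
  · refine (h0.add (Complex.continuous_im.comp h1)).congr fun q => (vec_two _ _).symm

theorem vec_ne_zero_iff (x : (Fin n → ℝ) × (Fin n → ℂ)) (w : Fin 2 → ℝ) :
    vec x w ≠ 0 ↔ ((pev x.1 (w 0) (w 1), hev x.2 (w 0) (w 1)) : ℝ × ℂ) ≠ 0 := by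
  refine not_congr ⟨fun h => ?_, fun h => ?_⟩
  · have h0 := congrFun h 0
    have h1 := congrFun h 1
    have h2 := congrFun h 2
    rw [vec_zero] at h0
    rw [vec_one, show pev x.1 (w 0) (w 1) = 0 from h0, zero_add] at h1
    rw [vec_two, show pev x.1 (w 0) (w 1) = 0 from h0, zero_add] at h2
    exact Prod.ext h0 (Complex.ext h1 h2)
  · have h0 : pev x.1 (w 0) (w 1) = 0 := congrArg Prod.fst h
    have h1 : hev x.2 (w 0) (w 1) = 0 := congrArg Prod.snd h
    ext i
    fin_cases i
    · exact h0
    · exact (vec_one x w).trans (by simp [h0, h1])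
    · exact (vec_two x w).trans (by simp [h0, h1])

theorem vec_ne_zero {x : (Fin n → ℝ) × (Fin n → ℂ)} (hx : x ∈ ratTuple n) {w : Fin 2 → ℝ}
    (hw : w ≠ 0) : vec x w ≠ 0 := by
  refine (vec_ne_zero_iff x w).2 (direction_ne_zero hx ?_)
  by_contra! h
  refine hw (_root_.funext fun i => ?_)
  fin_cases i
  · exact h.1
  · exact h.2

theorem mem_ratTuple_of_vec {x : (Fin n → ℝ) × (Fin n → ℂ)} (h : ∀ t : ℝ, vec x ![t, 1] ≠ 0) :
    x ∈ ratTuple n := by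
  refine mem_ratTuple.2 fun t ht h' => (vec_ne_zero_iff x _).1 (h t) ?_
  exact Prod.ext ht h'

/-- Evaluation of the loop defined by a triple of polynomials. -/
noncomputable def loopEval (n : ℕ) (q : ratTuple n × RP 1) : RP 2 :=
  Projectivization.lift (fun w : {w : Fin 2 → ℝ // w ≠ 0} =>
    RP.mk (vec q.1.1 w.1) (vec_ne_zero q.1.2 w.2)) (by
      rintro ⟨v, hv⟩ ⟨w, hw⟩ t h
      simp only at h
      refine RP.mk_eq_mk_iff.2 ⟨t ^ n, ?_⟩
      simp only
      rw [h, vec_smul]) q.2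

theorem continuous_loopEval : Continuous (loopEval n) := by
  have hq := (IsOpenQuotientMap.id (X := ratTuple n)).prodMap
    (RP.isOpenQuotientMap_quotientMk (m := 1))
  rw [hq.isQuotientMap.continuous_iff]
  exact RP.continuous_mk (v := fun q : ratTuple n × {w : Fin 2 → ℝ // w ≠ 0} => vec q.1.1 q.2.1)
    (continuous_vec.comp (f := fun q : ratTuple n × {w : Fin 2 → ℝ // w ≠ 0} => (q.1.1, q.2.1))
      (by fun_prop)) fun q => vec_ne_zero q.1.2 q.2.2

/-- The loop defined by a triple of polynomials. -/
noncomputable def loopMap (n : ℕ) : C(ratTuple n, LoopRP 2) where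
  toFun x := ⟨(ContinuousMap.curry ⟨loopEval n, continuous_loopEval⟩) x, by
    change RP.mk (vec x.1 ![1, 0]) _ = RP.mk _ _
    congr 1
    exact vec_infinity _⟩
  continuous_toFun := by fun_prop

theorem loopMap_mk (x : ratTuple n) (w : Fin 2 → ℝ) (hw : w ≠ 0) :
    (loopMap n x).1 (RP.mk w hw) = RP.mk (vec x.1 w) (vec_ne_zero x.2 hw) := rfl

theorem eq_infinity_or_affinePoint (ℓ : RP 1) : ℓ = infinity ∨ ∃ x, ℓ = affinePoint x := by
  obtain ⟨w, hw, rfl⟩ := RP.exists_mk ℓ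
  by_cases h : w 1 = 0
  · left
    refine RP.mk_eq_mk_iff.2 ⟨w 0, ?_⟩
    ext i; fin_cases i <;> simp [h]
  · right
    refine ⟨w 0 / w 1, RP.mk_eq_mk_iff.2 ⟨w 1, ?_⟩⟩
    ext i; fin_cases i <;> simp [mul_div_cancel₀ _ h]

theorem loop_ext {f g : LoopRP 2} (h : ∀ x, f.1 (affinePoint x) = g.1 (affinePoint x)) :
    f = g := by
  refine Subtype.ext (ContinuousMap.ext fun ℓ => ?_)
  rcases eq_infinity_or_affinePoint ℓ with rfl | ⟨x, rfl⟩
  · rw [f.2, g.2]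
  · exact h x

theorem loopMap_affinePoint (x : ratTuple n) (t : ℝ) {a : Fin 3 → ℝ} (ha : a ≠ 0)
    (h : ∀ i, pev (triple x.1 i) t 1 = a i) : (loopMap n x).1 (affinePoint t) = RP.mk a ha := by
  rw [affinePoint, loopMap_mk]
  congr 1
  exact _root_.funext h

/-- Triples of monic polynomials without common real zero define loops. -/
theorem exists_loopMap (P : Fin 3 → ℝ[X]) (hP : ∀ i, (P i).Monic ∧ (P i).natDegree = n)
    (h0 : ∀ x : ℝ, (fun i => (P i).eval x) ≠ 0) :
    ∃ y : ratTuple n, ∀ x : ℝ, (loopMap n y).1 (affinePoint x) = RP.mk _ (h0 x) := by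
  obtain ⟨y, hy⟩ := triple_surjective (n := n) fun i => coef n (P i)
  have h1 : ∀ i x, pev (triple y i) x 1 = (P i).eval x := fun i x => by
    rw [hy, pev_coef _ (hP i).1 (hP i).2]
  have hm : y ∈ ratTuple n := mem_ratTuple_of_vec fun t => by
    have := h0 t
    simp only [← h1] at this
    exact this
  exact ⟨⟨y, hm⟩, fun x => loopMap_affinePoint _ _ _ fun i => h1 i x⟩

theorem aeval_ofReal (P : ℝ[X]) (t : ℝ) : aeval (t : ℂ) P = ((P.eval t : ℝ) : ℂ) := by
  have := aeval_algebraMap_apply ℂ t P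
  simpa [coe_aeval_eq_eval] using this

theorem loopMap_mem_exactRat (x : ratTuple n)
    (h : ∀ z : ℂ, ∃ i, aeval z (monicPoly (triple x.1 i)) ≠ 0) : loopMap n x ∈ exactRat n 2 := by
  have h1 : ∀ t : ℝ, (fun i => (monicPoly (triple x.1 i)).eval t) ≠ 0 := fun t h0 => by
    obtain ⟨i, hi⟩ := h t
    apply hi
    have := congrFun h0 i
    simp only [Pi.zero_apply] at this
    rw [aeval_ofReal, this, Complex.ofReal_zero]
  exact ⟨fun i => monicPoly (triple x.1 i), fun i => ⟨monic_monicPoly _, natDegree_monicPoly _⟩, h,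
    fun t => ⟨h1 t, loopMap_affinePoint _ _ _ fun i => pev_eq_eval _ _⟩⟩

theorem lowPoly_add {R : Type*} [Semiring R] (c d : Fin n → R) :
    lowPoly (c + d) = lowPoly c + lowPoly d := by
  simp [lowPoly, add_mul, Finset.sum_add_distrib]

theorem lowPoly_smul_oneCoef (hn : 0 < n) (s : ℝ) : lowPoly (s • oneCoef n ℝ) = C s := by
  refine Polynomial.funext fun x => ?_
  rw [← hev_eq_eval_real, hev_smul, hev_one_real hn]
  simp

/-- Adding a real constant s to Re F leaves a common complex root z of the first two polynomials
only if s = -Re q(z) for a root z of the first, where q is the old Re F. These are finitely many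
values, so s can tend to 0 avoiding them. -/
theorem loopMap_mem_rat (hn : 0 < n) (x : ratTuple n) : loopMap n x ∈ rat n 2 := by
  let T : Set (ratTuple n) := {y | loopMap n y ∈ exactRat n 2}
  have hx : x ∈ closure T := by
    rw [closure_subtype]
    let q : ℝ[X] := lowPoly fun i => (x.1.2 i).re
    let B : Set ℝ := (fun z : ℂ => -(aeval z q).re) '' (monicPoly x.1.1).rootSet ℂ
    have hB : B.Finite := (rootSet_finite _ _).image _
    let f : ℝ → (Fin n → ℝ) × (Fin n → ℂ) := fun s =>
      (x.1.1, x.1.2 + fun i => ((s * oneCoef n ℝ i : ℝ) : ℂ))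
    have hf0 : f 0 = x.1 := by
      refine Prod.ext rfl ?_
      ext i; simp [f]
    have hf : Continuous f := by fun_prop
    have key : Set.MapsTo f Bᶜ (Subtype.val '' T) := by
      intro s hs
      have hroot : ∀ z : ℂ, ∃ i, aeval z (monicPoly (triple (f s) i)) ≠ 0 := by
        intro z
        by_cases hz : aeval z (monicPoly x.1.1) = 0
        · refine ⟨1, fun h => hs ⟨z, ?_, ?_⟩⟩
          · exact (mem_rootSet_of_ne (monic_monicPoly _).ne_zero).2 hz
          · have e : triple (f s) 1 = x.1.1 + ((fun i => (x.1.2 i).re) + s • oneCoef n ℝ) := by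
              ext i; simp [triple, f]
            have e2 : monicPoly (triple (f s) 1) = monicPoly x.1.1 + (q + C s) := by
              rw [e, monicPoly, lowPoly_add, lowPoly_add, lowPoly_smul_oneCoef hn, monicPoly,
                add_assoc]
            rw [e2, map_add, hz, map_add, aeval_C, zero_add] at h
            have := congrArg Complex.re h
            simp at this
            linarith
        · exact ⟨0, hz⟩
      have hm : f s ∈ ratTuple n := mem_ratTuple_of_vec fun t ht => by
        obtain ⟨i, hi⟩ := hroot t
        apply hi
        have h1 := congrFun ht i
        simp only [vec, Matrix.cons_val_zero, Matrix.cons_val_one, Pi.zero_apply] at h1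
        rw [pev_eq_eval] at h1
        rw [aeval_ofReal, h1, Complex.ofReal_zero]
      exact ⟨⟨f s, hm⟩, loopMap_mem_exactRat _ hroot, rfl⟩
    rw [← hf0]
    exact map_mem_closure hf (hB.countable.dense_compl ℝ 0) key
  exact map_mem_closure (loopMap n).continuous hx fun y hy => hy

end LoopMap

end

section

open unitInterval Filter Topology

/-! ### Every rational loop comes from a polynomial tuple -/

section Range

variable {n d : ℕ}

theorem continuous_affinePoint : Continuous affinePoint :=
  RP.continuous_mk (v := fun x : ℝ => ![x, 1]) (by fun_prop) _

/-- The loop `g` is given by the triple `Q` wherever the latter does not vanish. -/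
def Represents (Q : Fin 3 → ℝ[X]) (g : LoopRP 2) : Prop :=
  ∀ x : ℝ, applyProj (g.1 (affinePoint x)).proj (fun i => (Q i).eval x) = fun i => (Q i).eval x

theorem continuous_applyProj {Y : Type*} [TopologicalSpace Y] {m : ℕ}
    {A : Y → Fin (m + 1) → Fin (m + 1) → ℝ} {a : Y → Fin (m + 1) → ℝ} (hA : Continuous A)
    (ha : Continuous a) : Continuous fun y => applyProj (A y) (a y) := by
  unfold applyProj
  fun_prop

theorem applyProj_smul {m : ℕ} (A : Fin (m + 1) → Fin (m + 1) → ℝ) (c : ℝ)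
    (a : Fin (m + 1) → ℝ) : applyProj A (c • a) = c • applyProj A a := by
  ext i
  simp only [applyProj, Pi.smul_apply, smul_eq_mul, Finset.mul_sum]
  exact Finset.sum_congr rfl fun j _ => by ring

/-- Scale the coefficients to the unit sphere. Being represented by a triple is a closed condition,
and projection along a compact factor is closed, so it survives in the closure. Only the bound on
the degree remains, and common zeros may appear. -/
theorem represents_of_mem_rat {g : LoopRP 2} (hg : g ∈ rat n 2) :
    ∃ Q : Fin 3 → ℝ[X], Q ≠ 0 ∧ (∀ i, (Q i).natDegree ≤ n) ∧ Represents Q g := by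
  have hK : IsCompact (Metric.sphere (0 : Fin 3 → Fin (n + 1) → ℝ) 1) := isCompact_sphere _ _
  have := isCompact_iff_compactSpace.1 hK
  let A : Set (LoopRP 2 × Metric.sphere (0 : Fin 3 → Fin (n + 1) → ℝ) 1) :=
    {q | ∀ x : ℝ, applyProj (q.1.1 (affinePoint x)).proj (fun i => ∑ j, q.2.1 i j * x ^ (j : ℕ)) =
      fun i => ∑ j, q.2.1 i j * x ^ (j : ℕ)}
  have hA : IsClosed A := by
    simp only [A, Set.ofPred_forall]
    refine isClosed_iInter fun x => ?_
    have h1 : Continuous fun q : LoopRP 2 × Metric.sphere (0 : Fin 3 → Fin (n + 1) → ℝ) 1 =>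
        fun i => ∑ j, q.2.1 i j * x ^ (j : ℕ) := by
      refine continuous_pi fun i => continuous_finsetSum _ fun j _ => Continuous.mul ?_ (by fun_prop)
      exact (continuous_apply_apply i j).comp (continuous_subtype_val.comp continuous_snd)
    refine isClosed_eq (continuous_applyProj (RP.continuous_proj.comp ?_) h1) h1
    exact (continuous_eval_const _).comp
      (continuous_subtype_val.comp continuous_fst)
  have hcl := isClosedMap_fst_of_compactSpace A hA
  have hsub : exactRat n 2 ⊆ Prod.fst '' A := by
    rintro f ⟨p, hp, -, h⟩
    let c : Fin 3 → Fin (n + 1) → ℝ := fun i j => (p i).coeff j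
    have hc : c ≠ 0 := fun h0 => by
      have := congrFun (congrFun h0 0) (Fin.last n)
      have h2 := (hp 0).1.coeff_natDegree
      rw [(hp 0).2] at h2
      simp [c, h2] at this
    have hev : ∀ x i, ∑ j, c i j * x ^ (j : ℕ) = (p i).eval x := fun x i => by
      rw [eval_eq_sum_range, (hp i).2, Finset.sum_range]
    refine ⟨(f, ⟨‖c‖⁻¹ • c, by simp [norm_smul, hc]⟩), fun x => ?_, rfl⟩
    have e : (fun i => ∑ j, (‖c‖⁻¹ • c) i j * x ^ (j : ℕ)) = ‖c‖⁻¹ • fun i => (p i).eval x := by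
      ext i
      simp only [Pi.smul_apply, smul_eq_mul, mul_assoc, ← Finset.mul_sum, hev]
    obtain ⟨h0, h1⟩ := h x
    simp only [e, h1, RP.proj_mk]
    exact applyProj_lineProj_self h0 _
  obtain ⟨⟨g', C⟩, hC, rfl⟩ := closure_minimal hsub hcl hg
  let Q : Fin 3 → ℝ[X] := fun i => ∑ j : Fin (n + 1), Polynomial.C (C.1 i j) * X ^ (j : ℕ)
  have hcoeff : ∀ i (j : Fin (n + 1)), (Q i).coeff j = C.1 i j := fun i j => by
    simp [Q, coeff_X_pow, Fin.val_inj]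
  refine ⟨Q, fun h0 => ?_, fun i => ?_, fun x => ?_⟩
  · refine ne_zero_of_mem_unit_sphere C ?_
    ext i j
    rw [← hcoeff, h0]
    simp
  · refine natDegree_sum_le_of_forall_le _ _ fun j _ => (natDegree_C_mul_X_pow_le _ _).trans ?_
    omega
  · have e : (fun i => (Q i).eval x) = fun i => ∑ j, C.1 i j * x ^ (j : ℕ) := by
      ext i; simp [Q, eval_finsetSum]
    rw [e]
    exact hC x

/-- Cancel a common linear factor: the condition persists away from its root, and at the root by
continuity. The degree bound drops each time. -/
theorem Represents.exists_no_common_zero {g : LoopRP 2} (N : ℕ) (Q : Fin 3 → ℝ[X]) (hQ : Q ≠ 0)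
    (hd : ∀ i, (Q i).natDegree ≤ N) (h : Represents Q g) :
    ∃ R : Fin 3 → ℝ[X], (∀ x : ℝ, (fun i => (R i).eval x) ≠ 0) ∧ (∀ i, (R i).natDegree ≤ N) ∧
      Represents R g := by
  induction N generalizing Q with
  | zero =>
    refine ⟨Q, fun x h0 => hQ (_root_.funext fun i => ?_), hd, h⟩
    have h1 := congrFun h0 i
    have h2 := eq_C_of_natDegree_le_zero (hd i)
    rw [h2] at h1 ⊢
    simpa using h1
  | succ N ih =>
    by_cases h0 : ∀ x : ℝ, (fun i => (Q i).eval x) ≠ 0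
    · exact ⟨Q, h0, hd, h⟩
    push Not at h0
    obtain ⟨a, ha⟩ := h0
    have hdiv : ∀ i, ∃ R, Q i = (X - C a) * R := fun i => dvd_iff_isRoot.2 (congrFun ha i)
    choose R hR using hdiv
    obtain ⟨T, hT, hTd, hTr⟩ := ih R (fun h0 => hQ (_root_.funext fun i => by simp [hR, h0]))
      (fun i => by
        rcases eq_or_ne (R i) 0 with h0 | h0
        · simp [h0]
        · have := hd i
          rw [hR, natDegree_mul (X_sub_C_ne_zero a) h0, natDegree_X_sub_C] at this
          omega) (by
        have hne : ∀ x ≠ a, applyProj (g.1 (affinePoint x)).proj (fun i => (R i).eval x) =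
            fun i => (R i).eval x := by
          intro x hx
          have h1 := h x
          have e : (fun i => (Q i).eval x) = (x - a) • fun i => (R i).eval x := by
            ext i; simp [hR]
          rw [e, applyProj_smul] at h1
          exact smul_right_injective _ (sub_ne_zero.2 hx) h1
        have hc1 : Continuous fun x : ℝ => fun i => (R i).eval x :=
          continuous_pi fun i => (R i).continuous
        have hc : IsClosed {x : ℝ | applyProj (g.1 (affinePoint x)).proj (fun i => (R i).eval x) =
            fun i => (R i).eval x} := isClosed_eq (continuous_applyProj (RP.continuous_proj.comp
              (g.1.continuous.comp continuous_affinePoint)) hc1) hc1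
        intro x
        exact hc.closure_subset_iff.2 hne (dense_compl_singleton a x))
    exact ⟨T, hT, fun i => (hTd i).trans N.le_succ, hTr⟩

/-- Let k be the largest degree. Reversing the polynomials is the coordinate change at infinity and
puts the coefficients of degree k at 0; as the loop passes through [1:1:1] there, these are equal,
and dividing by them makes the triple monic. -/
theorem Represents.exists_loopMap {g : LoopRP 2} {N : ℕ} {R : Fin 3 → ℝ[X]}
    (h0 : ∀ x : ℝ, (fun i => (R i).eval x) ≠ 0) (hd : ∀ i, (R i).natDegree ≤ N)
    (h : Represents R g) : ∃ d ≤ N, ∃ y : ratTuple d, loopMap d y = g := by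
  -- The shift by 1 ranks nonzero constants above the zero polynomial, so the maximum is attained at
  -- a nonzero polynomial.
  obtain ⟨i₀, -, hi₀⟩ := Finset.exists_max_image Finset.univ
    (fun i => if R i = 0 then 0 else (R i).natDegree + 1) (Finset.univ_nonempty (α := Fin 3))
  have hR : R i₀ ≠ 0 := fun hz => by
    obtain ⟨j, hj⟩ := Function.ne_iff.1 (h0 0)
    have := hi₀ j (Finset.mem_univ j)
    rw [if_pos hz, if_neg (by rintro h; simp [h] at hj)] at this
    omega
  set k := (R i₀).natDegree with hk
  have hle : ∀ i, (R i).natDegree ≤ k := fun i => by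
    have := hi₀ i (Finset.mem_univ i)
    simp only [if_neg hR] at this
    split_ifs at this with hz
    · simp [hz]
    · omega
  have hrefl : ∀ t : ℝ, t ≠ 0 → ∀ i, (reflect k (R i)).eval t = t ^ k * (R i).eval t⁻¹ := by
    intro t ht i
    have : Invertible t⁻¹ := invertibleOfNonzero (inv_ne_zero ht)
    have h1 := eval₂_reflect_mul_pow (RingHom.id ℝ) t⁻¹ k (R i) (hle i)
    rw [invOf_eq_inv, inv_inv, ← eval, ← eval] at h1
    rw [← h1, mul_comm, mul_assoc, ← mul_pow, inv_mul_cancel₀ ht, one_pow, mul_one]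
  have hv0 : ∀ t : ℝ, (![1, t] : Fin 2 → ℝ) ≠ 0 := fun t h => one_ne_zero (congrFun h 0)
  have hc : Continuous fun t : ℝ => RP.mk ![1, t] (hv0 t) := RP.continuous_mk (by fun_prop) _
  have hc1 : Continuous fun t : ℝ => fun i => (reflect k (R i)).eval t :=
    continuous_pi fun i => (reflect k (R i)).continuous
  have hcl : IsClosed {t : ℝ | applyProj (g.1 (RP.mk ![1, t] (hv0 t))).proj
      (fun i => (reflect k (R i)).eval t) = fun i => (reflect k (R i)).eval t} :=
    isClosed_eq (continuous_applyProj (RP.continuous_proj.comp (g.1.continuous.comp hc)) hc1) hc1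
  have hne : ∀ t : ℝ, t ≠ 0 → applyProj (g.1 (RP.mk ![1, t] (hv0 t))).proj
      (fun i => (reflect k (R i)).eval t) = fun i => (reflect k (R i)).eval t := by
    intro t ht
    have e : (fun i => (reflect k (R i)).eval t) = t ^ k • fun i => (R i).eval t⁻¹ := by
      ext i; simp [hrefl t ht]
    have e2 : RP.mk ![1, t] (hv0 t) = affinePoint t⁻¹ := by
      refine RP.mk_eq_mk_iff.2 ⟨t, ?_⟩
      ext i; fin_cases i <;> simp [ht]
    rw [e, e2, applyProj_smul, h]
  have hinf := hcl.closure_subset_iff.2 hne (dense_compl_singleton (0 : ℝ) 0)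
  have einf : RP.mk ![1, 0] (hv0 0) = infinity := rfl
  have ecoef : (fun i => (reflect k (R i)).eval 0) = fun i => (R i).coeff k := by
    ext i
    rw [← coeff_zero_eq_eval_zero, coeff_reflect, revAt_le (Nat.zero_le k), Nat.sub_zero]
  rw [Set.mem_ofPred_eq, ecoef, einf, g.2, basePoint, RP.proj_mk, applyProj_lineProj] at hinf
  set c := (R i₀).coeff k with hcdef
  have hc0 : c ≠ 0 := by
    rw [hcdef, hk, coeff_natDegree]; exact leadingCoeff_ne_zero.2 hR
  have hcoef : ∀ i, (R i).coeff k = c := fun i => by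
    have h1 := congrFun hinf i
    have h2 := congrFun hinf i₀
    simp only [Pi.smul_apply, smul_eq_mul, mul_one] at h1 h2
    rw [← h1, h2]
  have hP : ∀ i, (C c⁻¹ * R i).Monic ∧ (C c⁻¹ * R i).natDegree = k := fun i => by
    have hdeg : (R i).natDegree = k := le_antisymm (hle i)
      (le_natDegree_of_ne_zero (by rw [hcoef]; exact hc0))
    refine ⟨?_, by rw [natDegree_C_mul (inv_ne_zero hc0), hdeg]⟩
    rw [Monic, leadingCoeff_C_mul_of_isUnit (inv_ne_zero hc0).isUnit, leadingCoeff, hdeg, hcoef,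
      inv_mul_cancel₀ hc0]
  have e : ∀ x : ℝ, (fun i => (C c⁻¹ * R i).eval x) = c⁻¹ • fun i => (R i).eval x := fun x => by
    ext i; simp
  obtain ⟨y, hy⟩ := RationalLoops.exists_loopMap (fun i => C c⁻¹ * R i) hP fun x => by
    rw [e]; exact smul_ne_zero (inv_ne_zero hc0) (h0 x)
  refine ⟨k, hk ▸ hd i₀, y, loop_ext fun x => ?_⟩
  rw [hy, RP.eq_mk_of_applyProj (h0 x) (h x)]
  exact RP.mk_eq_mk_iff.2 ⟨c⁻¹, (e x).symm⟩

/-- The punctured plane is connected, and at (1, 0) both vectors are (1, 1, 1). -/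
theorem sum_vec_mul_pos (x : (Fin n → ℝ) × (Fin n → ℂ)) (y : (Fin d → ℝ) × (Fin d → ℂ))
    (h : ∀ w : Fin 2 → ℝ, w ≠ 0 → ∑ i, vec x w i * vec y w i ≠ 0) {w : Fin 2 → ℝ} (hw : w ≠ 0) :
    0 < ∑ i, vec x w i * vec y w i := by
  have hcont : Continuous fun w : Fin 2 → ℝ => ∑ i, vec x w i * vec y w i := by
    have h1 : Continuous fun w : Fin 2 → ℝ => vec x w :=
      continuous_vec.comp (f := fun w : Fin 2 → ℝ => (x, w)) (by fun_prop)
    have h2 : Continuous fun w : Fin 2 → ℝ => vec y w :=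
      continuous_vec.comp (f := fun w : Fin 2 → ℝ => (y, w)) (by fun_prop)
    fun_prop
  have hconn : IsPreconnected ({0}ᶜ : Set (Fin 2 → ℝ)) :=
    (isConnected_compl_singleton_of_one_lt_rank (by simp) 0).isPreconnected
  by_contra hle
  have h10 : (![1, 0] : Fin 2 → ℝ) ≠ 0 := fun h => one_ne_zero (congrFun h 0)
  have := hconn.intermediate_value (a := w) (b := ![1, 0]) hw h10 hcont.continuousOn
    (show (0 : ℝ) ∈ _ from ⟨not_lt.1 hle, by simp [vec_infinity]⟩)
  obtain ⟨v, hv, hv0⟩ := this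
  exact h v hv hv0

theorem exists_loopMap_eq_mul (j : ℕ) (y : ratTuple d) :
    ∃ y' : ratTuple (d + 2 * j), loopMap (d + 2 * j) y' = loopMap d y := by
  have hq : (X ^ 2 + 1 : ℝ[X]).Monic := by monicity!
  have hqd : (X ^ 2 + 1 : ℝ[X]).natDegree = 2 := by compute_degree!
  have he : ∀ x : ℝ, (fun i => (monicPoly (triple y.1 i) * (X ^ 2 + 1) ^ j).eval x) =
      (x ^ 2 + 1) ^ j • vec y.1 ![x, 1] := fun x => by
    ext i
    simp [vec, pev_eq_eval, mul_comm]
  have hx : ∀ x : ℝ, ((x ^ 2 + 1) ^ j : ℝ) ≠ 0 := fun x => by positivity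
  have hv : ∀ x : ℝ, (![x, 1] : Fin 2 → ℝ) ≠ 0 := fun x h => one_ne_zero (congrFun h 1)
  obtain ⟨y', hy'⟩ := exists_loopMap (n := d + 2 * j)
    (fun i => monicPoly (triple y.1 i) * (X ^ 2 + 1) ^ j)
    (fun i => ⟨(monic_monicPoly _).mul (hq.pow j), by
      rw [(monic_monicPoly _).natDegree_mul (hq.pow j), natDegree_monicPoly, hq.natDegree_pow, hqd,
        mul_comm]⟩) fun x => by
      rw [he]; exact smul_ne_zero (hx x) (vec_ne_zero y.2 (hv x))
  refine ⟨y', loop_ext fun x => ?_⟩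
  rw [hy']
  exact RP.mk_eq_mk_iff.2 ⟨(x ^ 2 + 1) ^ j, (he x).symm⟩

/-- The reduced triple has some degree d ≤ n. A nearby loop of exact degree n is nowhere orthogonal
to it, which forces n + d to be even, and the missing degree is filled with powers of x² + 1. -/
theorem exists_loopMap_eq {g : LoopRP 2} (hg : g ∈ rat n 2) : ∃ y : ratTuple n, loopMap n y = g := by
  obtain ⟨Q, hQ, hQd, hQr⟩ := represents_of_mem_rat hg
  obtain ⟨R, hR, hRd, hRr⟩ := hQr.exists_no_common_zero n Q hQ hQd
  obtain ⟨d, hdn, y, rfl⟩ := hRr.exists_loopMap hR hRd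
  have hopen : IsOpen {f : LoopRP 2 | ∀ ℓ ∈ (Set.univ : Set (RP 1)), (f, ℓ) ∈
      {q : LoopRP 2 × RP 1 | ∑ i, ∑ j, (q.1.1 q.2).proj i j * ((loopMap d y).1 q.2).proj i j ≠ 0}} := by
    refine isOpen_setOf_forall_mem_compact isCompact_univ (isOpen_ne_fun ?_ continuous_const)
    have h1 : Continuous fun q : LoopRP 2 × RP 1 => (q.1.1 q.2).proj := by
      refine RP.continuous_proj.comp ?_
      fun_prop
    have h2 : Continuous fun q : LoopRP 2 × RP 1 => ((loopMap d y).1 q.2).proj := by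
      refine RP.continuous_proj.comp ?_
      fun_prop
    fun_prop
  obtain ⟨f, hf, p, hp, -, hfp⟩ := mem_closure_iff.1 hg _ hopen (by
    intro ℓ _
    obtain ⟨w, hw, rfl⟩ := RP.exists_mk ℓ
    have := sum_sq_pos (vec_ne_zero y.2 hw)
    simp only [Set.mem_ofPred_eq, loopMap_mk, RP.proj_mk, sum_lineProj_mul]
    simp only [← sq]
    positivity)
  obtain ⟨x, hx⟩ := exists_loopMap p hp fun t => (hfp t).choose
  obtain rfl : f = loopMap n x := loop_ext fun t => by rw [hx]; exact (hfp t).choose_spec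
  have hne : ∀ w : Fin 2 → ℝ, w ≠ 0 → ∑ i, vec x.1 w i * vec y.1 w i ≠ 0 := fun w hw h0 => by
    have := hf (RP.mk w hw) trivial
    simp only [Set.mem_ofPred_eq, loopMap_mk, RP.proj_mk, sum_lineProj_mul, h0] at this
    simp at this
  -- At (-1, 0) the inner product is 3(-1)^(n + d), and it has to be positive.
  have hm : ((-1 : ℝ) • ![1, 0] : Fin 2 → ℝ) ≠ 0 := fun h => by
    have := congrFun h 0
    simp at this
  have hpos := sum_vec_mul_pos x.1 y.1 hne hm
  rw [vec_smul, vec_smul, vec_infinity, vec_infinity] at hpos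
  have hpos' : (0 : ℝ) < (-1) ^ (n + d) := by
    simp only [Pi.smul_apply, smul_eq_mul, mul_one, ← pow_add, Finset.sum_const] at hpos
    simpa using hpos
  have heven : Even (n + d) := by
    by_contra h
    rw [(Nat.not_even_iff_odd.1 h).neg_one_pow] at hpos'
    norm_num at hpos'
  obtain ⟨j, rfl⟩ : ∃ j, n = d + 2 * j := by
    obtain ⟨k, hk⟩ := heven
    exact ⟨(n - d) / 2, by omega⟩
  exact exists_loopMap_eq_mul j y

theorem mem_rat_iff (hn : 0 < n) {g : LoopRP 2} : g ∈ rat n 2 ↔ ∃ y : ratTuple n, loopMap n y = g :=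
  ⟨exists_loopMap_eq, by rintro ⟨y, rfl⟩; exact loopMap_mem_rat hn y⟩

theorem rat_subset (hd : 0 < d) (j : ℕ) : rat d 2 ⊆ rat (d + 2 * j) 2 := by
  intro g hg
  obtain ⟨y, rfl⟩ := exists_loopMap_eq hg
  obtain ⟨y', hy'⟩ := exists_loopMap_eq_mul j y
  exact (mem_rat_iff (by omega)).2 ⟨y', hy'⟩

end Range

end

section

open unitInterval Filter Topology

/-! ### Homotopy equivalence of tuples and loops -/

section Equivalence

variable {n : ℕ}

theorem vec_combo (x y : (Fin n → ℝ) × (Fin n → ℂ)) {a b : ℝ} (h : a + b = 1) (w : Fin 2 → ℝ) :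
    vec (a • x + b • y) w = a • vec x w + b • vec y w := by
  have h1 : ∀ i, triple (a • x + b • y) i = a • triple x i + b • triple y i := fun i => by
    fin_cases i <;> ext j <;> simp [triple] <;> ring
  ext i
  simp only [vec, h1, pev_combo _ _ h, Pi.add_apply, Pi.smul_apply, smul_eq_mul]

/-- The Euclidean length of a vector. -/
noncomputable def elen (a : Fin 3 → ℝ) : ℝ := ‖WithLp.toLp 2 a‖

theorem elen_sq (a : Fin 3 → ℝ) : elen a ^ 2 = ∑ i, a i ^ 2 := by
  rw [elen, EuclideanSpace.real_norm_sq_eq]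

theorem elen_nonneg (a : Fin 3 → ℝ) : 0 ≤ elen a := norm_nonneg _

theorem elen_combo_le (a b : Fin 3 → ℝ) {s t : ℝ} (hs : 0 ≤ s) (ht : 0 ≤ t) :
    elen (s • a + t • b) ≤ s * elen a + t * elen b := by
  rw [elen, WithLp.toLp_add, WithLp.toLp_smul, WithLp.toLp_smul]
  refine (norm_add_le _ _).trans_eq ?_
  rw [norm_smul, norm_smul, Real.norm_of_nonneg hs, Real.norm_of_nonneg ht, elen, elen]

/-- The triples that make an angle of cosine more than `r` with the triple `y`. -/
def cone (y : (Fin n → ℝ) × (Fin n → ℂ)) (r : ℝ) : Set ((Fin n → ℝ) × (Fin n → ℂ)) :=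
  {x | ∀ w : Fin 2 → ℝ, w ≠ 0 → r * (elen (vec x w) * elen (vec y w)) < ∑ i, vec x w i * vec y w i}

/-- The inner product is affine and the length convex along segments of triples, so the inequality
is inherited for `r` ≥ 0. -/
theorem convex_cone (y : (Fin n → ℝ) × (Fin n → ℂ)) {r : ℝ} (hr : 0 ≤ r) :
    Convex ℝ (cone y r) := by
  refine convex_iff_forall_pos.2 fun x hx x' hx' a b ha hb hab w hw => ?_
  have h1 := mul_lt_mul_of_pos_left (hx w hw) ha
  have h2 := mul_lt_mul_of_pos_left (hx' w hw) hb
  have h3 := mul_le_mul_of_nonneg_left (mul_le_mul_of_nonneg_right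
    (elen_combo_le (vec x w) (vec x' w) ha.le hb.le) (elen_nonneg (vec y w))) hr
  have h4 : ∑ i, vec (a • x + b • x') w i * vec y w i =
      a * ∑ i, vec x w i * vec y w i + b * ∑ i, vec x' w i * vec y w i := by
    rw [vec_combo _ _ hab, Finset.mul_sum, Finset.mul_sum, ← Finset.sum_add_distrib]
    exact Finset.sum_congr rfl fun i _ => by simp; ring
  rw [h4, vec_combo _ _ hab]
  refine h3.trans_lt ?_
  linarith

theorem pos_of_mem_cone {x y : (Fin n → ℝ) × (Fin n → ℂ)} {r : ℝ} (hr : 0 ≤ r)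
    (h : x ∈ cone y r) {w : Fin 2 → ℝ} (hw : w ≠ 0) : 0 < ∑ i, vec x w i * vec y w i :=
  (mul_nonneg hr (mul_nonneg (elen_nonneg _) (elen_nonneg _))).trans_lt (h w hw)

theorem mem_ratTuple_of_pos {x y : (Fin n → ℝ) × (Fin n → ℂ)}
    (h : ∀ w : Fin 2 → ℝ, w ≠ 0 → 0 < ∑ i, vec x w i * vec y w i) : x ∈ ratTuple n :=
  mem_ratTuple_of_vec fun t h0 => by
    have := h ![t, 1] fun h => one_ne_zero (congrFun h 1)
    simp [h0] at this

theorem mem_ratTuple_of_mem_cone {x y : (Fin n → ℝ) × (Fin n → ℂ)} {r : ℝ} (hr : 0 ≤ r)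
    (h : x ∈ cone y r) : x ∈ ratTuple n :=
  mem_ratTuple_of_pos fun _ hw => pos_of_mem_cone hr h hw

/-- The map from triples of polynomials to the space of real rational loops. -/
noncomputable def loopRat (hn : 0 < n) : C(ratTuple n, rat n 2) where
  toFun x := ⟨loopMap n x, loopMap_mem_rat hn x⟩
  continuous_toFun := by fun_prop

/-- A choice of polynomials for each rational loop. -/
noncomputable def choiceTuple (f : rat n 2) : ratTuple n := (exists_loopMap_eq f.2).choose

theorem loopMap_choiceTuple (f : rat n 2) : loopMap n (choiceTuple f) = f.1 :=
  (exists_loopMap_eq f.2).choose_spec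

/-- No continuity of `choiceTuple` is claimed. The squared cosine, however, depends continuously on
the loops alone, and monic normalisation at infinity fixes the sign of the cosine. -/
theorem eventually_mem_cone (f₀ : rat n 2) (s₀ : Set.Ioc (0 : ℝ) 1) :
    ∀ᶠ q : rat n 2 × Set.Ioc (0 : ℝ) 1 in 𝓝 (f₀, s₀),
      (choiceTuple f₀).1 ∈ cone (choiceTuple q.1).1 (1 - q.2.1) := by
  have hopen : IsOpen {q : rat n 2 × Set.Ioc (0 : ℝ) 1 | ∀ ℓ ∈ (Set.univ : Set (RP 1)), (q, ℓ) ∈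
      {r : (rat n 2 × Set.Ioc (0 : ℝ) 1) × RP 1 | (1 - r.1.2.1) ^ 2 <
        ∑ i, ∑ j, (f₀.1.1 r.2).proj i j * (r.1.1.1.1 r.2).proj i j}} := by
    refine isOpen_setOf_forall_mem_compact isCompact_univ (isOpen_lt (by fun_prop) ?_)
    have h1 : Continuous fun r : (rat n 2 × Set.Ioc (0 : ℝ) 1) × RP 1 => (f₀.1.1 r.2).proj := by
      refine RP.continuous_proj.comp ?_
      fun_prop
    have h2 : Continuous fun r : (rat n 2 × Set.Ioc (0 : ℝ) 1) × RP 1 => (r.1.1.1.1 r.2).proj := by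
      refine RP.continuous_proj.comp ?_
      fun_prop
    fun_prop
  have hmem := hopen.mem_nhds (x := (f₀, s₀)) (by
    intro ℓ _
    obtain ⟨v, hv, h⟩ := RP.exists_mk (f₀.1.1 ℓ)
    have := (sum_sq_pos hv).ne'
    simp only [Set.mem_ofPred_eq, ← h, RP.proj_mk, sum_lineProj_mul]
    simp only [← sq]
    rw [div_self (by positivity)]
    have h1 := s₀.2.1
    have h2 := s₀.2.2
    nlinarith)
  filter_upwards [hmem] with q hq
  have hs1 := q.2.2.2
  have key : ∀ w : Fin 2 → ℝ, w ≠ 0 →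
      (1 - q.2.1) ^ 2 * (elen (vec (choiceTuple f₀).1 w) * elen (vec (choiceTuple q.1).1 w)) ^ 2 <
        (∑ i, vec (choiceTuple f₀).1 w i * vec (choiceTuple q.1).1 w i) ^ 2 := by
    intro w hw
    have h1 := hq (RP.mk w hw) trivial
    simp only [← loopMap_choiceTuple, loopMap_mk, RP.proj_mk, sum_lineProj_mul] at h1
    have h2 := sum_sq_pos (vec_ne_zero (choiceTuple f₀).2 hw)
    have h3 := sum_sq_pos (vec_ne_zero (choiceTuple q.1).2 hw)
    rwa [lt_div_iff₀ (mul_pos h2 h3), ← elen_sq, ← elen_sq, ← mul_pow] at h1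
  intro w hw
  have hpos := sum_vec_mul_pos (choiceTuple f₀).1 (choiceTuple q.1).1 (fun v hv h0 => by
    have := key v hv
    rw [h0, zero_pow two_ne_zero] at this
    exact absurd this (not_lt.2 (by positivity))) hw
  refine lt_of_pow_lt_pow_left₀ 2 hpos.le ?_
  rw [mul_pow]
  exact key w hw

/-- Convex values and locally constant solutions on a metrizable space allow patching by a partition
of unity. The parameter s makes the approximation of the loop as close as desired. -/
theorem exists_continuous_choice (n : ℕ) : ∃ g : C(rat n 2 × Set.Ioc (0 : ℝ) 1,
    (Fin n → ℝ) × (Fin n → ℂ)), ∀ q, g q ∈ cone (choiceTuple q.1).1 (1 - q.2.1) := by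
  have : TopologicalSpace.MetrizableSpace (LoopRP 2) :=
    Topology.IsEmbedding.subtypeVal.metrizableSpace
  have : TopologicalSpace.MetrizableSpace (rat n 2) :=
    Topology.IsEmbedding.subtypeVal.metrizableSpace
  let _ := TopologicalSpace.metrizableSpaceMetric (rat n 2 × Set.Ioc (0 : ℝ) 1)
  exact exists_continuous_forall_mem_convex_of_local_const
    (fun q => convex_cone _ (sub_nonneg.2 q.2.2.2)) fun q => ⟨_, eventually_mem_cone q.1 q.2⟩

theorem abs_proj_sub_le_of_mem_cone (f : rat n 2) {x : ratTuple n} {s : ℝ} (h0 : 0 < s) (h1 : s ≤ 1)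
    (hx : x.1 ∈ cone (choiceTuple f).1 (1 - s)) (ℓ : RP 1) (i j : Fin 3) :
    (((loopMap n x).1 ℓ).proj i j - (f.1.1 ℓ).proj i j) ^ 2 ≤ 4 * s := by
  obtain ⟨w, hw, rfl⟩ := RP.exists_mk ℓ
  rw [← loopMap_choiceTuple f, loopMap_mk, loopMap_mk, RP.proj_mk, RP.proj_mk]
  have hx0 := vec_ne_zero x.2 hw
  have hy0 := vec_ne_zero (choiceTuple f).2 hw
  refine (abs_lineProj_sub_le hx0 hy0 i j).trans ?_
  have h2 := pow_le_pow_left₀ (mul_nonneg (sub_nonneg.2 h1)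
    (mul_nonneg (elen_nonneg _) (elen_nonneg _))) (hx w hw).le 2
  have h3 : (1 - s) ^ 2 ≤ (∑ k, vec x.1 w k * vec (choiceTuple f).1 w k) ^ 2 /
      ((∑ k, vec x.1 w k ^ 2) * ∑ k, vec (choiceTuple f).1 w k ^ 2) := by
    rw [le_div_iff₀ (mul_pos (sum_sq_pos hx0) (sum_sq_pos hy0)), ← elen_sq, ← elen_sq, ← mul_pow,
      ← mul_pow]
    exact h2
  -- 2 - 2(1 - s)² = 4s - 2s² ≤ 4s.
  nlinarith

/-- As s tends to 0 the selected loops converge uniformly to the given one, so setting the value at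
s = 0 to the loop itself extends the selection to a homotopy. -/
theorem homotopic_loopRat_comp (hn : 0 < n) {g : C(rat n 2 × Set.Ioc (0 : ℝ) 1, ratTuple n)}
    (hg : ∀ q, (g q).1 ∈ cone (choiceTuple q.1).1 (1 - q.2.1)) :
    (ContinuousMap.id (rat n 2)).Homotopic
      ((loopRat hn).comp (g.comp ⟨fun f => (f, ⟨1, one_pos, le_rfl⟩), by fun_prop⟩)) := by
  classical
  let H : I × rat n 2 → rat n 2 := fun q =>
    if h : 0 < (q.1 : ℝ) then loopRat hn (g (q.2, ⟨q.1, h, q.1.2.2⟩)) else q.2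
  have hH0 : ∀ f, H (0, f) = f := fun f => by simp [H]
  have hHpos : ∀ q (h : 0 < (q.1 : ℝ)), H q = loopRat hn (g (q.2, ⟨q.1, h, q.1.2.2⟩)) :=
    fun q h => dif_pos h
  have hbound : ∀ (q : I × rat n 2) ℓ i j,
      (((H q).1.1 ℓ).proj i j - (q.2.1.1 ℓ).proj i j) ^ 2 ≤ 4 * q.1 := by
    intro q ℓ i j
    by_cases h : 0 < (q.1 : ℝ)
    · rw [hHpos q h]
      exact abs_proj_sub_le_of_mem_cone q.2 h q.1.2.2 (hg (q.2, ⟨q.1, h, q.1.2.2⟩)) ℓ i j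
    · have : H q = q.2 := dif_neg h
      rw [this, sub_self, zero_pow two_ne_zero]
      exact mul_nonneg zero_le_four q.1.2.1
  have hH : Continuous H := by
    refine Continuous.subtype_mk (Continuous.subtype_mk (f := fun q => (H q).1.1) ?_ _) _
    refine ContinuousMap.continuous_of_continuous_uncurry _ ?_
    rw [RP.isClosedEmbedding_proj.isEmbedding.isInducing.continuous_iff]
    refine continuous_pi fun i => continuous_pi fun j => continuous_iff_continuousAt.2 fun q₀ => ?_
    have hB : Continuous fun q : (I × rat n 2) × RP 1 => (q.1.2.1.1 q.2).proj i j := by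
      have : Continuous fun q : (I × rat n 2) × RP 1 => (q.1.2.1.1 q.2).proj := by
        refine RP.continuous_proj.comp ?_
        fun_prop
      fun_prop
    by_cases h : 0 < (q₀.1.1 : ℝ)
    · have hU : IsOpen {q : (I × rat n 2) × RP 1 | 0 < (q.1.1 : ℝ)} :=
        isOpen_lt continuous_const (by fun_prop)
      refine ContinuousOn.continuousAt (s := {q : (I × rat n 2) × RP 1 | 0 < (q.1.1 : ℝ)}) ?_
        (hU.mem_nhds h)
      rw [continuousOn_iff_continuous_domRestrict]
      have hc : Continuous fun q : {q : (I × rat n 2) × RP 1 | 0 < (q.1.1 : ℝ)} =>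
          ((loopMap n (g (q.1.1.2, ⟨q.1.1.1, q.2, q.1.1.1.2.2⟩))).1 q.1.2).proj := by
        refine RP.continuous_proj.comp ?_
        have h1 : Continuous fun q : {q : (I × rat n 2) × RP 1 | 0 < (q.1.1 : ℝ)} =>
            loopMap n (g (q.1.1.2, ⟨q.1.1.1, q.2, q.1.1.1.2.2⟩)) := by
          refine (loopMap n).continuous.comp (g.continuous.comp ?_)
          refine Continuous.prodMk (by fun_prop) (Continuous.subtype_mk (by fun_prop) _)
        fun_prop
      have hc' := (continuous_apply_apply i j).comp hc
      refine hc'.congr fun q => ?_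
      change _ = ((H q.1.1).1.1 q.1.2).proj i j
      rw [hHpos q.1.1 q.2]
      rfl
    · have hq0 : (q₀.1.1 : ℝ) = 0 := le_antisymm (not_lt.1 h) q₀.1.1.2.1
      have hlim : Tendsto (fun q : (I × rat n 2) × RP 1 => 4 * (q.1.1 : ℝ)) (𝓝 q₀) (𝓝 0) := by
        have : Continuous fun q : (I × rat n 2) × RP 1 => 4 * (q.1.1 : ℝ) := by fun_prop
        simpa [hq0] using this.tendsto q₀
      have hsq : Tendsto (fun q : (I × rat n 2) × RP 1 =>
          (((H q.1).1.1 q.2).proj i j - (q.1.2.1.1 q.2).proj i j) ^ 2) (𝓝 q₀) (𝓝 0) :=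
        squeeze_zero (fun q => sq_nonneg _) (fun q => hbound q.1 q.2 i j) hlim
      have habs : Tendsto (fun q : (I × rat n 2) × RP 1 =>
          ((H q.1).1.1 q.2).proj i j - (q.1.2.1.1 q.2).proj i j) (𝓝 q₀) (𝓝 0) := by
        rw [tendsto_zero_iff_abs_tendsto_zero]
        have := (Real.continuous_sqrt.tendsto 0).comp hsq
        simpa [Function.comp_def, Real.sqrt_sq_eq_abs] using this
      have hsum := habs.add (hB.tendsto q₀)
      have hval : H q₀.1 = q₀.1.2 := dif_neg h
      simp only [sub_add_cancel, zero_add] at hsum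
      change Tendsto (fun q : (I × rat n 2) × RP 1 => ((H q.1).1.1 q.2).proj i j) (𝓝 q₀)
        (𝓝 (((H q₀.1).1.1 q₀.2).proj i j))
      rw [hval]
      exact hsum
  exact ⟨⟨⟨H, hH⟩, hH0, fun f => hHpos (1, f) one_pos⟩⟩

/-- Polynomial triples and rational loops form homotopy equivalent spaces. -/
theorem exists_homotopyEquiv (hn : 0 < n) :
    ∃ e : ContinuousMap.HomotopyEquiv (ratTuple n) (rat n 2), e.toFun = loopRat hn := by
  obtain ⟨g₀, hg₀⟩ := exists_continuous_choice n
  let g : C(rat n 2 × Set.Ioc (0 : ℝ) 1, ratTuple n) :=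
    ⟨fun q => ⟨g₀ q, mem_ratTuple_of_mem_cone (sub_nonneg.2 q.2.2.2) (hg₀ q)⟩, by fun_prop⟩
  let k : C(rat n 2, ratTuple n) := g.comp ⟨fun f => (f, ⟨1, one_pos, le_rfl⟩), by fun_prop⟩
  -- `x` and the chosen triple `y` give the same loop, so at every parameter they are proportional,
  -- with a factor that is positive by `sum_vec_mul_pos`. Being at an acute angle to `y` is thus the
  -- same as to `x`.
  have hk : ∀ x w, w ≠ 0 → 0 < ∑ i, vec (k (loopRat hn x)).1 w i * vec x.1 w i := by
    intro x w hw
    set y := choiceTuple (loopRat hn x) with hy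
    have hxy : loopMap n y = loopMap n x := loopMap_choiceTuple _
    have hmul : ∀ v : Fin 2 → ℝ, v ≠ 0 → ∃ c : ℝ, vec y.1 v = c • vec x.1 v := fun v hv => by
      have h1 := congrArg (fun f : LoopRP 2 => f.1 (RP.mk v hv)) hxy
      simp only [loopMap_mk] at h1
      obtain ⟨c, hc⟩ := RP.mk_eq_mk_iff.1 h1
      exact ⟨c, hc.symm⟩
    have hs : ∀ v c, vec y.1 v = c • vec x.1 v →
        ∑ i, vec x.1 v i * vec y.1 v i = c * ∑ i, vec x.1 v i ^ 2 := fun v c hc => by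
      rw [hc, Finset.mul_sum]
      exact Finset.sum_congr rfl fun i _ => by simp; ring
    have h2 := sum_vec_mul_pos x.1 y.1 (fun v hv h0 => by
      obtain ⟨c, hc⟩ := hmul v hv
      rw [hs v c hc] at h0
      have hc0 := (mul_eq_zero.1 h0).resolve_right (sum_sq_pos (vec_ne_zero x.2 hv)).ne'
      exact vec_ne_zero y.2 hv (by rw [hc, hc0, zero_smul])) hw
    obtain ⟨c, hc⟩ := hmul w hw
    rw [hs w c hc] at h2
    have hcpos : 0 < c := (pos_iff_pos_of_mul_pos h2).2 (sum_sq_pos (vec_ne_zero x.2 hw))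
    have h3 : 0 < ∑ i, vec (k (loopRat hn x)).1 w i * vec y.1 w i := pos_of_mem_cone (sub_nonneg.2 le_rfl)
      (hg₀ (loopRat hn x, ⟨1, one_pos, le_rfl⟩)) hw
    have h4 : ∑ i, vec (k (loopRat hn x)).1 w i * vec y.1 w i =
        c * ∑ i, vec (k (loopRat hn x)).1 w i * vec x.1 w i := by
      rw [hc, Finset.mul_sum]
      exact Finset.sum_congr rfl fun i _ => by simp; ring
    rw [h4] at h3
    exact (pos_iff_pos_of_mul_pos h3).1 hcpos
  refine ⟨⟨loopRat hn, k, ?_, (homotopic_loopRat_comp hn (g := g) hg₀).symm⟩, rfl⟩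
  -- Both ends are at an acute angle to `x` at every parameter, hence so is the whole segment; in
  -- particular it never vanishes.
  have hmem : ∀ q : I × ratTuple n,
      (1 - (q.1 : ℝ)) • (k (loopRat hn q.2)).1 + (q.1 : ℝ) • q.2.1 ∈ ratTuple n := by
    rintro ⟨s, x⟩
    refine mem_ratTuple_of_pos (y := x.1) fun w hw => ?_
    have h1 := hk x w hw
    have h2 := sum_sq_pos (vec_ne_zero x.2 hw)
    have h4 : ∑ i, vec ((1 - (s : ℝ)) • (k (loopRat hn x)).1 + (s : ℝ) • x.1) w i * vec x.1 w i =
        (1 - (s : ℝ)) * ∑ i, vec (k (loopRat hn x)).1 w i * vec x.1 w i +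
          s * ∑ i, vec x.1 w i ^ 2 := by
      rw [vec_combo _ _ (sub_add_cancel _ _), Finset.mul_sum, Finset.mul_sum,
        ← Finset.sum_add_distrib]
      exact Finset.sum_congr rfl fun i _ => by simp; ring
    rw [h4]
    rcases eq_or_lt_of_le s.2.1 with h | h
    · rw [← h]; linarith
    · have := mul_pos h h2
      have := mul_nonneg (sub_nonneg.2 s.2.2) h1.le
      linarith
  exact ⟨⟨⟨fun q => ⟨_, hmem q⟩, by fun_prop⟩, fun x => Subtype.ext (by simp), fun x =>
    Subtype.ext (by simp)⟩⟩

end Equivalence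

end

section

open unitInterval

/-! ### The fundamental group and the inclusions -/

section Main

variable {n : ℕ}

theorem bijective_map_comp_iff {X Y Z : Type*} [TopologicalSpace X] [TopologicalSpace Y]
    [TopologicalSpace Z] (g : C(Y, Z)) (f : C(X, Y)) (x : X)
    (hf : Function.Bijective (FundamentalGroup.map f x)) :
    Function.Bijective (FundamentalGroup.map (g.comp f) x) ↔
      Function.Bijective (FundamentalGroup.map g (f x)) := by
  have : ⇑(FundamentalGroup.map (g.comp f) x) =
      FundamentalGroup.map g (f x) ∘ FundamentalGroup.map f x :=
    _root_.funext (groupMap_comp_apply _ _ x)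
  rw [this]
  exact Function.Bijective.of_comp_iff _ hf

theorem bijective_map_loopRat (hn : 0 < n) (x : ratTuple n) :
    Function.Bijective (FundamentalGroup.map (loopRat hn) x) := by
  obtain ⟨e, he⟩ := exists_homotopyEquiv hn
  rw [← he]
  exact bijective_map_homotopyEquiv e x

theorem pathConnectedSpace_rat (hn : 0 < n) : PathConnectedSpace (rat n 2) := by
  have := pathConnectedSpace_ratTuple hn
  have hs : Function.Surjective (loopRat hn) := fun f =>
    ⟨choiceTuple f, Subtype.ext (loopMap_choiceTuple f)⟩
  exact hs.pathConnectedSpace (loopRat hn).continuous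

theorem mem_circleData_odd (hn : 0 < n) (p : Fin n → ℝ) : (p, oneCoef n ℝ) ∈ circleData n :=
  fun x _ => by rw [hev_one_real hn]; norm_num

theorem mem_circleData_even {p e : Fin n → ℝ} (hp : pev p 0 1 < 0)
    (he : ∀ x, hev e x 1 = (x + 1) / 2) : (p, e) ∈ circleData n := by
  intro x hx h
  rw [he] at h
  obtain rfl : x = 0 := by linarith
  exact hp.ne hx

theorem exists_even_data (hn : 0 < n) (heven : Even n) :
    ∃ p e : Fin n → ℝ, pev p 0 1 < 0 ∧ ∀ x, hev e x 1 = (x + 1) / 2 := by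
  obtain ⟨p, hp⟩ := exists_shifted_pow hn 0 (-1)
  obtain ⟨e, he⟩ := exists_half_line (n := n) (by obtain ⟨k, rfl⟩ := heven; omega) 0
  exact ⟨p, e, by rw [hp]; simp [hn.ne'], fun x => by rw [he]; simp⟩

theorem nonempty_fundamentalGroup_rat (hn : 0 < n) (f : rat n 2) :
    Nonempty (FundamentalGroup (rat n 2) f ≃* Multiplicative ℤ) := by
  obtain ⟨x, c, hc⟩ : ∃ (x : Circle) (c : C(Circle, ratTuple n)),
      Function.Bijective (FundamentalGroup.map c x) := by
    rcases Nat.even_or_odd n with heven | hodd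
    · obtain ⟨p, e, hp, he⟩ := exists_even_data hn heven
      exact ⟨1, _, bijective_map_circleMap_even hn heven hp he (mem_circleData_even hp he)⟩
    · exact ⟨1, _, bijective_map_circleMap_odd hodd 0 (mem_circleData_odd hn 0)⟩
  have h := (bijective_map_comp_iff (loopRat hn) c x hc).2 (bijective_map_loopRat hn _)
  obtain ⟨i⟩ := nonempty_fundamentalGroup_circle_mulEquiv x
  have := pathConnectedSpace_rat hn
  exact ⟨(FundamentalGroup.fundamentalGroupMulEquivOfPathConnected f _).trans
    ((MulEquiv.ofBijective _ h).symm.trans i)⟩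

/-- The loops of the circle for degree k do not change when the tuples are multiplied by (x² + 1)^j.
The multiplied circle is homotopic to the one for degree k + 2j, so every other map in the
commutative square is bijective on fundamental groups. Path-connectedness then frees the base point.
-/
theorem bijective_map_ratInclusion {k j : ℕ} (hk : 0 < k) (hn : 0 < k + 2 * j)
    (h : rat k 2 ⊆ rat (k + 2 * j) 2) {p e : Fin k → ℝ} {p' e' : Fin (k + 2 * j) → ℝ}
    (hd : (p, e) ∈ circleData k) (hd' : (p', e') ∈ circleData (k + 2 * j))
    (hp : ∀ x, pev p' x 1 = (x ^ 2 + 1) ^ j * pev p x 1)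
    (he : ∀ x, hev e' x 1 = hev e x 1)
    (hb : Function.Bijective (FundamentalGroup.map (circleMap hk hd) 1))
    (hb' : Function.Bijective (FundamentalGroup.map (circleMap hn hd') 1)) (f : rat k 2) :
    Function.Bijective (FundamentalGroup.map (ratInclusion h) f) := by
  have hq : ((X ^ 2 + 1 : ℝ[X]) ^ j).natDegree = 2 * j := by
    rw [natDegree_pow, show (X ^ 2 + 1 : ℝ[X]).natDegree = 2 by compute_degree!, mul_comm]
  have hq0 : (X ^ 2 + 1 : ℝ[X]) ^ j ≠ 0 := pow_ne_zero _ (by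
    apply Monic.ne_zero; monicity!)
  obtain ⟨A, hA⟩ := exists_hev_eq_real (n := k + 2 * j) ((X ^ 2 + 1) ^ j) (by
    rw [degree_eq_natDegree hq0, hq]
    exact_mod_cast (by omega : 2 * j < k + 2 * j))
  obtain ⟨B, hB⟩ := exists_hev_eq_real (n := k + 2 * j) (lowPoly e * (X ^ 2 + 1) ^ j) (by
    rw [degree_mul, degree_eq_natDegree hq0, hq, Nat.cast_add]
    exact WithBot.add_lt_add_right (WithBot.natCast_ne_bot _) (degree_lowPoly e))
  simp only [eval_mul, eval_pow, eval_add, eval_X, eval_one, ← hev_eq_eval_real] at hA hB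
  -- From (x² + 1)^j (1 + (z - 1)e) to 1 + (z - 1)e' on a segment: since `e` and `e'` take the same
  -- values, only the positive factor in front changes.
  let L : I × Circle → Fin (k + 2 * j) → ℂ := fun q =>
    (1 - (q.1 : ℂ)) • ((fun i => (A i : ℂ)) + ((q.2 : ℂ) - 1) • fun i => (B i : ℂ)) +
      (q.1 : ℂ) • circleCoef e' q.2
  have hLval : ∀ q x, hev (L q) x 1 =
      (((1 - (q.1 : ℝ)) * (x ^ 2 + 1) ^ j + q.1 : ℝ) : ℂ) *
        (1 + ((q.2 : ℂ) - 1) * (hev e x 1 : ℝ)) := fun q x => by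
    simp only [L]
    rw [hev_add, hev_smul, hev_smul, hev_add, hev_smul, hev_ofReal, hev_ofReal,
      hev_circleCoef hn, hA, hB, he]
    simp only [smul_eq_mul]
    push_cast
    ring
  have hLmem : ∀ q, (p', L q) ∈ ratTuple (k + 2 * j) := fun q => mem_ratTuple.2 fun x hx => by
    rw [hLval]
    refine mul_ne_zero (Complex.ofReal_ne_zero.2 ?_) (one_add_mul_ne_zero ?_)
    · have h0 := q.1.2.1
      have h1 := q.1.2.2
      have h2 : (1 : ℝ) ≤ (x ^ 2 + 1) ^ j := one_le_pow₀ (by nlinarith [sq_nonneg x])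
      nlinarith
    · rw [← he]; exact hd' x hx
  have hz : Continuous fun q : I × Circle => (q.2 : ℂ) :=
    continuous_circle_coe.comp continuous_snd
  have hLc : Continuous L :=
    ((by fun_prop : Continuous fun q : I × Circle => (1 - (q.1 : ℂ)) • ((fun i => (A i : ℂ)) +
      ((q.2 : ℂ) - 1) • fun i => (B i : ℂ)))).add ((by fun_prop : Continuous fun q : I × Circle =>
        (q.1 : ℂ)).smul (continuous_circleCoef continuous_const continuous_snd))
  let K : C(I × Circle, ratTuple (k + 2 * j)) := ⟨fun q => ⟨(p', L q), hLmem q⟩, by fun_prop⟩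
  let c' : C(Circle, ratTuple (k + 2 * j)) := K.comp ⟨fun z => (0, z), by fun_prop⟩
  have hhom : c'.Homotopic (circleMap hn hd') :=
    ⟨⟨K, fun z => rfl, fun z => Subtype.ext (Prod.ext rfl (by simp [K, L, circleMap]))⟩⟩
  have hbc' := bijective_map_of_homotopic hhom.symm 1 hb'
  have e1 : (loopRat hn).comp c' = (ratInclusion h).comp ((loopRat hk).comp (circleMap hk hd)) := by
    refine ContinuousMap.ext fun z => Subtype.ext (loop_ext fun x => ?_)
    have hv : (![x, 1] : Fin 2 → ℝ) ≠ 0 := fun h => one_ne_zero (congrFun h 1)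
    change (loopMap _ (c' z)).1 (RP.mk ![x, 1] hv) =
      (loopMap _ (circleMap hk hd z)).1 (RP.mk ![x, 1] hv)
    rw [loopMap_mk, loopMap_mk]
    refine RP.mk_eq_mk_iff.2 ⟨(x ^ 2 + 1) ^ j, ?_⟩
    have h1 : pev (c' z).1.1 x 1 = (x ^ 2 + 1) ^ j * pev (circleMap hk hd z).1.1 x 1 := hp x
    have h2 : hev (c' z).1.2 x 1 =
        (((x ^ 2 + 1) ^ j : ℝ) : ℂ) * hev (circleMap hk hd z).1.2 x 1 := by
      refine (hLval (0, z) x).trans ?_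
      rw [show (circleMap hk hd z).1.2 = circleCoef e z from rfl, hev_circleCoef hk]
      simp
    ext i
    rw [Pi.smul_apply, smul_eq_mul]
    fin_cases i
    · exact h1.symm
    · refine (congrArg _ (vec_one _ _)).trans (Eq.trans ?_ (vec_one _ _).symm)
      simp only [Matrix.cons_val_zero, Matrix.cons_val_one]
      rw [h1, h2, Complex.re_ofReal_mul]
      ring
    · refine (congrArg _ (vec_two _ _)).trans (Eq.trans ?_ (vec_two _ _).symm)
      simp only [Matrix.cons_val_zero, Matrix.cons_val_one]
      rw [h1, h2, Complex.im_ofReal_mul]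
      ring
  have h2 := (bijective_map_comp_iff (loopRat hn) c' 1 hbc').2 (bijective_map_loopRat hn _)
  rw [e1] at h2
  have h3 := (bijective_map_comp_iff (loopRat hk) _ 1 hb).2 (bijective_map_loopRat hk _)
  have h4 := (bijective_map_comp_iff _ _ 1 h3).1 h2
  have := pathConnectedSpace_rat hk
  exact bijective_map_of_joined _ (PathConnectedSpace.joined _ f) h4

theorem exists_mul_pow (k j : ℕ) (p : Fin k → ℝ) :
    ∃ p' : Fin (k + 2 * j) → ℝ, ∀ x, pev p' x 1 = (x ^ 2 + 1) ^ j * pev p x 1 := by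
  have hq : (X ^ 2 + 1 : ℝ[X]).Monic := by monicity!
  have hqd : (X ^ 2 + 1 : ℝ[X]).natDegree = 2 := by compute_degree!
  obtain ⟨p', hp'⟩ := exists_pev_eq (n := k + 2 * j) (monicPoly p * (X ^ 2 + 1) ^ j)
    ((monic_monicPoly _).mul (hq.pow j)) (by
      rw [(monic_monicPoly _).natDegree_mul (hq.pow j), natDegree_monicPoly, hq.natDegree_pow, hqd,
        mul_comm])
  exact ⟨p', fun x => by rw [hp', pev_eq_eval]; simp [mul_comm]⟩

theorem exists_inclusion_odd (hodd : Odd n) : ∃ h : rat 1 2 ⊆ rat n 2, ∀ f : rat 1 2,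
    Function.Bijective (FundamentalGroup.map (ratInclusion h) f) := by
  obtain ⟨j, rfl⟩ : ∃ j, n = 1 + 2 * j := by obtain ⟨j, rfl⟩ := hodd; exact ⟨j, by ring⟩
  obtain ⟨p', hp'⟩ := exists_mul_pow 1 j 0
  exact ⟨rat_subset one_pos j, bijective_map_ratInclusion one_pos hodd.pos _
    (mem_circleData_odd one_pos 0) (mem_circleData_odd hodd.pos p') hp'
    (fun x => by rw [hev_one_real hodd.pos, hev_one_real one_pos])
    (bijective_map_circleMap_odd odd_one _ _) (bijective_map_circleMap_odd hodd _ _)⟩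

theorem exists_inclusion_even (hn : 0 < n) (heven : Even n) :
    ∃ h : rat 2 2 ⊆ rat n 2, ∀ f : rat 2 2,
      Function.Bijective (FundamentalGroup.map (ratInclusion h) f) := by
  obtain ⟨j, rfl⟩ : ∃ j, n = 2 + 2 * j := by
    obtain ⟨j, rfl⟩ := heven; exact ⟨j - 1, by omega⟩
  obtain ⟨p, e, hp, he⟩ := exists_even_data two_pos even_two
  obtain ⟨p', hp'⟩ := exists_mul_pow 2 j p
  obtain ⟨-, e', -, he'⟩ := exists_even_data hn heven
  have hp0 : pev p' 0 1 < 0 := by rw [hp']; simpa using hp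
  exact ⟨rat_subset two_pos j, bijective_map_ratInclusion two_pos hn _
    (mem_circleData_even hp he) (mem_circleData_even hp0 he') hp' (fun x => by rw [he, he'])
    (bijective_map_circleMap_even two_pos even_two hp he _)
    (bijective_map_circleMap_even hn heven hp0 he' _)⟩

end Main

end

end RationalLoops

theorem mainTheorem6 (n : ℕ) (hn : 0 < n) :
    PathConnectedSpace (RationalLoops.rat n 2) ∧
    (∀ f : RationalLoops.rat n 2,
      Nonempty (FundamentalGroup (RationalLoops.rat n 2) f ≃* Multiplicative ℤ)) ∧
    (Odd n → ∃ h : RationalLoops.rat 1 2 ⊆ RationalLoops.rat n 2,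
      ∀ f : RationalLoops.rat 1 2,
        Function.Bijective (FundamentalGroup.map (RationalLoops.ratInclusion h) f)) ∧
    (Even n → ∃ h : RationalLoops.rat 2 2 ⊆ RationalLoops.rat n 2,
      ∀ f : RationalLoops.rat 2 2,
        Function.Bijective (FundamentalGroup.map (RationalLoops.ratInclusion h) f)) := by
  refine ⟨RationalLoops.pathConnectedSpace_rat hn, RationalLoops.nonempty_fundamentalGroup_rat hn,
    RationalLoops.exists_inclusion_odd, RationalLoops.exists_inclusion_even hn⟩
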